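/- **Setting.** Let $\Sigma=\{0,1\}$ and let $\Sigma^*=\bigcup_{k\ge 1}\Sigma^k$ be the set of finite nonempty strings. A *promise problem* is a function $\phi$ from $\Sigma^*$ to the nonempty subsets of $\Sigma$ ($\phi(s)$ is the set of valid answers on input $s$); a problem $\phi:\Sigma^*\to\Sigma$ is regarded as the promise problem $s\mapsto\{\phi(s)\}$. Write $\phi_1\propto\phi_2$ if there is a function $\mu:\Sigma^*\to\Sigma^*$, computed by a Turing machine in time polynomial in the length of the input, such that $\phi_1(s)\supseteq\phi_2(\mu(s))$ for all $s\in\Sigma^*$. Put $[\phi]=\{\psi\mid\psi\propto\phi\}$, let $\lnot\phi$ be the promise problem $s\mapsto\{1-b\mid b\in\phi(s)\}$, and write $\lnot[\phi]=[\lnot\phi]$. Let $n\ge 1$. An *instance of level $n$* consists of integers $m_1,\dots,m_n\ge 1$ and a Boolean expression, built with $\land,\lor,\lnot$ from variables for the bits of $n$ blocks of lengths $m_1,\dots,m_n$; it describes a function $f:\Sigma^{m_1}\times\cdots\times\Sigma^{m_n}\to\Sigma$. It is encoded as a string by writing each $m_j$ in unary followed by $0$, and then the expression in Polish notation, with $00$,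 $010$, $011$ for $\lnot,\land,\lor$ and $1\,1^{j}\,0\,1^{i}\,0$ for the variable number $i$ of block number $j$, counted from $0$. For $x\in\Sigma^{m_1}$ let $f_x=f(x,\cdot)$. For a constant $c \in \Sigma$ (a function of no blocks) put $\mathrm{SAT}_0(c)=\overline{\mathrm{SAT}}_0(c)=c$, and recursively $$\mathrm{SAT}_n(f)=1\iff\exists x:\overline{\mathrm{SAT}}_{n-1}(f_x)=1,\qquad \overline{\mathrm{SAT}}_n(f)=1\iff\forall x:\mathrm{SAT}_{n-1}(f_x)=1 .$$ Let $W_f=\{x\in\Sigma^{m_1}\mid\overline{\mathrm{SAT}}_{n-1}(f_x)=1\}$, let $\pi_1x$ be the first bit of $x$, and order $\Sigma^{m_1}$ lexicographically, the first bit being the most significant. The following promise problems have the stated value on the encoding of an instance describing $f$ if the stated promise holds, and the value $\Sigma$ if it does not: - $\mathrm{MaxVAL}_n(f)=\{\pi_1\max W_f\}$, promise $\mathrm{SAT}_n(f)=1$; - $\mathrm{MinVAL}_n(f)=\{\pi_1\min W_f\}$, promise $\mathrm{SAT}_n(f)=1$; - $\mathrm{VAL}_n(f)=\{\pi_1x\mid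 x\in W_f\}$, promise $\mathrm{SAT}_n(f)=1$; - $\mathrm{USAT}_n(f)=\{\mathrm{SAT}_n(f)\}$, promise $|W_f|\le 1$; - $\overline{\mathrm{USAT}}_n(f)=\{\overline{\mathrm{SAT}}_n(f)\}$, promise $|\{x\mid\mathrm{SAT}_{n-1}(f_x)=0\}|\le 1$; - $\mathrm{UVAL}_n(f)=\{\pi_1x\mid x\in W_f\}$, promise $|W_f|=1$. On a string that encodes no instance of level $n$, the problems $\mathrm{SAT}_n$ and $\overline{\mathrm{SAT}}_n$ have the answer $0$ and the six promise problems above have the value $\Sigma$. **Theorem.** For every $n\ge 1$, 1. $\lnot[\mathrm{SAT}_n]=[\overline{\mathrm{SAT}}_n]$; 2. $\lnot[\mathrm{MaxVAL}_n]=[\mathrm{MinVAL}_n]$; 3. $\lnot[\mathrm{VAL}_n]=[\mathrm{VAL}_n]$; 4. $\lnot[\mathrm{USAT}_n]=[\overline{\mathrm{USAT}}_n]$; 5. $\lnot[\mathrm{UVAL}_n]=[\mathrm{UVAL}_n]$; 6. $[\mathrm{SAT}_n]=[\mathrm{MaxVAL}_n]$; 7. $\mathrm{UVAL}_n\propto\mathrm{VAL}_n\propto\mathrm{MaxVAL}_n\propto\mathrm{UVAL}_{n+1}$;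 8. $\mathrm{UVAL}_n\propto\mathrm{USAT}_n\propto\mathrm{SAT}_n$. -/

import Mathlib

namespace PromiseHierarchy

/-! ### Strings, promise problems, strong reduction -/

/-- The finite nonempty strings over the alphabet `{0, 1}`. -/
abbrev Str : Type := {s : List Bool // s ≠ []}

/-- The nonempty subsets of the alphabet `{0, 1}`. -/
abbrev Answers : Type := {A : Set Bool // A.Nonempty}

/-- Negation of a nonempty set of answers, elementwise. -/
def Answers.neg (A : Answers) : Answers := ⟨Bool.not '' A.1, A.2.image _⟩

/-- The answer set which is `A` if the promise `P` holds and `{0, 1}` otherwise. -/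
def Answers.promise (P : Prop) (A : Set Bool) (h : P → A.Nonempty) : Answers :=
  ⟨{b | P → b ∈ A}, by
    by_cases hP : P
    · obtain ⟨b, hb⟩ := h hP
      exact ⟨b, fun _ => hb⟩
    · exact ⟨true, fun h' => absurd h' hP⟩⟩

/-- A non-promise problem. -/
abbrev Problem : Type := Str → Bool

/-- A promise problem. -/
abbrev PromiseProblem : Type := Str → Answers

/-- A non-promise problem, regarded as a promise problem with one valid answer per input. -/
def Problem.toPromise (φ : Problem) : PromiseProblem :=
  fun s => ⟨{φ s}, Set.singleton_nonempty _⟩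

/-- The dual of a promise problem. -/
def PromiseProblem.dual (φ : PromiseProblem) : PromiseProblem := fun s => (φ s).neg

/-- `μ` is computed by a Turing machine in time polynomial in the length of the input. -/
def PolyTime (μ : Str → Str) : Prop :=
  Nonempty (Turing.TM2ComputableInPolyTime (Subtype.val : Str → List Bool)
    (Subtype.val : Str → List Bool) μ)

/-- Strong (Karp, many-one) reduction of promise problems. -/
def StrongReduces (φ₁ φ₂ : PromiseProblem) : Prop :=
  ∃ μ : Str → Str, PolyTime μ ∧ ∀ s : Str, (φ₂ (μ s)).1 ⊆ (φ₁ s).1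

/-- The strong closure of a promise problem. -/
def strongClosure (φ : PromiseProblem) : Set PromiseProblem := {ψ | StrongReduces ψ φ}

/-! ### Boolean functions of several blocks of variables -/

/-- Strings of length `m ≥ 1`. -/
abbrev Word (m : ℕ+) : Type := Fin (m : ℕ) → Bool

/-- The first bit of a string. -/
def firstBit {m : ℕ+} (x : Word m) : Bool := x ⟨0, m.pos⟩

/-- `Inputs [m₁, …, mₙ]` is the product of the sets of strings of lengths `m₁, …, mₙ`. -/
@[reducible] def Inputs : List ℕ+ → Type
  | [] => Unit
  | m :: ms => Word m × Inputs ms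

/-- The function `f_x` obtained from `f` by fixing the value `x` of the first argument. -/
def fixFirst {m : ℕ+} {ms : List ℕ+} (f : Inputs (m :: ms) → Bool) (x : Word m) :
    Inputs ms → Bool := fun y => f (x, y)

mutual

/-- The quantified formula `∃ x, ∀ y⁽¹⁾, ∃ y⁽²⁾, …, f(x, y⁽¹⁾, y⁽²⁾, …) = 1`. -/
def SatHolds : (ms : List ℕ+) → (Inputs ms → Bool) → Prop
  | [], f => f () = true
  | m :: ms, f => ∃ x : Word m, CoSatHolds ms (fixFirst f x)

/-- The quantified formula `∀ x, ∃ y⁽¹⁾, ∀ y⁽²⁾, …, f(x, y⁽¹⁾, y⁽²⁾, …) = 1`. -/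
def CoSatHolds : (ms : List ℕ+) → (Inputs ms → Bool) → Prop
  | [], f => f () = true
  | m :: ms, f => ∀ x : Word m, SatHolds ms (fixFirst f x)

end

/-! ### Boolean expressions and their encoding as strings -/

/-- Variables of a function on `Inputs ms`: the `i`-th bit of one of the blocks. -/
inductive Var : List ℕ+ → Type
  | head {m : ℕ+} {ms : List ℕ+} (i : Fin (m : ℕ)) : Var (m :: ms)
  | tail {m : ℕ+} {ms : List ℕ+} (v : Var ms) : Var (m :: ms)

/-- The value of a variable. -/
def Var.eval : {ms : List ℕ+} → Var ms → Inputs ms → Bool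
  | _ :: _, .head i, (x, _) => x i
  | _ :: _, .tail v, (_, y) => v.eval y

/-- The variable with index `i` in block `j` (both counted from `0`) is written `1ʲ 0 1ⁱ 0`. -/
def Var.encode : {ms : List ℕ+} → Var ms → List Bool
  | _ :: _, .head i => false :: (List.replicate (i : ℕ) true ++ [false])
  | _ :: _, .tail v => true :: v.encode

/-- Boolean expressions. -/
inductive Expr (ms : List ℕ+) : Type
  | var (v : Var ms) : Expr ms
  | neg (e : Expr ms) : Expr ms
  | and (e₁ e₂ : Expr ms) : Expr ms
  | or (e₁ e₂ : Expr ms) : Expr ms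

/-- The value of a Boolean expression. -/
def Expr.eval {ms : List ℕ+} : Expr ms → Inputs ms → Bool
  | .var v, x => v.eval x
  | .neg e, x => !(e.eval x)
  | .and e₁ e₂, x => e₁.eval x && e₂.eval x
  | .or e₁ e₂, x => e₁.eval x || e₂.eval x

/-- Boolean expressions are written in Polish (prefix) notation, with the symbols
`00` for `¬`, `010` for `∧`, `011` for `∨`, and `1` in front of a variable. -/
def Expr.encode {ms : List ℕ+} : Expr ms → List Bool
  | .var v => true :: v.encode
  | .neg e => false :: false :: e.encode
  | .and e₁ e₂ => false :: true :: false :: (e₁.encode ++ e₂.encode)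
  | .or e₁ e₂ => false :: true :: true :: (e₁.encode ++ e₂.encode)

/-- An instance of level `n`: block lengths `m₁, …, mₙ` and a Boolean expression. -/
structure Instance (n : ℕ) where
  /-- the length of the first block -/
  m : ℕ+
  /-- the lengths of the other blocks -/
  ms : List ℕ+
  /-- there are `n` blocks -/
  length_eq : ms.length + 1 = n
  /-- the expression -/
  expr : Expr (m :: ms)

/-- The function described by an instance. -/
def Instance.fn {n : ℕ} (F : Instance n) : Inputs (F.m :: F.ms) → Bool := F.expr.eval

/-- Block lengths are written in unary, each followed by a `0`. -/
def encodeSizes : List ℕ+ → List Bool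
  | [] => []
  | k :: ks => List.replicate (k : ℕ) true ++ false :: encodeSizes ks

/-- An instance is written as its `n` block lengths followed by its expression. -/
def Instance.encode {n : ℕ} (F : Instance n) : List Bool :=
  encodeSizes (F.m :: F.ms) ++ F.expr.encode

theorem unary_inj : ∀ {a b : ℕ} {s t : List Bool},
    List.replicate a true ++ false :: s = List.replicate b true ++ false :: t →
      a = b ∧ s = t
  | 0, 0, _, _, h => ⟨rfl, by simpa using h⟩
  | 0, _ + 1, _, _, h => by simp [List.replicate_succ] at h
  | _ + 1, 0, _, _, h => by simp [List.replicate_succ] at h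
  | a + 1, b + 1, s, t, h => by
    have h' : List.replicate a true ++ false :: s = List.replicate b true ++ false :: t := by
      simpa [List.replicate_succ] using h
    obtain ⟨h1, h2⟩ := unary_inj h'
    exact ⟨by rw [h1], h2⟩

theorem Var.encode_inj : ∀ {ms : List ℕ+} (v w : Var ms) {s t : List Bool},
    v.encode ++ s = w.encode ++ t → v = w ∧ s = t
  | _ :: _, .head i, .head j, s, t, h => by
    have h' : List.replicate (i : ℕ) true ++ false :: s =
        List.replicate (j : ℕ) true ++ false :: t := by
      simpa [Var.encode] using h
    obtain ⟨h1, h2⟩ := unary_inj h'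
    exact ⟨by rw [Fin.ext h1], h2⟩
  | _ :: _, .head _, .tail _, _, _, h => by simp [Var.encode] at h
  | _ :: _, .tail _, .head _, _, _, h => by simp [Var.encode] at h
  | _ :: _, .tail v, .tail w, s, t, h => by
    have h' : v.encode ++ s = w.encode ++ t := by simpa [Var.encode] using h
    obtain ⟨h1, h2⟩ := Var.encode_inj v w h'
    exact ⟨by rw [h1], h2⟩

theorem Expr.encode_inj {ms : List ℕ+} : ∀ (d e : Expr ms) {s t : List Bool},
    d.encode ++ s = e.encode ++ t → d = e ∧ s = t := by
  intro d
  induction d with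
  | var v =>
    intro e s t h
    cases e with
    | var w =>
      obtain ⟨h1, h2⟩ := Var.encode_inj v w (by simpa [Expr.encode] using h)
      exact ⟨by rw [h1], h2⟩
    | _ => simp [Expr.encode] at h
  | neg d ih =>
    intro e s t h
    cases e with
    | neg e =>
      obtain ⟨h1, h2⟩ := ih e (by simpa [Expr.encode] using h)
      exact ⟨by rw [h1], h2⟩
    | _ => simp [Expr.encode] at h
  | and d₁ d₂ ih₁ ih₂ =>
    intro e s t h
    cases e with
    | and e₁ e₂ =>
      obtain ⟨h1, h2⟩ := ih₁ e₁ (by simpa [Expr.encode] using h)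
      obtain ⟨h3, h4⟩ := ih₂ e₂ h2
      exact ⟨by rw [h1, h3], h4⟩
    | _ => simp [Expr.encode] at h
  | or d₁ d₂ ih₁ ih₂ =>
    intro e s t h
    cases e with
    | or e₁ e₂ =>
      obtain ⟨h1, h2⟩ := ih₁ e₁ (by simpa [Expr.encode] using h)
      obtain ⟨h3, h4⟩ := ih₂ e₂ h2
      exact ⟨by rw [h1, h3], h4⟩
    | _ => simp [Expr.encode] at h

theorem encodeSizes_inj : ∀ {ks ls : List ℕ+} {s t : List Bool}, ks.length = ls.length →
    encodeSizes ks ++ s = encodeSizes ls ++ t → ks = ls ∧ s = t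
  | [], [], _, _, _, h => ⟨rfl, by simpa [encodeSizes] using h⟩
  | [], _ :: _, _, _, hl, _ => by simp at hl
  | _ :: _, [], _, _, hl, _ => by simp at hl
  | k :: ks, l :: ls, s, t, hl, h => by
    obtain ⟨h1, h2⟩ := unary_inj (a := k) (b := l) (s := encodeSizes ks ++ s)
      (t := encodeSizes ls ++ t) (by simpa [encodeSizes] using h)
    obtain ⟨h3, h4⟩ := encodeSizes_inj (by simpa using hl) h2
    exact ⟨by rw [PNat.coe_injective h1, h3], h4⟩

/-- A string encodes at most one instance of level `n`. -/
theorem Instance.encode_injective (n : ℕ) :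
    Function.Injective (Instance.encode : Instance n → List Bool) := by
  rintro ⟨m, ms, hl, e⟩ ⟨m', ms', hl', e'⟩ h
  obtain ⟨h1, h2⟩ := encodeSizes_inj (by simp; omega) h
  obtain ⟨rfl, rfl⟩ := List.cons.inj h1
  obtain ⟨rfl, -⟩ := Expr.encode_inj e e' (s := []) (t := []) (by simpa using h2)
  rfl

/-! ### The problems of level `n` -/

/-- The problem with answer `1` on exactly the strings which encode an instance of level `n`
with property `P`. -/
noncomputable def decisionProblem (n : ℕ) (P : Instance n → Prop) : Problem := by
  classical
  exact fun s => decide (∃ F : Instance n, F.encode = s.1 ∧ P F)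

/-- The promise problem whose valid answers on the encoding of an instance `F` of level `n` are
those in `A F`; a string which encodes no instance does not satisfy the promise. -/
def promiseProblem (n : ℕ) (A : Instance n → Answers) : PromiseProblem :=
  fun s => ⟨{b | ∀ F : Instance n, F.encode = s.1 → b ∈ (A F).1}, by
    by_cases h : ∃ F : Instance n, F.encode = s.1
    · obtain ⟨F, hF⟩ := h
      obtain ⟨b, hb⟩ := (A F).2
      exact ⟨b, fun G hG => (Instance.encode_injective n (hF.trans hG.symm)) ▸ hb⟩
    · exact ⟨true, fun F hF => absurd ⟨F, hF⟩ h⟩⟩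

/-- The set of all `x` such that the remaining formula `∀ y⁽¹⁾, ∃ y⁽²⁾, …` holds of `f_x`. -/
def Instance.witnesses {n : ℕ} (F : Instance n) : Set (Word F.m) :=
  {x | CoSatHolds F.ms (fixFirst F.fn x)}

/-- The set of all `x` such that the remaining formula `∃ y⁽¹⁾, ∀ y⁽²⁾, …` fails for `f_x`. -/
def Instance.counterexamples {n : ℕ} (F : Instance n) : Set (Word F.m) :=
  {x | ¬ SatHolds F.ms (fixFirst F.fn x)}

/-- The truth of the formula `∃ x, ∀ y⁽¹⁾, …` of an instance. -/
def Instance.Sat {n : ℕ} (F : Instance n) : Prop := SatHolds (F.m :: F.ms) F.fn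

/-- The truth of the formula `∀ x, ∃ y⁽¹⁾, …` of an instance. -/
def Instance.CoSat {n : ℕ} (F : Instance n) : Prop := CoSatHolds (F.m :: F.ms) F.fn

/-- The first bits of the lexicographically greatest element of `S` (if there is one). -/
def firstBitMax {m : ℕ+} (S : Set (Word m)) : Set Bool :=
  {b | ∃ w : Lex (Word m), IsGreatest {v | ofLex v ∈ S} w ∧ b = firstBit (ofLex w)}

/-- The first bits of the lexicographically least element of `S` (if there is one). -/
def firstBitMin {m : ℕ+} (S : Set (Word m)) : Set Bool :=
  {b | ∃ w : Lex (Word m), IsLeast {v | ofLex v ∈ S} w ∧ b = firstBit (ofLex w)}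

theorem Instance.Sat.nonempty {n : ℕ} {F : Instance n} (h : F.Sat) : F.witnesses.Nonempty := by
  obtain ⟨x, hx⟩ := (by simpa [Instance.Sat, SatHolds] using h :
    ∃ x : Word F.m, CoSatHolds F.ms (fixFirst F.fn x))
  exact ⟨x, hx⟩

theorem firstBitMax_nonempty {m : ℕ+} {S : Set (Word m)} (h : S.Nonempty) :
    (firstBitMax S).Nonempty := by
  obtain ⟨x, hx⟩ := h
  have : Finite (Lex (Word m)) := inferInstanceAs (Finite (Word m))
  obtain ⟨w, hw, hmax⟩ := Set.exists_max_image {v : Lex (Word m) | ofLex v ∈ S} id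
    (Set.toFinite _) ⟨toLex x, hx⟩
  exact ⟨_, w, ⟨hw, fun v hv => hmax v hv⟩, rfl⟩

theorem firstBitMin_nonempty {m : ℕ+} {S : Set (Word m)} (h : S.Nonempty) :
    (firstBitMin S).Nonempty := by
  obtain ⟨x, hx⟩ := h
  have : Finite (Lex (Word m)) := inferInstanceAs (Finite (Word m))
  obtain ⟨w, hw, hmin⟩ := Set.exists_min_image {v : Lex (Word m) | ofLex v ∈ S} id
    (Set.toFinite _) ⟨toLex x, hx⟩
  exact ⟨_, w, ⟨hw, fun v hv => hmin v hv⟩, rfl⟩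

/-- `SAT_n`. -/
noncomputable def SAT (n : ℕ) : PromiseProblem := (decisionProblem n Instance.Sat).toPromise

/-- `coSAT_n`. -/
noncomputable def coSAT (n : ℕ) : PromiseProblem := (decisionProblem n Instance.CoSat).toPromise

/-- `MaxVAL_n`. -/
def MaxVAL (n : ℕ) : PromiseProblem := promiseProblem n fun F =>
  Answers.promise F.Sat (firstBitMax F.witnesses) fun h => firstBitMax_nonempty h.nonempty

/-- `MinVAL_n`. -/
def MinVAL (n : ℕ) : PromiseProblem := promiseProblem n fun F =>
  Answers.promise F.Sat (firstBitMin F.witnesses) fun h => firstBitMin_nonempty h.nonempty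

/-- `VAL_n`. -/
def VAL (n : ℕ) : PromiseProblem := promiseProblem n fun F =>
  Answers.promise F.Sat (firstBit '' F.witnesses) fun h => h.nonempty.image _

open Classical in
/-- `USAT_n`. -/
noncomputable def USAT (n : ℕ) : PromiseProblem := promiseProblem n fun F =>
  Answers.promise (F.witnesses.encard ≤ 1) {decide F.Sat} fun _ => Set.singleton_nonempty _

open Classical in
/-- `coUSAT_n`. -/
noncomputable def coUSAT (n : ℕ) : PromiseProblem := promiseProblem n fun F =>
  Answers.promise (F.counterexamples.encard ≤ 1) {decide F.CoSat} fun _ => Set.singleton_nonempty _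

/-- `UVAL_n`. -/
def UVAL (n : ℕ) : PromiseProblem := promiseProblem n fun F =>
  Answers.promise (∃! x, x ∈ F.witnesses) (firstBit '' F.witnesses)
    fun h => Set.Nonempty.image _ h.exists

end PromiseHierarchy

-- Every reduction is an explicit rewriting of the formula. Write W for the set of witnesses of an
-- instance f. Negating the expression exchanges witnesses and counterexamples, which gives (1) and
-- (4). Negating only the variables of the first block replaces W by the set of complements of its
-- elements; this reverses the lexicographic order and flips first bits, which gives (2), (3) and
-- (5). The conjunction of f with its first bit keeps just the witnesses that begin with 1. If W is
-- nonempty, some are left iff max W begins with 1 (`MaxVAL_reduces_SAT`), and a unique witness is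
-- kept iff it begins with 1 (`UVAL_reduces_USAT`). Conversely, for a new first bit b the formula ¬b
-- ∨ f always has witnesses, and the greatest of them begins with 1 iff f is satisfiable
-- (`SAT_reduces_MaxVAL`). The other reductions within level n leave the formula alone and only
-- compare promises and answers.
--
-- The substantial step is `MaxVAL_reduces_UVAL`: the greatest witness is the unique x with x ∈ W
-- and ∀ y, ¬(x < y) ∨ y ∉ W. Membership in W is a formula with n - 1 blocks beginning with ∀, so y
-- ∉ W is one beginning with ∃, and the second condition has n blocks beginning with ∀. The two
-- conditions are quantified simultaneously by giving them disjoint ranges of bits in common, longer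
-- blocks (`bits_and`); a dummy last block makes up for the difference in length. Hence x is a
-- witness of an instance of level n + 1 (`Instance.exists_greatest`).
--
-- The rest is computability. Reductions compose because the machines do (`PolyTime.comp`). The
-- rewritings are shown to be polynomial-time through `PolyT`, the functions computed by programs
-- over string registers, which compile to machines (`Exec.stepsTo`) and are closed under
-- composition, pairing, case distinction and size-controlled iteration. A promise problem demands
-- nothing of a string that encodes no instance, so only encodings matter
-- (`StrongReduces.of_instances`); a reduction from `SAT` or `coSAT` must treat the other strings
-- too, and for this a parser recognises encodings (`exists_instance_of_instanceError`).

namespace PromiseHierarchy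

/-! ### Composition of polynomial-time machines -/

section Composition

open Turing Function StateTransition

variable {K₁ K₂ Λ₁ Λ₂ σ₁ σ₂ : Type} {Γ₁ : K₁ → Type} {Γ₂ : K₂ → Type}

/-- The stack alphabets of a composite machine: those of the two machines and an auxiliary one. -/
abbrev CompΓ (Γ₁ : K₁ → Type) (Γ₂ : K₂ → Type) : K₁ ⊕ K₂ ⊕ Unit → Type
  | .inl k => Γ₁ k
  | .inr (.inl k) => Γ₂ k
  | .inr (.inr _) => Bool

/-- The stacks of a composite machine. -/
def joinStk (S : ∀ k, List (Γ₁ k)) (T : ∀ k, List (Γ₂ k)) (u : List Bool) :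
    ∀ k, List (CompΓ Γ₁ Γ₂ k)
  | .inl k => S k
  | .inr (.inl k) => T k
  | .inr (.inr _) => u

/-- A statement of the first machine; instead of halting it goes to the first copying loop. -/
def liftFst : TM2.Stmt Γ₁ Λ₁ σ₁ →
    TM2.Stmt (CompΓ Γ₁ Γ₂) (Λ₁ ⊕ Λ₂ ⊕ Bool) (σ₁ × σ₂ × Option Bool)
  | .push k f q => .push (.inl k) (fun v => f v.1) (liftFst q)
  | .peek k f q => .peek (.inl k) (fun v a => (f v.1 a, v.2)) (liftFst q)
  | .pop k f q => .pop (.inl k) (fun v a => (f v.1 a, v.2)) (liftFst q)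
  | .load f q => .load (fun v => (f v.1, v.2)) (liftFst q)
  | .branch f q r => .branch (fun v => f v.1) (liftFst q) (liftFst r)
  | .goto f => .goto fun v => .inl (f v.1)
  | .halt => .goto fun _ => .inr (.inr false)

/-- A statement of the second machine. -/
def liftSnd : TM2.Stmt Γ₂ Λ₂ σ₂ →
    TM2.Stmt (CompΓ Γ₁ Γ₂) (Λ₁ ⊕ Λ₂ ⊕ Bool) (σ₁ × σ₂ × Option Bool)
  | .push k f q => .push (.inr (.inl k)) (fun v => f v.2.1) (liftSnd q)
  | .peek k f q => .peek (.inr (.inl k)) (fun v a => (v.1, f v.2.1 a, v.2.2)) (liftSnd q)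
  | .pop k f q => .pop (.inr (.inl k)) (fun v a => (v.1, f v.2.1 a, v.2.2)) (liftSnd q)
  | .load f q => .load (fun v => (v.1, f v.2.1, v.2.2)) (liftSnd q)
  | .branch f q r => .branch (fun v => f v.2.1) (liftSnd q) (liftSnd r)
  | .goto f => .goto fun v => .inr (.inl (f v.2.1))
  | .halt => .halt

/-- A configuration of the first machine within the composite machine. -/
def cfgFst (w : σ₂ × Option Bool) (T : ∀ k, List (Γ₂ k)) (u : List Bool)
    (c : TM2.Cfg Γ₁ Λ₁ σ₁) :
    TM2.Cfg (CompΓ Γ₁ Γ₂) (Λ₁ ⊕ Λ₂ ⊕ Bool) (σ₁ × σ₂ × Option Bool) :=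
  ⟨some (c.l.elim (.inr (.inr false)) .inl), (c.var, w), joinStk c.stk T u⟩

/-- A configuration of the second machine within the composite machine. -/
def cfgSnd (w : σ₁) (b : Option Bool) (S : ∀ k, List (Γ₁ k)) (u : List Bool)
    (c : TM2.Cfg Γ₂ Λ₂ σ₂) :
    TM2.Cfg (CompΓ Γ₁ Γ₂) (Λ₁ ⊕ Λ₂ ⊕ Bool) (σ₁ × σ₂ × Option Bool) :=
  ⟨c.l.map fun l => .inr (.inl l), (w, c.var, b), joinStk S c.stk u⟩

variable [DecidableEq K₁] [DecidableEq K₂]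

theorem update_joinStk_fst (S : ∀ k, List (Γ₁ k)) (T : ∀ k, List (Γ₂ k)) (u : List Bool)
    (k : K₁) (x : List (Γ₁ k)) :
    update (joinStk S T u) (.inl k) x = joinStk (update S k x) T u := by
  funext j
  rcases j with j | j | j
  · by_cases h : j = k
    · subst h; simp [joinStk]
    · simp [joinStk, h]
  · simp [joinStk]
  · simp [joinStk]

theorem update_joinStk_snd (S : ∀ k, List (Γ₁ k)) (T : ∀ k, List (Γ₂ k)) (u : List Bool)
    (k : K₂) (x : List (Γ₂ k)) :
    update (joinStk S T u) (.inr (.inl k)) x = joinStk S (update T k x) u := by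
  funext j
  rcases j with j | j | j
  · simp [joinStk]
  · by_cases h : j = k
    · subst h; simp [joinStk]
    · simp [joinStk, h]
  · simp [joinStk]

theorem update_joinStk_aux (S : ∀ k, List (Γ₁ k)) (T : ∀ k, List (Γ₂ k)) (u x : List Bool) :
    update (joinStk S T u) (.inr (.inr ())) x = joinStk S T x := by
  funext j
  rcases j with j | j | j <;> simp [joinStk]

/-- A lifted statement touches only the stacks and the state of its own machine. Halting turns into
a jump to the first copying loop, which is the label that `cfgFst` assigns to a halted
configuration. -/
theorem stepAux_liftFst (q : TM2.Stmt Γ₁ Λ₁ σ₁) (v : σ₁) (w : σ₂ × Option Bool)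
    (S : ∀ k, List (Γ₁ k)) (T : ∀ k, List (Γ₂ k)) (u : List Bool) :
    TM2.stepAux (liftFst (Λ₂ := Λ₂) q) (v, w) (joinStk S T u) =
      cfgFst w T u (TM2.stepAux q v S) := by
  induction q generalizing v S with
  | push k f q ih => simp only [liftFst, TM2.stepAux, ← ih, ← update_joinStk_fst]; rfl
  | peek k f q ih => simp only [liftFst, TM2.stepAux, ← ih]; rfl
  | pop k f q ih => simp only [liftFst, TM2.stepAux, ← ih, ← update_joinStk_fst]; rfl
  | load f q ih => simp only [liftFst, TM2.stepAux, ← ih]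
  | branch f q r ihq ihr => cases h : f v <;> simp [liftFst, TM2.stepAux, h, ihq, ihr]
  | goto f => rfl
  | halt => rfl

theorem stepAux_liftSnd (q : TM2.Stmt Γ₂ Λ₂ σ₂) (v : σ₂) (w : σ₁) (b : Option Bool)
    (S : ∀ k, List (Γ₁ k)) (T : ∀ k, List (Γ₂ k)) (u : List Bool) :
    TM2.stepAux (liftSnd (Λ₁ := Λ₁) q) (w, v, b) (joinStk S T u) =
      cfgSnd w b S u (TM2.stepAux q v T) := by
  induction q generalizing v T with
  | push k f q ih => simp only [liftSnd, TM2.stepAux, ← ih, ← update_joinStk_snd]; rfl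
  | peek k f q ih => simp only [liftSnd, TM2.stepAux, ← ih]; rfl
  | pop k f q ih => simp only [liftSnd, TM2.stepAux, ← ih, ← update_joinStk_snd]; rfl
  | load f q ih => simp only [liftSnd, TM2.stepAux, ← ih]
  | branch f q r ihq ihr => cases h : f v <;> simp [liftSnd, TM2.stepAux, h, ihq, ihr]
  | goto f => rfl
  | halt => rfl

-- Runs of a given length, and simulation of the two machines.

/-- `c'` is reached from `c` in exactly `t` steps. -/
def StepsTo {C : Type} (f : C → Option C) (t : ℕ) (c c' : C) : Prop :=
  (flip bind f)^[t] (some c) = some c'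

theorem iterate_bind_none {C : Type} (f : C → Option C) (t : ℕ) :
    (flip bind f)^[t] none = none :=
  iterate_fixed rfl t

theorem StepsTo.refl {C : Type} (f : C → Option C) (c : C) : StepsTo f 0 c c := rfl

theorem StepsTo.trans {C : Type} {f : C → Option C} {s t : ℕ} {a b c : C}
    (h : StepsTo f s a b) (h' : StepsTo f t b c) : StepsTo f (s + t) a c := by
  unfold StepsTo at *
  rw [add_comm, iterate_add_apply, h, h']

theorem StepsTo.single {C : Type} {f : C → Option C} {a b : C} (h : f a = some b) :
    StepsTo f 1 a b := by
  simpa [StepsTo, flip] using h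

theorem stepsTo_succ {C : Type} {f : C → Option C} {t : ℕ} {a c : C} :
    StepsTo f (t + 1) a c ↔ ∃ b, f a = some b ∧ StepsTo f t b c := by
  unfold StepsTo
  rw [iterate_succ_apply]
  cases h : f a with
  | none =>
    have : flip bind f (some a) = none := h
    rw [this, iterate_bind_none]
    simp
  | some b => simp [flip, h]

theorem stepsTo_liftFst {M₁ : Λ₁ → TM2.Stmt Γ₁ Λ₁ σ₁}
    {M : Λ₁ ⊕ Λ₂ ⊕ Bool → TM2.Stmt (CompΓ Γ₁ Γ₂) (Λ₁ ⊕ Λ₂ ⊕ Bool) (σ₁ × σ₂ × Option Bool)}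
    (hM : ∀ l, M (.inl l) = liftFst (M₁ l)) (w : σ₂ × Option Bool) (T : ∀ k, List (Γ₂ k))
    (u : List Bool) {t : ℕ} {c c' : TM2.Cfg Γ₁ Λ₁ σ₁} (h : StepsTo (TM2.step M₁) t c c') :
    StepsTo (TM2.step M) t (cfgFst w T u c) (cfgFst w T u c') := by
  induction t generalizing c with
  | zero =>
    obtain rfl : c = c' := by simpa [StepsTo] using h
    exact .refl _ _
  | succ t ih =>
    obtain ⟨b, hb, h⟩ := stepsTo_succ.1 h
    refine stepsTo_succ.2 ⟨_, ?_, ih h⟩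
    obtain ⟨_ | l, v, S⟩ := c
    · simp at hb
    · obtain rfl : TM2.stepAux (M₁ l) v S = b := by simpa using hb
      rw [← stepAux_liftFst, ← hM]
      rfl

theorem stepsTo_liftSnd {M₂ : Λ₂ → TM2.Stmt Γ₂ Λ₂ σ₂}
    {M : Λ₁ ⊕ Λ₂ ⊕ Bool → TM2.Stmt (CompΓ Γ₁ Γ₂) (Λ₁ ⊕ Λ₂ ⊕ Bool) (σ₁ × σ₂ × Option Bool)}
    (hM : ∀ l, M (.inr (.inl l)) = liftSnd (M₂ l)) (w : σ₁) (b : Option Bool)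
    (S : ∀ k, List (Γ₁ k)) (u : List Bool) {t : ℕ} {c c' : TM2.Cfg Γ₂ Λ₂ σ₂}
    (h : StepsTo (TM2.step M₂) t c c') :
    StepsTo (TM2.step M) t (cfgSnd w b S u c) (cfgSnd w b S u c') := by
  induction t generalizing c with
  | zero =>
    obtain rfl : c = c' := by simpa [StepsTo] using h
    exact .refl _ _
  | succ t ih =>
    obtain ⟨d, hd, h⟩ := stepsTo_succ.1 h
    refine stepsTo_succ.2 ⟨_, ?_, ih h⟩
    obtain ⟨_ | l, v, T⟩ := c
    · simp at hd
    · obtain rfl : TM2.stepAux (M₂ l) v T = d := by simpa using hd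
      rw [← stepAux_liftSnd, ← hM]
      rfl

-- Stack growth is bounded by running time.

/-- The number of push instructions in a statement. -/
def pushCount : TM2.Stmt Γ₁ Λ₁ σ₁ → ℕ
  | .push _ _ q => pushCount q + 1
  | .peek _ _ q => pushCount q
  | .pop _ _ q => pushCount q
  | .load _ q => pushCount q
  | .branch _ q r => pushCount q + pushCount r
  | .goto _ => 0
  | .halt => 0

/-- A machine step executes a whole statement, so it may push several times. Adding the counts of
both branches is wasteful but gives a bound independent of the state. -/
theorem length_stepAux_le (q : TM2.Stmt Γ₁ Λ₁ σ₁) (v : σ₁) (S : ∀ k, List (Γ₁ k)) (k : K₁) :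
    ((TM2.stepAux q v S).stk k).length ≤ (S k).length + pushCount q := by
  induction q generalizing v S with
  | push j f q ih =>
    refine (ih _ _).trans ?_
    by_cases h : k = j
    · subst h; simp [pushCount]; omega
    · simp [h, pushCount]; try omega
  | peek j f q ih => exact ih _ _
  | pop j f q ih =>
    refine (ih _ _).trans ?_
    by_cases h : k = j
    · subst h; simp [pushCount]
    · simp [h, pushCount]
  | load f q ih => exact ih _ _
  | branch f q r ihq ihr =>
    have hq := ihq v S
    have hr := ihr v S
    cases h : f v <;> simp [TM2.stepAux, h, pushCount] <;> omega
  | goto f => simp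
  | halt => simp

theorem StepsTo.length_stk_le {M₁ : Λ₁ → TM2.Stmt Γ₁ Λ₁ σ₁} {B t : ℕ}
    (hB : ∀ l, pushCount (M₁ l) ≤ B) {c c' : TM2.Cfg Γ₁ Λ₁ σ₁}
    (h : StepsTo (TM2.step M₁) t c c') (k : K₁) :
    (c'.stk k).length ≤ (c.stk k).length + t * B := by
  induction t generalizing c with
  | zero =>
    obtain rfl : c = c' := by simpa [StepsTo] using h
    simp
  | succ t ih =>
    obtain ⟨d, hd, h⟩ := stepsTo_succ.1 h
    obtain ⟨_ | l, v, T⟩ := c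
    · simp at hd
    · obtain rfl : TM2.stepAux (M₁ l) v T = d := by simpa using hd
      have h1 := ih h
      have h2 := length_stepAux_le (M₁ l) v T k
      have h3 := hB l
      simp only at h1 h2 ⊢
      rw [add_mul]
      omega

/-- The code of the composite machine. -/
def compCode (M₁ : Λ₁ → TM2.Stmt Γ₁ Λ₁ σ₁) (M₂ : Λ₂ → TM2.Stmt Γ₂ Λ₂ σ₂) (k₁ : K₁) (k₂ : K₂)
    (e₁ : Γ₁ k₁ ≃ Bool) (e₂ : Γ₂ k₂ ≃ Bool) (main₂ : Λ₂) :
    Λ₁ ⊕ Λ₂ ⊕ Bool → TM2.Stmt (CompΓ Γ₁ Γ₂) (Λ₁ ⊕ Λ₂ ⊕ Bool) (σ₁ × σ₂ × Option Bool)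
  | .inl l => liftFst (M₁ l)
  | .inr (.inl l) => liftSnd (M₂ l)
  | .inr (.inr false) => .pop (.inl k₁) (fun v a => (v.1, v.2.1, a.map e₁))
      (.branch (fun v => v.2.2.isSome)
        (.push (.inr (.inr ())) (fun v => v.2.2.getD false) (.goto fun _ => .inr (.inr false)))
        (.goto fun _ => .inr (.inr true)))
  | .inr (.inr true) => .pop (.inr (.inr ())) (fun v a => (v.1, v.2.1, a))
      (.branch (fun v => v.2.2.isSome)
        (.push (.inr (.inl k₂)) (fun v => e₂.symm (v.2.2.getD false))
          (.goto fun _ => .inr (.inr true)))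
        (.goto fun _ => .inr (.inl main₂)))

/-- Popping one stack and pushing on another reverses the string; the second copying loop reverses
it again. The loop for an empty stack takes one step, whence the `+ 1`. -/
theorem stepsTo_copy_fst (M₁ : Λ₁ → TM2.Stmt Γ₁ Λ₁ σ₁) (M₂ : Λ₂ → TM2.Stmt Γ₂ Λ₂ σ₂)
    (k₁ : K₁) (k₂ : K₂) (e₁ : Γ₁ k₁ ≃ Bool) (e₂ : Γ₂ k₂ ≃ Bool) (main₂ : Λ₂)
    (v : σ₁) (w : σ₂) (T : ∀ k, List (Γ₂ k)) (l : List Bool) :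
    ∀ (b : Option Bool) (S : ∀ k, List (Γ₁ k)) (u : List Bool), S k₁ = l.map e₁.symm →
    StepsTo (TM2.step (compCode M₁ M₂ k₁ k₂ e₁ e₂ main₂)) (l.length + 1)
      ⟨some (.inr (.inr false)), (v, w, b), joinStk S T u⟩
      ⟨some (.inr (.inr true)), (v, w, none), joinStk (update S k₁ []) T (l.reverse ++ u)⟩ := by
  induction l with
  | nil =>
    intro b S u h
    refine StepsTo.single ?_
    simp only [TM2.step, compCode, TM2.stepAux, joinStk, h, update_joinStk_fst]
    simp
  | cons a l ih =>
    intro b S u h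
    refine stepsTo_succ.2 ⟨⟨some (.inr (.inr false)), (v, w, some a),
      joinStk (update S k₁ (l.map e₁.symm)) T (a :: u)⟩, ?_, ?_⟩
    · simp only [TM2.step, compCode, TM2.stepAux, joinStk, h, update_joinStk_fst]
      simp [update_joinStk_aux]
    · have := ih (some a) (update S k₁ (l.map e₁.symm)) (a :: u) (by simp)
      simpa using this

theorem stepsTo_copy_snd (M₁ : Λ₁ → TM2.Stmt Γ₁ Λ₁ σ₁) (M₂ : Λ₂ → TM2.Stmt Γ₂ Λ₂ σ₂)
    (k₁ : K₁) (k₂ : K₂) (e₁ : Γ₁ k₁ ≃ Bool) (e₂ : Γ₂ k₂ ≃ Bool) (main₂ : Λ₂)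
    (v : σ₁) (w : σ₂) (S : ∀ k, List (Γ₁ k)) (l : List Bool) :
    ∀ (b : Option Bool) (T : ∀ k, List (Γ₂ k)),
    StepsTo (TM2.step (compCode M₁ M₂ k₁ k₂ e₁ e₂ main₂)) (l.length + 1)
      ⟨some (.inr (.inr true)), (v, w, b), joinStk S T l⟩
      ⟨some (.inr (.inl main₂)), (v, w, none),
        joinStk S (update T k₂ (l.reverse.map e₂.symm ++ T k₂)) []⟩ := by
  induction l with
  | nil =>
    intro b T
    refine StepsTo.single ?_
    simp only [TM2.step, compCode, TM2.stepAux, joinStk, update_joinStk_aux]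
    simp
  | cons a l ih =>
    intro b T
    refine stepsTo_succ.2 ⟨⟨some (.inr (.inr true)), (v, w, some a),
      joinStk S (update T k₂ (e₂.symm a :: T k₂)) l⟩, ?_, ?_⟩
    · simp only [TM2.step, compCode, TM2.stepAux, joinStk, update_joinStk_aux]
      simp [update_joinStk_snd]
    · have := ih (some a) (update T k₂ (e₂.symm a :: T k₂))
      simpa using this

theorem initList_eq (tm : FinTM2) (s : List (tm.Γ tm.k₀)) :
    initList tm s = ⟨some tm.main, tm.initialState, update (fun _ => []) tm.k₀ s⟩ := by
  unfold initList
  congr 1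
  funext k
  by_cases h : k = tm.k₀
  · subst h; simp
  · simp [h]

theorem haltList_eq (tm : FinTM2) (s : List (tm.Γ tm.k₁)) :
    haltList tm s = ⟨none, tm.initialState, update (fun _ => []) tm.k₁ s⟩ := by
  unfold haltList
  congr 1
  funext k
  by_cases h : k = tm.k₁
  · subst h; simp
  · simp [h]

theorem exists_pushCount_le (tm : FinTM2) : ∃ B, ∀ l, pushCount (tm.m l) ≤ B := by
  have := tm.ΛFin
  exact ⟨∑ l, pushCount (tm.m l),
    fun l => Finset.single_le_sum (f := fun l => pushCount (tm.m l)) (by simp) (Finset.mem_univ l)⟩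

/-- The coefficients are natural numbers, so every monomial is monotone. -/
theorem polynomial_eval_mono (P : Polynomial ℕ) : Monotone fun n => P.eval n := by
  intro a b h
  simp only [Polynomial.eval_eq_sum]
  exact Finset.sum_le_sum fun i _ => Nat.mul_le_mul_left _ (Nat.pow_le_pow_left h i)

/-- The composite of two machines whose output, respectively input, alphabet is `{0, 1}`. -/
def compTM (tm₁ tm₂ : FinTM2) (e₁ : tm₁.Γ tm₁.k₁ ≃ Bool) (e₂ : tm₂.Γ tm₂.k₀ ≃ Bool) : FinTM2 :=
  letI := tm₁.kDecidableEq
  letI := tm₂.kDecidableEq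
  letI := tm₁.kFin
  letI := tm₂.kFin
  letI := tm₁.ΛFin
  letI := tm₂.ΛFin
  letI := tm₁.σFin
  letI := tm₂.σFin
  { K := tm₁.K ⊕ tm₂.K ⊕ Unit
    k₀ := .inl tm₁.k₀
    k₁ := .inr (.inl tm₂.k₁)
    Γ := CompΓ tm₁.Γ tm₂.Γ
    Λ := tm₁.Λ ⊕ tm₂.Λ ⊕ Bool
    main := .inl tm₁.main
    σ := tm₁.σ × tm₂.σ × Option Bool
    initialState := (tm₁.initialState, tm₂.initialState, none)
    Γk₀Fin := tm₁.Γk₀Fin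
    m := compCode tm₁.m tm₂.m tm₁.k₁ tm₂.k₀ e₁ e₂ tm₂.main }

theorem PolyTime.exists_machine {μ : Str → Str} (h : PolyTime μ) :
    ∃ (tm : FinTM2) (i : tm.Γ tm.k₀ ≃ Bool) (o : tm.Γ tm.k₁ ≃ Bool) (P : Polynomial ℕ),
      ∀ s : Str, ∃ t ≤ P.eval s.1.length, StepsTo tm.step t
        ⟨some tm.main, tm.initialState, update (fun _ => []) tm.k₀ (s.1.map i.symm)⟩
        ⟨none, tm.initialState, update (fun _ => []) tm.k₁ ((μ s).1.map o.symm)⟩ := by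
  obtain ⟨⟨⟨tm, i, o⟩, P, h⟩⟩ := h
  refine ⟨tm, i, o, P, fun s => ⟨(h s).steps, (h s).steps_le_m, ?_⟩⟩
  rw [← initList_eq, ← haltList_eq]
  exact (h s).evals_in_steps

theorem PolyTime.of_machine {μ : Str → Str} (tm : FinTM2) (i : tm.Γ tm.k₀ ≃ Bool)
    (o : tm.Γ tm.k₁ ≃ Bool) (P : Polynomial ℕ)
    (h : ∀ s : Str, ∃ t ≤ P.eval s.1.length, StepsTo tm.step t
      ⟨some tm.main, tm.initialState, update (fun _ => []) tm.k₀ (s.1.map i.symm)⟩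
      ⟨none, tm.initialState, update (fun _ => []) tm.k₁ ((μ s).1.map o.symm)⟩) :
    PolyTime μ := by
  choose t ht h using h
  refine ⟨⟨⟨tm, i, o⟩, P, fun s => ⟨⟨t s, ?_⟩, ht s⟩⟩⟩
  have := h s
  rw [← initList_eq, ← haltList_eq] at this
  exact this

theorem update_nil_joinStk_fst (k : K₁) (x : List (Γ₁ k)) :
    update (β := fun j => List (CompΓ Γ₁ Γ₂ j)) (fun _ => []) (.inl k) x =
      joinStk (Γ₁ := Γ₁) (Γ₂ := Γ₂) (update (fun _ => []) k x) (fun _ => []) [] := by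
  rw [← update_joinStk_fst]
  congr 1
  funext j
  rcases j with j | j | j <;> rfl

theorem update_nil_joinStk_snd (k : K₂) (x : List (Γ₂ k)) :
    update (β := fun j => List (CompΓ Γ₁ Γ₂ j)) (fun _ => []) (.inr (.inl k)) x =
      joinStk (Γ₁ := Γ₁) (Γ₂ := Γ₂) (fun _ => []) (update (fun _ => []) k x) [] := by
  rw [← update_joinStk_snd]
  congr 1
  funext j
  rcases j with j | j | j <;> rfl

/-- The time of the second machine is polynomial in the length of the intermediate string, which is
itself bounded by the input length plus a constant number of pushes for each step of the first
machine. -/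
theorem PolyTime.comp {μ ν : Str → Str} (hν : PolyTime ν) (hμ : PolyTime μ) :
    PolyTime (ν ∘ μ) := by
  obtain ⟨tm₁, i₁, o₁, P₁, h₁⟩ := hμ.exists_machine
  obtain ⟨tm₂, i₂, o₂, P₂, h₂⟩ := hν.exists_machine
  obtain ⟨B, hB⟩ := exists_pushCount_le tm₁
  let L : Polynomial ℕ := Polynomial.X + P₁ * Polynomial.C B
  refine PolyTime.of_machine (compTM tm₁ tm₂ o₁ i₂) i₁ o₂
    (P₁ + (L + 1) + (L + 1) + P₂.comp L) fun s => ?_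
  obtain ⟨t₁, l₁, H₁⟩ := h₁ s
  obtain ⟨t₂, l₂, H₂⟩ := h₂ (μ s)
  have hlen : (μ s).1.length ≤ L.eval s.1.length := by
    have := StepsTo.length_stk_le hB H₁ tm₁.k₁
    simp only [update_self, List.length_map] at this
    refine this.trans ?_
    simp only [L, Polynomial.eval_add, Polynomial.eval_X, Polynomial.eval_mul, Polynomial.eval_C]
    refine Nat.add_le_add ?_ (Nat.mul_le_mul_right _ l₁)
    have hk : ∀ k, (update (fun _ => []) tm₁.k₀ (s.1.map i₁.symm) k).length ≤ s.1.length := by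
      intro k
      by_cases h : k = tm₁.k₀
      · subst h; simp
      · simp [h]
    exact hk _
  refine ⟨t₁ + ((μ s).1.length + 1) + ((μ s).1.length + 1) + t₂, ?_, ?_⟩
  · simp only [Polynomial.eval_add, Polynomial.eval_comp, Polynomial.eval_one]
    have := polynomial_eval_mono P₂ hlen
    simp only at this
    omega
  -- The run has four phases: first machine, two copying loops, second machine. A halted machine has
  -- its initial state and all stacks empty except the output; hence the second machine finds clean
  -- stacks, and at the end the composite is in the prescribed final configuration.
  · have A := stepsTo_liftFst (M := compCode tm₁.m tm₂.m tm₁.k₁ tm₂.k₀ o₁ i₂ tm₂.main)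
      (fun _ => rfl) (tm₂.initialState, none) (fun _ => []) [] H₁
    have B := stepsTo_copy_fst tm₁.m tm₂.m tm₁.k₁ tm₂.k₀ o₁ i₂ tm₂.main tm₁.initialState
      tm₂.initialState (fun _ => []) (μ s).1 none
      (update (fun _ => []) tm₁.k₁ ((μ s).1.map o₁.symm)) [] (by simp)
    have C := stepsTo_copy_snd tm₁.m tm₂.m tm₁.k₁ tm₂.k₀ o₁ i₂ tm₂.main tm₁.initialState
      tm₂.initialState (fun _ => []) ((μ s).1.reverse ++ []) none (fun _ => [])
    have D := stepsTo_liftSnd (M := compCode tm₁.m tm₂.m tm₁.k₁ tm₂.k₀ o₁ i₂ tm₂.main)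
      (fun _ => rfl) tm₁.initialState none (fun _ => []) [] H₂
    have hu : update (fun _ => []) tm₁.k₁ [] = (fun k => [] : ∀ k, List (tm₁.Γ k)) :=
      update_eq_self _ _
    simp only [update_idem, hu] at B
    simp only [List.append_nil, List.reverse_reverse, List.length_reverse] at B C
    have := ((A.trans B).trans C).trans D
    simp only [cfgFst, cfgSnd, Option.elim, Option.map] at this
    rw [← update_nil_joinStk_fst, ← update_nil_joinStk_snd] at this
    exact this

theorem StrongReduces.trans {φ₁ φ₂ φ₃ : PromiseProblem} (h : StrongReduces φ₁ φ₂)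
    (h' : StrongReduces φ₂ φ₃) : StrongReduces φ₁ φ₃ := by
  obtain ⟨μ, hμ, h⟩ := h
  obtain ⟨ν, hν, h'⟩ := h'
  exact ⟨ν ∘ μ, hν.comp hμ, fun s => (h' (μ s)).trans (h s)⟩

theorem strongClosure_eq {φ ψ : PromiseProblem} (h : StrongReduces φ ψ)
    (h' : StrongReduces ψ φ) : strongClosure φ = strongClosure ψ :=
  Set.ext fun _ => ⟨fun k => k.trans h, fun k => k.trans h'⟩

end Composition
/-! ### A programming language over registers holding strings -/

section Programs

open Turing Function

/-- Programs over registers which hold bit strings. -/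
inductive Prog (R : Type) : Type
  /-- do nothing -/
  | skip : Prog R
  /-- put a bit in front of a register -/
  | push (r : R) (b : Bool) : Prog R
  /-- sequential composition -/
  | seq (p q : Prog R) : Prog R
  /-- remove the first bit of a register and branch on it -/
  | pop (r : R) (pn pt pf : Prog R) : Prog R
  /-- as long as a register is nonempty, remove its first bit and branch on it -/
  | loop (r : R) (pt pf : Prog R) : Prog R

/-- `Exec p s s' t`: started in `s`, the program `p` ends in `s'` after `t` steps. -/
inductive Exec {R : Type} [DecidableEq R] :
    Prog R → (R → List Bool) → (R → List Bool) → ℕ → Prop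
  | skip (s) : Exec .skip s s 1
  | push (r b s) : Exec (.push r b) s (update s r (b :: s r)) 1
  | seq {p q s s' s'' t t'} : Exec p s s' t → Exec q s' s'' t' → Exec (.seq p q) s s'' (t + t')
  | pop_nil {r pn pt pf s s' t} : s r = [] → Exec pn s s' t → Exec (.pop r pn pt pf) s s' (t + 1)
  | pop_true {r pn pt pf s s' t l} : s r = true :: l → Exec pt (update s r l) s' t →
      Exec (.pop r pn pt pf) s s' (t + 1)
  | pop_false {r pn pt pf s s' t l} : s r = false :: l → Exec pf (update s r l) s' t →
      Exec (.pop r pn pt pf) s s' (t + 1)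
  | loop_nil {r pt pf s} : s r = [] → Exec (.loop r pt pf) s s 1
  | loop_true {r pt pf s s' s'' t t' l} : s r = true :: l → Exec pt (update s r l) s' t →
      Exec (.loop r pt pf) s' s'' t' → Exec (.loop r pt pf) s s'' (t + t' + 1)
  | loop_false {r pt pf s s' s'' t t' l} : s r = false :: l → Exec pf (update s r l) s' t →
      Exec (.loop r pt pf) s' s'' t' → Exec (.loop r pt pf) s s'' (t + t' + 1)

/-- The labels of the machine code of a program. -/
def Prog.Label {R : Type} : Prog R → Type
  | .skip => Unit
  | .push _ _ => Unit
  | .seq p q => p.Label ⊕ q.Label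
  | .pop _ pn pt pf => Unit ⊕ pn.Label ⊕ pt.Label ⊕ pf.Label
  | .loop _ pt pf => Unit ⊕ pt.Label ⊕ pf.Label

/-- A program has finitely many labels. -/
@[reducible] def Prog.labelFintype {R : Type} : (p : Prog R) → Fintype p.Label
  | .skip => inferInstanceAs (Fintype Unit)
  | .push _ _ => inferInstanceAs (Fintype Unit)
  | .seq p q =>
    letI := p.labelFintype
    letI := q.labelFintype
    inferInstanceAs (Fintype (p.Label ⊕ q.Label))
  | .pop _ pn pt pf =>
    letI := pn.labelFintype
    letI := pt.labelFintype
    letI := pf.labelFintype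
    inferInstanceAs (Fintype (Unit ⊕ pn.Label ⊕ pt.Label ⊕ pf.Label))
  | .loop _ pt pf =>
    letI := pt.labelFintype
    letI := pf.labelFintype
    inferInstanceAs (Fintype (Unit ⊕ pt.Label ⊕ pf.Label))

/-- The label at which a program starts. -/
def Prog.entry {R : Type} : (p : Prog R) → p.Label
  | .skip => ()
  | .push _ _ => ()
  | .seq p _ => .inl p.entry
  | .pop _ _ _ _ => .inl ()
  | .loop _ _ _ => .inl ()

/-- Statements of the machines executing programs. -/
abbrev CodeStmt (R L : Type) : Type := TM2.Stmt (fun _ : R => Bool) L (Option Bool)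

/-- Pop a bit and jump depending on the result. -/
def popGoto {R L : Type} (r : R) (ln lt lf : L) : CodeStmt R L :=
  .pop r (fun _ a => a) (.branch (fun a => a.isSome)
    (.branch (fun a => a.getD false) (.load (fun _ => none) (.goto fun _ => lt))
      (.load (fun _ => none) (.goto fun _ => lf)))
    (.goto fun _ => ln))

/-- The machine code of a program, within a machine with labels in `L`. -/
def Prog.code {R L : Type} : (p : Prog R) → (p.Label → L) → L → p.Label → CodeStmt R L
  | .skip, _, exit, _ => .goto fun _ => exit
  | .push r b, _, exit, _ => .push r (fun _ => b) (.goto fun _ => exit)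
  | .seq p q, emb, _, .inl l => p.code (fun l => emb (.inl l)) (emb (.inr q.entry)) l
  | .seq _ q, emb, exit, .inr l => q.code (fun l => emb (.inr l)) exit l
  | .pop r pn pt pf, emb, _, .inl _ => popGoto r (emb (.inr (.inl pn.entry)))
      (emb (.inr (.inr (.inl pt.entry)))) (emb (.inr (.inr (.inr pf.entry))))
  | .pop _ pn _ _, emb, exit, .inr (.inl l) => pn.code (fun l => emb (.inr (.inl l))) exit l
  | .pop _ _ pt _, emb, exit, .inr (.inr (.inl l)) =>
      pt.code (fun l => emb (.inr (.inr (.inl l)))) exit l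
  | .pop _ _ _ pf, emb, exit, .inr (.inr (.inr l)) =>
      pf.code (fun l => emb (.inr (.inr (.inr l)))) exit l
  | .loop r pt pf, emb, exit, .inl _ => popGoto r exit (emb (.inr (.inl pt.entry)))
      (emb (.inr (.inr pf.entry)))
  | .loop _ pt _, emb, _, .inr (.inl l) =>
      pt.code (fun l => emb (.inr (.inl l))) (emb (.inl ())) l
  | .loop _ _ pf, emb, _, .inr (.inr l) =>
      pf.code (fun l => emb (.inr (.inr l))) (emb (.inl ())) l

/-- The code is considered inside an arbitrary machine, with arbitrary exit label, so that the
induction hypotheses apply to subprograms. One step of `Exec` is one machine step. The one-bit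
memory is `none` at every label, because `popGoto` clears it after branching on a bit. -/
theorem Exec.stepsTo {R : Type} [DecidableEq R] {p : Prog R} {s s' : R → List Bool} {t : ℕ}
    (h : Exec p s s' t) : ∀ {L : Type} (M : L → CodeStmt R L) (emb : p.Label → L) (exit : L),
    (∀ l, M (emb l) = p.code emb exit l) →
    StepsTo (TM2.step M) t ⟨some (emb p.entry), none, s⟩ ⟨some exit, none, s'⟩ := by
  induction h with
  | skip s =>
    intro L M emb exit hM
    exact .single (by rw [TM2.step, hM]; simp [Prog.code])
  | push r b s =>
    intro L M emb exit hM
    exact .single (by rw [TM2.step, hM]; simp [Prog.code])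
  | seq _ _ ih ih' =>
    intro L M emb exit hM
    exact (ih M (fun l => emb (.inl l)) _ fun l => hM (.inl l)).trans
      (ih' M (fun l => emb (.inr l)) _ fun l => hM (.inr l))
  | @pop_nil r pn pt pf s s' t h _ ih =>
    intro L M emb exit hM
    refine stepsTo_succ.2 ⟨_, ?_, ih M (fun l => emb (.inr (.inl l))) _
      fun l => hM (.inr (.inl l))⟩
    have : update s r [] = s := by rw [← h, update_eq_self]
    rw [TM2.step, hM]; simp [Prog.entry, Prog.code, popGoto, h, this]
  | pop_true h _ ih =>
    intro L M emb exit hM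
    refine stepsTo_succ.2 ⟨_, ?_, ih M (fun l => emb (.inr (.inr (.inl l)))) _
      fun l => hM (.inr (.inr (.inl l)))⟩
    rw [TM2.step, hM]; simp [Prog.entry, Prog.code, popGoto, h]
  | pop_false h _ ih =>
    intro L M emb exit hM
    refine stepsTo_succ.2 ⟨_, ?_, ih M (fun l => emb (.inr (.inr (.inr l)))) _
      fun l => hM (.inr (.inr (.inr l)))⟩
    rw [TM2.step, hM]; simp [Prog.entry, Prog.code, popGoto, h]
  | @loop_nil r pt pf s h =>
    intro L M emb exit hM
    have : update s r [] = s := by rw [← h, update_eq_self]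
    exact .single (by rw [TM2.step, hM]; simp [Prog.entry, Prog.code, popGoto, h, this])
  | loop_true h _ _ ih ih' =>
    intro L M emb exit hM
    refine stepsTo_succ.2 ⟨_, ?_, (ih M (fun l => emb (.inr (.inl l))) _
      fun l => hM (.inr (.inl l))).trans (ih' M emb exit hM)⟩
    rw [TM2.step, hM]; simp [Prog.entry, Prog.code, popGoto, h]
  | loop_false h _ _ ih ih' =>
    intro L M emb exit hM
    refine stepsTo_succ.2 ⟨_, ?_, (ih M (fun l => emb (.inr (.inr l))) _
      fun l => hM (.inr (.inr l))).trans (ih' M emb exit hM)⟩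
    rw [TM2.step, hM]; simp [Prog.entry, Prog.code, popGoto, h]

/-- The machine executing a program. -/
def Prog.machine {R : Type} [DecidableEq R] [Fintype R] (p : Prog R) (r r' : R) : FinTM2 :=
  letI := p.labelFintype
  { K := R
    k₀ := r
    k₁ := r'
    Γ := fun _ => Bool
    Λ := Option p.Label
    main := some p.entry
    σ := Option Bool
    initialState := none
    Γk₀Fin := inferInstanceAs (Fintype Bool)
    m := fun l => l.elim .halt (p.code some none) }

theorem PolyTime.of_prog {R : Type} [DecidableEq R] [Fintype R] (p : Prog R) (r r' : R)
    (P : Polynomial ℕ) {μ : Str → Str}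
    (h : ∀ s : Str, ∃ t ≤ P.eval s.1.length,
      Exec p (update (fun _ => []) r s.1) (update (fun _ => []) r' (μ s).1) t) : PolyTime μ := by
  refine PolyTime.of_machine (p.machine r r') (Equiv.refl Bool) (Equiv.refl Bool) (P + 1)
    fun s => ?_
  obtain ⟨t, ht, h⟩ := h s
  -- The extra step executes the halt statement at the exit label.
  refine ⟨t + 1, by simpa using ht, ?_⟩
  have e : ∀ l : List Bool, l.map (Equiv.refl Bool).symm = l := List.map_id
  have key := (h.stepsTo (fun l : Option p.Label => l.elim .halt (p.code some none)) some none
    fun _ => rfl).trans (StepsTo.single rfl)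
  rw [← e s.1, ← e (μ s).1] at key
  exact key

-- Renaming and framing of registers.

/-- Rename the registers of a program. -/
def Prog.map {R R' : Type} (f : R → R') : Prog R → Prog R'
  | .skip => .skip
  | .push r b => .push (f r) b
  | .seq p q => .seq (p.map f) (q.map f)
  | .pop r pn pt pf => .pop (f r) (pn.map f) (pt.map f) (pf.map f)
  | .loop r pt pf => .loop (f r) (pt.map f) (pf.map f)

theorem Exec.map {R R' : Type} [DecidableEq R] [DecidableEq R'] {f : R → R'}
    (hf : Injective f) {p : Prog R} {s s' : R → List Bool} {t : ℕ} (h : Exec p s s' t)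
    (S : R' → List Bool) : Exec (p.map f) (extend f s S) (extend f s' S) t := by
  have hu : ∀ (s : R → List Bool) r l,
      update (extend f s S) (f r) l = extend f (update s r l) S := by
    intro s r l
    funext x
    by_cases hx : ∃ y, f y = x
    · obtain ⟨y, rfl⟩ := hx
      rw [hf.extend_apply]
      by_cases hy : y = r
      · subst hy; simp
      · rw [update_of_ne (hf.ne hy), hf.extend_apply, update_of_ne hy]
    · rw [extend_apply' _ _ _ hx, update_of_ne, extend_apply' _ _ _ hx]
      rintro rfl
      exact hx ⟨r, rfl⟩
  have ha : ∀ (s : R → List Bool) r, extend f s S (f r) = s r := fun s r => hf.extend_apply _ _ _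
  induction h with
  | skip s => exact .skip _
  | push r b s =>
    rw [← hu, ← ha s r]
    exact .push _ _ _
  | seq _ _ ih ih' => exact .seq ih ih'
  | pop_nil h _ ih => exact .pop_nil (by rw [ha, h]) ih
  | pop_true h _ ih => exact .pop_true (by rw [ha, h]) (by rwa [hu])
  | pop_false h _ ih => exact .pop_false (by rw [ha, h]) (by rwa [hu])
  | loop_nil h => exact .loop_nil (by rw [ha, h])
  | loop_true h _ _ ih ih' => exact .loop_true (by rw [ha, h]) (by rwa [hu]) ih'
  | loop_false h _ _ ih ih' => exact .loop_false (by rw [ha, h]) (by rwa [hu]) ih'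

/-- A frame rule: the program runs inside a larger register set, and registers outside the image
keep their contents. This is how programs are put together from parts. -/
theorem Exec.map_of {R R' : Type} [DecidableEq R] [DecidableEq R'] {f : R → R'}
    (hf : Injective f) {p : Prog R} {s s' : R → List Bool} {t : ℕ} (h : Exec p s s' t)
    {S S' : R' → List Bool} (hS : ∀ x, S (f x) = s x) (hS' : ∀ x, S' (f x) = s' x)
    (hframe : ∀ y, (∀ x, f x ≠ y) → S' y = S y) : Exec (p.map f) S S' t := by
  have key := h.map hf S
  have h1 : extend f s S = S := by
    funext y
    by_cases hy : ∃ x, f x = y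
    · obtain ⟨x, rfl⟩ := hy
      rw [hf.extend_apply, hS]
    · exact extend_apply' _ _ _ hy
  have h2 : extend f s' S = S' := by
    funext y
    by_cases hy : ∃ x, f x = y
    · obtain ⟨x, rfl⟩ := hy
      rw [hf.extend_apply, hS']
    · rw [extend_apply' _ _ _ hy, hframe y fun x hx => hy ⟨x, hx⟩]
  rwa [h1, h2] at key

/-- The total length of the contents of all registers. -/
def totalLength {R : Type} [Fintype R] (s : R → List Bool) : ℕ := ∑ r, (s r).length

theorem totalLength_update {R : Type} [Fintype R] [DecidableEq R] (s : R → List Bool) (r : R)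
    (l : List Bool) : totalLength (update s r l) + (s r).length = totalLength s + l.length := by
  unfold totalLength
  rw [← Finset.add_sum_erase _ _ (Finset.mem_univ r),
    ← Finset.add_sum_erase Finset.univ (fun r => (s r).length) (Finset.mem_univ r)]
  have : ∑ x ∈ Finset.univ.erase r, (update s r l x).length =
      ∑ x ∈ Finset.univ.erase r, (s x).length :=
    Finset.sum_congr rfl fun x hx => by rw [update_of_ne (Finset.ne_of_mem_erase hx)]
  rw [this, update_self]
  omega

/-- A step puts at most one bit into at most one register. This bounds the output of a program by
its input and its time. -/
theorem Exec.totalLength_le {R : Type} [Fintype R] [DecidableEq R] {p : Prog R}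
    {s s' : R → List Bool} {t : ℕ} (h : Exec p s s' t) :
    totalLength s' ≤ totalLength s + t := by
  induction h with
  | skip s => omega
  | push r b s =>
    have := totalLength_update s r (b :: s r)
    rw [List.length_cons] at this
    omega
  | seq _ _ ih ih' => omega
  | pop_nil h _ ih => omega
  | @pop_true r _ _ _ s _ _ l h _ ih | @pop_false r _ _ _ s _ _ l h _ ih =>
    have := totalLength_update s r l
    rw [h, List.length_cons] at this
    omega
  | loop_nil h => omega
  | @loop_true r _ _ s _ _ _ _ l h _ _ ih ih' | @loop_false r _ _ s _ _ _ _ l h _ _ ih ih' =>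
    have := totalLength_update s r l
    rw [h, List.length_cons] at this
    omega

/-- Put a bit in front of several registers. -/
def Prog.pushAll {R : Type} (b : Bool) : List R → Prog R
  | [] => .skip
  | r :: rs => .seq (.push r b) (pushAll b rs)

theorem Exec.congr {R : Type} [DecidableEq R] {p : Prog R} {s s₁ s₂ : R → List Bool} {t₁ t₂ : ℕ}
    (h : Exec p s s₁ t₁) (hs : s₁ = s₂) (ht : t₁ = t₂) : Exec p s s₂ t₂ := by
  subst hs ht
  exact h

theorem exec_pushAll {R : Type} [DecidableEq R] (b : Bool) (rs : List R) (hrs : rs.Nodup)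
    (s : R → List Bool) :
    Exec (.pushAll b rs) s (fun x => if x ∈ rs then b :: s x else s x) (rs.length + 1) := by
  induction rs generalizing s with
  | nil => exact (Exec.skip s).congr (by simp) (by simp)
  | cons r rs ih =>
    obtain ⟨hr, hrs⟩ := List.nodup_cons.1 hrs
    refine (Exec.seq (Exec.push r b s) (ih hrs _)).congr ?_ (by simp [add_comm])
    funext x
    by_cases hx : x = r
    · subst hx; simp [hr]
    · simp [hx]

/-- Empty the register `r` and put its reversed contents in front of the registers `rs`. -/
def Prog.drain {R : Type} (r : R) (rs : List R) : Prog R :=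
  .loop r (.pushAll true rs) (.pushAll false rs)

theorem exec_drain {R : Type} [DecidableEq R] (r : R) (rs : List R) (hrs : rs.Nodup)
    (hr : r ∉ rs) (l : List Bool) (s : R → List Bool) (hs : s r = l) :
    Exec (.drain r rs) s
      (fun x => if x = r then [] else if x ∈ rs then l.reverse ++ s x else s x)
      (l.length * (rs.length + 2) + 1) := by
  induction l generalizing s with
  | nil =>
    refine (Exec.loop_nil hs).congr ?_ (by simp)
    funext x
    by_cases hx : x = r
    · subst hx; simp [hs]
    · simp [hx]
  | cons b l ih =>
    have h1 := exec_pushAll b rs hrs (update s r l)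
    have h2 := ih (fun x => if x ∈ rs then b :: update s r l x else update s r l x) (by simp [hr])
    have key : Exec (.drain r rs) s
        (fun x => if x = r then [] else if x ∈ rs then l.reverse ++
          (if x ∈ rs then b :: update s r l x else update s r l x) else
          (if x ∈ rs then b :: update s r l x else update s r l x))
        (rs.length + 1 + (l.length * (rs.length + 2) + 1) + 1) := by
      cases b
      · exact Exec.loop_false hs h1 h2
      · exact Exec.loop_true hs h1 h2
    refine key.congr ?_ (by simp only [List.length_cons]; ring)
    funext x
    by_cases hx : x = r
    · subst hx; simp
    · by_cases hx' : x ∈ rs <;> simp [hx, hx']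

/-- Empty the register `r` and put its contents in front of the registers `rs`. -/
def Prog.spread {R : Type} (r tmp : R) (rs : List R) : Prog R :=
  .seq (.drain r [tmp]) (.drain tmp rs)

/-- Draining into `tmp` and then from `tmp` reverses the string twice. Several targets are allowed
because reading a register destroys it, so that all copies have to be made at once. -/
theorem exec_spread {R : Type} [DecidableEq R] (r tmp : R) (rs : List R) (hrs : rs.Nodup)
    (hr : r ∉ rs) (htmp : tmp ∉ rs) (hne : tmp ≠ r) (s : R → List Bool) (hs : s tmp = []) :
    Exec (.spread r tmp rs) s
      (fun x => if x = r then [] else if x ∈ rs then s r ++ s x else s x)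
      ((s r).length * (rs.length + 5) + 2) := by
  have h1 := exec_drain r [tmp] (by simp) (by simpa using hne.symm) (s r) s rfl
  have h2 := exec_drain tmp rs hrs htmp (s r).reverse
    (fun x => if x = r then [] else if x ∈ [tmp] then (s r).reverse ++ s x else s x)
    (by simp [hne, hs])
  refine (Exec.seq h1 h2).congr ?_ (by
    simp only [List.length_reverse, List.length_cons, List.length_nil]; ring)
  funext x
  by_cases hx : x = r
  · subst hx; simp [hne.symm, hr]
  · by_cases hx' : x = tmp
    · subst hx'; simp [hne, hs, htmp]
    · simp [hx, hx']

end Programs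
/-! ### Functions computable by polynomial-time programs -/

section PolyT

open Function

/-- A type whose elements are stored in finitely many registers. -/
class Reg (α : Type) where
  /-- the registers -/
  K : Type
  [fin : Fintype K]
  [dec : DecidableEq K]
  /-- the contents of the registers -/
  enc : α → K → List Bool

attribute [reducible] Reg.fin Reg.dec
attribute [instance] Reg.fin Reg.dec

instance : Reg (List Bool) where
  K := Unit
  enc l _ := l

instance : Reg Unit where
  K := Empty
  enc _ := Empty.elim

instance {α β : Type} [Reg α] [Reg β] : Reg (α × β) where
  K := Reg.K α ⊕ Reg.K β
  enc x := Sum.elim (Reg.enc x.1) (Reg.enc x.2)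

/-- The total length of the strings storing `a`. -/
def size {α : Type} [Reg α] (a : α) : ℕ := totalLength (Reg.enc a)

@[simp] theorem size_list (l : List Bool) : size l = l.length := by
  change ∑ r : Unit, (l : List Bool).length = _
  simp

@[simp] theorem size_unit (u : Unit) : size u = 0 :=
  Finset.sum_of_isEmpty (f := fun r : Empty => (Reg.enc u r).length) Finset.univ

@[simp] theorem size_prod {α β : Type} [Reg α] [Reg β] (x : α × β) :
    size x = size x.1 + size x.2 := by
  change ∑ r : Reg.K α ⊕ Reg.K β, (Sum.elim (Reg.enc x.1) (Reg.enc x.2) r).length = _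
  simp [size, totalLength]

/-- The register contents `a`, `b` and `w`. -/
def store {A B W : Type} (a : A → List Bool) (b : B → List Bool) (w : W → List Bool) :
    A ⊕ B ⊕ W → List Bool := Sum.elim a (Sum.elim b w)

/-- Empty registers. -/
def empty (A : Type) : A → List Bool := fun _ => []

/-- The program `p` computes `f` in time bounded by the polynomial `P`. -/
def Computes {α β W : Type} [Reg α] [Reg β] [DecidableEq W] (p : Prog (Reg.K α ⊕ Reg.K β ⊕ W))
    (P : Polynomial ℕ) (f : α → β) : Prop :=
  ∀ a, ∃ t ≤ P.eval (size a), Exec p (store (Reg.enc a) (empty _) (empty _))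
    (store (empty _) (Reg.enc (f a)) (empty _)) t

/-- `f` is computed by a program in polynomial time. -/
@[fun_prop]
def PolyT {α β : Type} [Reg α] [Reg β] (f : α → β) : Prop :=
  ∃ (W : Type) (_ : Fintype W) (_ : DecidableEq W) (p : Prog (Reg.K α ⊕ Reg.K β ⊕ W))
    (P : Polynomial ℕ), Computes p P f

variable {α β γ δ : Type} [Reg α] [Reg β] [Reg γ] [Reg δ]

theorem Computes.size_le {W : Type} [Fintype W] [DecidableEq W]
    {p : Prog (Reg.K α ⊕ Reg.K β ⊕ W)} {P : Polynomial ℕ} {f : α → β} (h : Computes p P f)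
    (a : α) : size (f a) ≤ size a + P.eval (size a) := by
  obtain ⟨t, ht, h⟩ := h a
  have := h.totalLength_le
  simp only [totalLength, store, Fintype.sum_sum_type, Sum.elim_inl, Sum.elim_inr, empty,
    List.length_nil, Finset.sum_const_zero, zero_add, add_zero] at this
  exact this.trans (Nat.add_le_add_left ht _)

theorem PolyT.exists_size_le {f : α → β} (hf : PolyT f) :
    ∃ P : Polynomial ℕ, ∀ a, size (f a) ≤ P.eval (size a) := by
  obtain ⟨W, _, _, p, P, h⟩ := hf
  exact ⟨Polynomial.X + P, fun a => by simpa using h.size_le a⟩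

/-- The intermediate value lives in what are work registers of the composite. Each program empties
its input and its work registers, so the second one starts from a clean store. -/
theorem PolyT.comp {f : α → β} {g : β → γ} (hg : PolyT g) (hf : PolyT f) :
    PolyT fun a => g (f a) := by
  obtain ⟨W, _, _, p, P, hp⟩ := hf
  obtain ⟨V, _, _, q, Q, hq⟩ := hg
  let i : Reg.K α ⊕ Reg.K β ⊕ W → Reg.K α ⊕ Reg.K γ ⊕ Reg.K β ⊕ W ⊕ V :=
    Sum.elim (fun x => .inl x) (Sum.elim (fun x => .inr (.inr (.inl x)))
      fun x => .inr (.inr (.inr (.inl x))))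
  let j : Reg.K β ⊕ Reg.K γ ⊕ V → Reg.K α ⊕ Reg.K γ ⊕ Reg.K β ⊕ W ⊕ V :=
    Sum.elim (fun x => .inr (.inr (.inl x))) (Sum.elim (fun x => .inr (.inl x))
      fun x => .inr (.inr (.inr (.inr x))))
  have hi : Injective i := by
    rintro (x | x | x) (y | y | y) h <;> simp [i] at h <;> simp [h]
  have hj : Injective j := by
    rintro (x | x | x) (y | y | y) h <;> simp [j] at h <;> simp [h]
  refine ⟨_, inferInstance, inferInstance, .seq (p.map i) (q.map j), P + Q.comp (Polynomial.X + P),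
    fun a => ?_⟩
  obtain ⟨t, ht, hp'⟩ := hp a
  obtain ⟨u, hu, hq'⟩ := hq (f a)
  refine ⟨t + u, ?_, .seq (s' := store (empty _) (empty _)
    (Sum.elim (Reg.enc (f a)) (empty _))) (hp'.map_of hi ?_ ?_ ?_) (hq'.map_of hj ?_ ?_ ?_)⟩
  · have := polynomial_eval_mono Q (hp.size_le a)
    simp only [Polynomial.eval_add, Polynomial.eval_comp, Polynomial.eval_X] at this ⊢
    omega
  · rintro (x | x | x) <;> rfl
  · rintro (x | x | x) <;> rfl
  · rintro (x | x | x | x | x) h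
    exacts [absurd rfl (h (.inl x)), rfl, absurd rfl (h (.inr (.inl x))),
      absurd rfl (h (.inr (.inr x))), rfl]
  · rintro (x | x | x) <;> rfl
  · rintro (x | x | x) <;> rfl
  · rintro (x | x | x | x | x) h
    exacts [rfl, absurd rfl (h (.inr (.inl x))), absurd rfl (h (.inl x)), rfl,
      absurd rfl (h (.inr (.inr x)))]

theorem PolyT.prodMap {f : α → β} {g : γ → δ} (hf : PolyT f) (hg : PolyT g) :
    PolyT fun x : α × γ => (f x.1, g x.2) := by
  obtain ⟨W, _, _, p, P, hp⟩ := hf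
  obtain ⟨V, _, _, q, Q, hq⟩ := hg
  let i : Reg.K α ⊕ Reg.K β ⊕ W → (Reg.K α ⊕ Reg.K γ) ⊕ (Reg.K β ⊕ Reg.K δ) ⊕ W ⊕ V :=
    Sum.elim (fun x => .inl (.inl x)) (Sum.elim (fun x => .inr (.inl (.inl x)))
      fun x => .inr (.inr (.inl x)))
  let j : Reg.K γ ⊕ Reg.K δ ⊕ V → (Reg.K α ⊕ Reg.K γ) ⊕ (Reg.K β ⊕ Reg.K δ) ⊕ W ⊕ V :=
    Sum.elim (fun x => .inl (.inr x)) (Sum.elim (fun x => .inr (.inl (.inr x)))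
      fun x => .inr (.inr (.inr x)))
  have hi : Injective i := by
    rintro (x | x | x) (y | y | y) h <;> simp [i] at h <;> simp [h]
  have hj : Injective j := by
    rintro (x | x | x) (y | y | y) h <;> simp [j] at h <;> simp [h]
  refine ⟨_, inferInstance, inferInstance, .seq (p.map i) (q.map j), P + Q, fun a => ?_⟩
  obtain ⟨t, ht, hp'⟩ := hp a.1
  obtain ⟨u, hu, hq'⟩ := hq a.2
  refine ⟨t + u, ?_, .seq (s' := store (Sum.elim (empty _) (Reg.enc a.2))
    (Sum.elim (Reg.enc (f a.1)) (empty _)) (empty _)) (hp'.map_of hi ?_ ?_ ?_)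
    (hq'.map_of hj ?_ ?_ ?_)⟩
  · have h1 := polynomial_eval_mono P (show size a.1 ≤ size a by simp)
    have h2 := polynomial_eval_mono Q (show size a.2 ≤ size a by simp)
    simp only [Polynomial.eval_add] at h1 h2 ⊢
    omega
  · rintro (x | x | x) <;> rfl
  · rintro (x | x | x) <;> rfl
  · rintro ((x | x) | (x | x) | x | x) h
    exacts [absurd rfl (h (.inl x)), rfl, absurd rfl (h (.inr (.inl x))), rfl,
      absurd rfl (h (.inr (.inr x))), rfl]
  · rintro (x | x | x) <;> rfl
  · rintro (x | x | x) <;> rfl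
  · rintro ((x | x) | (x | x) | x | x) h
    exacts [rfl, absurd rfl (h (.inl x)), rfl, absurd rfl (h (.inr (.inl x))), rfl,
      absurd rfl (h (.inr (.inr x)))]

-- Copying, permuting and deleting registers.

/-- The output registers `r` with `φ r = some k`. -/
noncomputable def targets {A B : Type} [DecidableEq A] [Fintype B] (φ : B → Option A) (k : A) :
    List (A ⊕ B ⊕ Unit) :=
  (Finset.univ.filter fun r : B => φ r = some k).toList.map fun r => .inr (.inl r)

theorem mem_targets {A B : Type} [DecidableEq A] [Fintype B] (φ : B → Option A) (k : A)
    (x : A ⊕ B ⊕ Unit) : x ∈ targets φ k ↔ ∃ r, φ r = some k ∧ .inr (.inl r) = x := by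
  simp [targets]

/-- Move the contents of the input registers `ks` to the output registers `r` with `φ r = some k`. -/
noncomputable def Prog.moveRegs {A B : Type} [DecidableEq A] [Fintype B] (φ : B → Option A) :
    List A → Prog (A ⊕ B ⊕ Unit)
  | [] => .skip
  | k :: ks => .seq (.spread (.inl k) (.inr (.inr ())) (targets φ k)) (moveRegs φ ks)

/-- An output register has at most one source under `φ`, so it is still empty when its source is
moved; `hv` is the form of this that survives the induction. -/
theorem exec_moveRegs {A B : Type} [DecidableEq A] [DecidableEq B] [Fintype B]
    (φ : B → Option A) (N : ℕ) (ks : List A) (hks : ks.Nodup) (u : A → List Bool)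
    (v : B → List Bool) (hv : ∀ r, ∀ k ∈ ks, φ r = some k → v r = [])
    (hN : ∀ k, (u k).length ≤ N) :
    ∃ t ≤ ks.length * (N * (Fintype.card B + 5) + 2) + 1,
      Exec (.moveRegs φ ks) (store u v (empty Unit))
        (store (fun k => if k ∈ ks then [] else u k)
          (fun r => (φ r).elim (v r) fun k => if k ∈ ks then u k else v r) (empty Unit)) t := by
  induction ks generalizing u v with
  | nil =>
    refine ⟨1, by simp, (Exec.skip _).congr ?_ rfl⟩
    congr 1
    funext r
    cases φ r <;> simp
  | cons k ks ih =>
    obtain ⟨hk, hks⟩ := List.nodup_cons.1 hks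
    have hc : (targets φ k).length ≤ Fintype.card B := by
      simpa [targets] using Finset.card_le_univ _
    have h1 := exec_spread (.inl k : A ⊕ B ⊕ Unit) (.inr (.inr ())) (targets φ k)
      ((Finset.nodup_toList _).map fun _ _ h => by simpa using h) (by simp [mem_targets])
      (by simp [mem_targets]) (by simp) (store u v (empty Unit)) rfl
    replace h1 := h1.congr (s₂ := store (fun j => if j = k then [] else u j)
        (fun r => if φ r = some k then u k else v r) (empty Unit)) (by
      funext x
      rcases x with x | x | x
      · simp [store, mem_targets]
      · by_cases hx : φ x = some k
        · simp [store, mem_targets, hx, hv x k (by simp) hx]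
        · simp [store, mem_targets, hx]
      · simp [store, mem_targets]) rfl
    obtain ⟨t, ht, h3⟩ := ih hks (fun j => if j = k then [] else u j)
      (fun r => if φ r = some k then u k else v r) (by
        intro r j hj hr
        have : j ≠ k := fun h => hk (h ▸ hj)
        simp [hr, this, hv r j (by simp [hj]) hr]) (by
        intro j
        by_cases hj : j = k <;> simp [hj, hN])
    refine ⟨_, ?_, (Exec.seq h1 h3).congr ?_ rfl⟩
    · have := Nat.mul_le_mul (hN k) (Nat.add_le_add_right hc 5)
      simp only [List.length_cons, add_mul, one_mul, store, Sum.elim_inl] at this ht ⊢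
      omega
    · congr 1
      · funext j
        by_cases hj : j = k <;> simp [hj]
      · funext r
        rcases hr : φ r with _ | j
        · simp
        · by_cases hj : j = k
          · subst hj; simp [hk]
          · by_cases hj' : j ∈ ks <;> simp [hj, hj']

/-- A function which only copies, permutes and deletes registers is computable. -/
theorem PolyT.of_regs {f : α → β} (φ : Reg.K β → Option (Reg.K α))
    (h : ∀ a r, Reg.enc (f a) r = (φ r).elim [] (Reg.enc a)) : PolyT f := by
  refine ⟨Unit, inferInstance, inferInstance, .moveRegs φ Finset.univ.toList,
    Polynomial.C (Fintype.card (Reg.K α)) *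
      (Polynomial.X * Polynomial.C (Fintype.card (Reg.K β) + 5) + 2) + 1, fun a => ?_⟩
  obtain ⟨t, ht, h'⟩ := exec_moveRegs φ (size a) Finset.univ.toList (Finset.nodup_toList _)
    (Reg.enc a) (empty _) (fun _ _ _ _ => rfl)
    (fun k => Finset.single_le_sum (f := fun k => (Reg.enc a k).length) (by simp)
      (Finset.mem_univ k))
  refine ⟨t, by simpa using ht, h'.congr ?_ rfl⟩
  congr 1
  · funext k; simp [empty]
  · funext r
    rw [h]
    cases φ r <;> simp [empty]

@[fun_prop]
theorem PolyT.id' : PolyT fun a : α => a := .of_regs some fun _ _ => rfl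

theorem PolyT.fst' : PolyT fun x : α × β => x.1 := .of_regs (fun k => some (.inl k)) fun _ _ => rfl

theorem PolyT.snd' : PolyT fun x : α × β => x.2 := .of_regs (fun k => some (.inr k)) fun _ _ => rfl

@[fun_prop]
theorem PolyT.fst {f : α → β × γ} (hf : PolyT f) : PolyT fun a => (f a).1 := PolyT.fst'.comp hf

@[fun_prop]
theorem PolyT.snd {f : α → β × γ} (hf : PolyT f) : PolyT fun a => (f a).2 := PolyT.snd'.comp hf

@[fun_prop]
theorem PolyT.pair {f : α → β} {g : α → γ} (hf : PolyT f) (hg : PolyT g) :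
    PolyT fun a => (f a, g a) :=
  (hf.prodMap hg).comp (f := fun a : α => (a, a)) <|
    .of_regs (fun k => some (k.elim id id)) fun _ r => by cases r <;> rfl

theorem PolyT.nil : PolyT fun _ : α => ([] : List Bool) := .of_regs (fun _ => none) fun _ _ => rfl

@[fun_prop]
theorem PolyT.cons {f : α → List Bool} (b : Bool) (hf : PolyT f) : PolyT fun a => b :: f a := by
  obtain ⟨W, _, _, p, P, hp⟩ := hf
  refine ⟨W, inferInstance, inferInstance, .seq p (.push (.inr (.inl ())) b), P + 1, fun a => ?_⟩
  obtain ⟨t, ht, h⟩ := hp a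
  refine ⟨t + 1, by simpa using ht, (h.seq (.push _ _ _)).congr ?_ rfl⟩
  funext x
  rcases x with x | x | x <;> (simp [store]; try rfl)

theorem PolyT.const_list (l : List Bool) : PolyT fun _ : α => l := by
  induction l with
  | nil => exact .nil
  | cons b l ih => exact .cons b ih

-- Case distinction and iteration.

/-- Branch on the first bit of a list. -/
def bcase {β : Type} (l : List Bool) (n : β) (t f : List Bool → β) : β :=
  match l with
  | [] => n
  | true :: l => t l
  | false :: l => f l

@[simp] theorem bcase_nil {τ : Type} (n : τ) (t f : List Bool → τ) : bcase [] n t f = n := rfl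

@[simp] theorem bcase_true {τ : Type} (l : List Bool) (n : τ) (t f : List Bool → τ) :
    bcase (true :: l) n t f = t l := rfl

@[simp] theorem bcase_false {τ : Type} (l : List Bool) (n : τ) (t f : List Bool → τ) :
    bcase (false :: l) n t f = f l := rfl

/-- The three branch programs share the input and output registers and have separate work registers.
The `pop` instruction removes the inspected bit, so the branches for a bit see exactly the tail. -/
theorem polyT_bcase_aux {n : α → β} {t f : α × List Bool → β} (hn : PolyT n) (ht : PolyT t)
    (hf : PolyT f) : PolyT fun x : α × List Bool =>
      bcase x.2 (n x.1) (fun l => t (x.1, l)) (fun l => f (x.1, l)) := by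
  obtain ⟨W, _, _, p, P, hp⟩ := hn
  obtain ⟨V, _, _, q, Q, hq⟩ := ht
  obtain ⟨U, _, _, r, R, hr⟩ := hf
  let i : Reg.K α ⊕ Reg.K β ⊕ W → (Reg.K α ⊕ Unit) ⊕ Reg.K β ⊕ W ⊕ V ⊕ U :=
    Sum.elim (fun x => .inl (.inl x)) (Sum.elim (fun x => .inr (.inl x))
      fun x => .inr (.inr (.inl x)))
  let j : (Reg.K α ⊕ Unit) ⊕ Reg.K β ⊕ V → (Reg.K α ⊕ Unit) ⊕ Reg.K β ⊕ W ⊕ V ⊕ U :=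
    Sum.elim .inl (Sum.elim (fun x => .inr (.inl x)) fun x => .inr (.inr (.inr (.inl x))))
  let k : (Reg.K α ⊕ Unit) ⊕ Reg.K β ⊕ U → (Reg.K α ⊕ Unit) ⊕ Reg.K β ⊕ W ⊕ V ⊕ U :=
    Sum.elim .inl (Sum.elim (fun x => .inr (.inl x)) fun x => .inr (.inr (.inr (.inr x))))
  have hi : Injective i := by
    rintro (x | x | x) (y | y | y) h <;> simp [i] at h <;> simp [h]
  have hj : Injective j := by
    rintro (x | x | x) (y | y | y) h <;> simp [j] at h <;> simp [h]
  have hk : Injective k := by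
    rintro (x | x | x) (y | y | y) h <;> simp [k] at h <;> simp [h]
  have hu : ∀ (a : α) (b : Bool) (l : List Bool),
      update (store (Reg.enc (a, b :: l)) (empty (Reg.K β)) (empty (W ⊕ V ⊕ U)))
        (.inl (.inr ())) l = store (Reg.enc (a, l)) (empty _) (empty _) := by
    intro a b l
    funext x
    rcases x with (x | x) | x | x
    · rfl
    · simp [store]; rfl
    · rfl
    · rfl
  refine ⟨_, inferInstance, inferInstance, .pop (.inl (.inr ())) (p.map i) (q.map j) (r.map k),
    P + Q + R + 1, ?_⟩
  rintro ⟨a, l⟩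
  rcases l with _ | ⟨_ | _, l⟩
  · obtain ⟨t, ht, h⟩ := hp a
    refine ⟨t + 1, ?_, .pop_nil rfl (h.map_of hi ?_ ?_ ?_)⟩
    · simp only [Polynomial.eval_add, size_prod, size_list, List.length_nil, add_zero,
        Polynomial.eval_one]
      omega
    · rintro (x | x | x) <;> rfl
    · rintro (x | x | x) <;> rfl
    · rintro ((x | x) | x | x | x | x) h
      exacts [absurd rfl (h (.inl x)), rfl, absurd rfl (h (.inr (.inl x))),
        absurd rfl (h (.inr (.inr x))), rfl, rfl]
  · obtain ⟨t, ht, h⟩ := hr (a, l)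
    refine ⟨t + 1, ?_, .pop_false (l := l) rfl ?_⟩
    · have := polynomial_eval_mono R (show size (a, l) ≤ size (a, false :: l) by simp)
      simp only [Polynomial.eval_add, Polynomial.eval_one] at this ⊢
      omega
    rw [hu]
    refine h.map_of hk ?_ ?_ ?_
    · rintro (x | x | x) <;> rfl
    · rintro ((x | x) | x | x) <;> rfl
    · rintro ((x | x) | x | x | x | x) h
      exacts [absurd rfl (h (.inl (.inl x))), absurd rfl (h (.inl (.inr x))),
        absurd rfl (h (.inr (.inl x))), rfl, rfl, absurd rfl (h (.inr (.inr x)))]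
  · obtain ⟨t, ht, h⟩ := hq (a, l)
    refine ⟨t + 1, ?_, .pop_true (l := l) rfl ?_⟩
    · have := polynomial_eval_mono Q (show size (a, l) ≤ size (a, true :: l) by simp)
      simp only [Polynomial.eval_add, Polynomial.eval_one] at this ⊢
      omega
    rw [hu]
    refine h.map_of hj ?_ ?_ ?_
    · rintro (x | x | x) <;> rfl
    · rintro ((x | x) | x | x) <;> rfl
    · rintro ((x | x) | x | x | x | x) h
      exacts [absurd rfl (h (.inl (.inl x))), absurd rfl (h (.inl (.inr x))),
        absurd rfl (h (.inr (.inl x))), rfl, absurd rfl (h (.inr (.inr x))), rfl]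

theorem polyT_bcase {l : α → List Bool} {n : α → β} {t f : α → List Bool → β} (hl : PolyT l)
    (hn : PolyT n) (ht : PolyT fun x : α × List Bool => t x.1 x.2)
    (hf : PolyT fun x : α × List Bool => f x.1 x.2) :
    PolyT fun a => bcase (l a) (n a) (t a) (f a) :=
  (polyT_bcase_aux hn ht hf).comp (PolyT.id'.pair hl)

/-- Iterating a function as often as a list is long, if the results stay polynomially bounded. -/
theorem PolyT.iterate_aux {f : α → α} (hf : PolyT f) (Q : Polynomial ℕ)
    (hQ : ∀ i a, size (f^[i] a) ≤ Q.eval (i + size a)) :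
    PolyT fun x : List Bool × α => f^[x.1.length] x.2 := by
  obtain ⟨W, _, _, p, P, hp⟩ := hf
  -- A program for the identity serves twice: under `j` it moves the result of `f` back to the place
  -- of its argument, and under `k` it moves the final value to the output.
  obtain ⟨V, _, _, q, R, hq⟩ := PolyT.id' (α := α)
  let i : Reg.K α ⊕ Reg.K α ⊕ W → (Unit ⊕ Reg.K α) ⊕ Reg.K α ⊕ Reg.K α ⊕ W ⊕ V :=
    Sum.elim (fun x => .inl (.inr x)) (Sum.elim (fun x => .inr (.inr (.inl x)))
      fun x => .inr (.inr (.inr (.inl x))))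
  let j : Reg.K α ⊕ Reg.K α ⊕ V → (Unit ⊕ Reg.K α) ⊕ Reg.K α ⊕ Reg.K α ⊕ W ⊕ V :=
    Sum.elim (fun x => .inr (.inr (.inl x))) (Sum.elim (fun x => .inl (.inr x))
      fun x => .inr (.inr (.inr (.inr x))))
  let k : Reg.K α ⊕ Reg.K α ⊕ V → (Unit ⊕ Reg.K α) ⊕ Reg.K α ⊕ Reg.K α ⊕ W ⊕ V :=
    Sum.elim (fun x => .inl (.inr x)) (Sum.elim (fun x => .inr (.inl x))
      fun x => .inr (.inr (.inr (.inr x))))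
  have hi : Injective i := by
    rintro (x | x | x) (y | y | y) h <;> simp [i] at h <;> simp [h]
  have hj : Injective j := by
    rintro (x | x | x) (y | y | y) h <;> simp [j] at h <;> simp [h]
  have hk : Injective k := by
    rintro (x | x | x) (y | y | y) h <;> simp [k] at h <;> simp [h]
  let body := Prog.seq (p.map i) (q.map j)
  have hbody : ∀ (l : List Bool) (a : α), ∃ t ≤ P.eval (size a) + R.eval (size (f a)),
      Exec body (store (Reg.enc (l, a)) (empty _) (empty _))
        (store (Reg.enc (l, f a)) (empty _) (empty _)) t := by
    intro l a
    obtain ⟨t, ht, hp'⟩ := hp a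
    obtain ⟨u, hu, hq'⟩ := hq (f a)
    refine ⟨t + u, by omega, .seq (s' := store (Sum.elim (fun _ => l) (empty _)) (empty _)
      (Sum.elim (Reg.enc (f a)) (empty _))) (hp'.map_of hi ?_ ?_ ?_) (hq'.map_of hj ?_ ?_ ?_)⟩
    · rintro (x | x | x) <;> rfl
    · rintro (x | x | x) <;> rfl
    · rintro ((x | x) | x | x | x | x) h
      exacts [rfl, absurd rfl (h (.inl x)), rfl, absurd rfl (h (.inr (.inl x))),
        absurd rfl (h (.inr (.inr x))), rfl]
    · rintro (x | x | x) <;> rfl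
    · rintro (x | x | x) <;> rfl
    · rintro ((x | x) | x | x | x | x) h
      exacts [rfl, absurd rfl (h (.inr (.inl x))), rfl, absurd rfl (h (.inl x)), rfl,
        absurd rfl (h (.inr (.inr x)))]
  have hu : ∀ (a : α) (b : Bool) (l : List Bool),
      update (store (Reg.enc (b :: l, a)) (empty (Reg.K α)) (empty (Reg.K α ⊕ W ⊕ V)))
        (.inl (.inl ())) l = store (Reg.enc (l, a)) (empty _) (empty _) := by
    intro a b l
    funext x
    rcases x with (x | x) | x | x
    · simp [store]; rfl
    · rfl
    · rfl
    · rfl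
  -- A single bound `N` for the sizes of all iterates makes the cost of every round uniform.
  have hloop : ∀ (N : ℕ) (l : List Bool) (a : α), (∀ m ≤ l.length, size (f^[m] a) ≤ N) →
      ∃ t ≤ l.length * (P.eval N + R.eval N + 1) + 1,
        Exec (.loop (.inl (.inl ())) body body) (store (Reg.enc (l, a)) (empty _) (empty _))
          (store (Reg.enc (([] : List Bool), f^[l.length] a)) (empty _) (empty _)) t := by
    intro N l
    induction l with
    | nil => exact fun a _ => ⟨1, by simp, .loop_nil rfl⟩
    | cons b l ih =>
      intro a hN
      obtain ⟨t, ht, h⟩ := hbody l a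
      obtain ⟨u, hu', h'⟩ := ih (f a) fun m hm => by
        have := hN (m + 1) (by simpa using hm)
        rwa [iterate_succ_apply] at this
      have h1 := polynomial_eval_mono P (hN 0 (by simp))
      have h2 := polynomial_eval_mono R (hN 1 (by simp))
      simp only [iterate_zero, iterate_one, id] at h1 h2
      refine ⟨t + u + 1, ?_, ?_⟩
      · simp only [List.length_cons, add_mul, one_mul] at hu' ⊢
        omega
      · rw [← hu a b l] at h
        cases b
        · exact .loop_false rfl h h'
        · exact .loop_true rfl h h'
  refine ⟨_, inferInstance, inferInstance, .seq (.loop (.inl (.inl ())) body body) (q.map k),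
    Polynomial.X * (P.comp Q + R.comp Q + 1) + 1 + R.comp Q, ?_⟩
  rintro ⟨l, a⟩
  have hN : ∀ m ≤ l.length, size (f^[m] a) ≤ Q.eval (size (l, a)) := fun m hm =>
    (hQ m a).trans (polynomial_eval_mono Q (by simpa using hm))
  obtain ⟨t, ht, h⟩ := hloop _ l a hN
  obtain ⟨u, hu', h'⟩ := hq (f^[l.length] a)
  refine ⟨t + u, ?_, h.seq (h'.map_of hk ?_ ?_ ?_)⟩
  · have h1 := polynomial_eval_mono R (hN l.length le_rfl)
    have h2 := Nat.mul_le_mul_right (P.eval (Q.eval (size (l, a))) +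
      R.eval (Q.eval (size (l, a))) + 1) (show l.length ≤ size (l, a) by simp)
    simp only [Polynomial.eval_add, Polynomial.eval_mul, Polynomial.eval_comp, Polynomial.eval_X,
      Polynomial.eval_one] at h1 h2 ⊢
    omega
  · rintro (x | x | x) <;> rfl
  · rintro (x | x | x) <;> rfl
  · rintro ((x | x) | x | x | x | x) h
    exacts [rfl, absurd rfl (h (.inl x)), absurd rfl (h (.inr (.inl x))), rfl, rfl,
      absurd rfl (h (.inr (.inr x)))]

/-- Iterating a function as often as a list is long, if each step enlarges the data by an amount
controlled by a quantity `M` which does not grow. -/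
theorem PolyT.iterate {f : α → α} (hf : PolyT f) (M : α → ℕ) (R : Polynomial ℕ)
    (hM : ∀ a, M a ≤ size a) (hM' : ∀ a, M (f a) ≤ M a)
    (hR : ∀ a, size (f a) ≤ size a + R.eval (M a)) {n : β → List Bool} {g : β → α}
    (hn : PolyT n) (hg : PolyT g) : PolyT fun b => f^[(n b).length] (g b) := by
  refine (PolyT.iterate_aux hf (Polynomial.X + Polynomial.X * R) fun i a => ?_).comp
    (f := fun b => (n b, g b)) (hn.pair hg)
  -- Since `M` never grows, each round adds at most `R.eval (M a)` for the initial `a`: growth is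
  -- additive, not compounded.
  have h : ∀ i a, size (f^[i] a) ≤ size a + i * R.eval (M a) := by
    intro i
    induction i with
    | zero => simp
    | succ i ih =>
      intro a
      rw [iterate_succ_apply]
      refine (ih (f a)).trans ?_
      have h1 := hR a
      have h2 := Nat.mul_le_mul_left i (polynomial_eval_mono R (hM' a))
      simp only [add_mul, one_mul] at h2 ⊢
      omega
  refine (h i a).trans ?_
  have h1 := polynomial_eval_mono R ((hM a).trans (Nat.le_add_left (size a) i))
  have h2 := Nat.mul_le_mul (Nat.le_add_right i (size a)) h1
  simp only [Polynomial.eval_add, Polynomial.eval_mul, Polynomial.eval_X] at h2 ⊢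
  omega

/-- A computable function on strings gives a polynomial-time function on nonempty strings. -/
theorem PolyT.polyTime {f : List Bool → List Bool} (hf : PolyT f) (μ : Str → Str)
    (h : ∀ s, (μ s).1 = f s.1) : PolyTime μ := by
  obtain ⟨W, _, _, p, P, hp⟩ := hf
  refine PolyTime.of_prog p (.inl ()) (.inr (.inl ())) P fun s => ?_
  obtain ⟨t, ht, h'⟩ := hp s.1
  refine ⟨t, by simpa using ht, ?_⟩
  have e1 : update (fun _ => []) (.inl ()) s.1 =
      store (Reg.enc s.1) (empty (Reg.K (List Bool))) (empty W) := by
    funext x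
    rcases x with x | x | x <;> (simp [store, empty]; try rfl)
  have e2 : update (fun _ => []) (.inr (.inl ())) (μ s).1 =
      store (empty (Reg.K (List Bool))) (Reg.enc (f s.1)) (empty W) := by
    funext x
    rcases x with x | x | x <;> (simp [store, empty, h]; try rfl)
  rw [e1, e2]
  exact h'

end PolyT
/-! ### Some computable functions on strings -/

section ListFunctions

open Function

variable {α β P S : Type} [Reg α] [Reg β] [Reg P] [Reg S]

/-- Primitive recursion along a string, with accumulator `s` and parameter `p`. -/
def listRec (g : Bool → P → List Bool → S → S) (p : P) : List Bool → S → S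
  | [], s => s
  | b :: l, s => listRec g p l (g b p l s)

/-- One step of the recursion along a string. -/
def listRecStep (g : Bool → P → List Bool → S → S) (x : P × List Bool × S) : P × List Bool × S :=
  bcase x.2.1 x (fun l => (x.1, l, g true x.1 l x.2.2)) (fun l => (x.1, l, g false x.1 l x.2.2))

omit [Reg P] [Reg S] in
theorem listRecStep_cons (g : Bool → P → List Bool → S → S) (p : P) (b : Bool) (l : List Bool)
    (s : S) : listRecStep g (p, b :: l, s) = (p, l, g b p l s) := by
  cases b <;> rfl

omit [Reg P] [Reg S] in
theorem listRecStep_iterate (g : Bool → P → List Bool → S → S) (p : P) (l : List Bool) (s : S) :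
    (listRecStep g)^[l.length] (p, l, s) = (p, [], listRec g p l s) := by
  induction l generalizing s with
  | nil => rfl
  | cons b l ih =>
    rw [List.length_cons, iterate_succ_apply, listRecStep_cons, ih]
    rfl

/-- The controlling quantity is the size of the parameter together with the length of the unread
part. The accumulator is left out of it, so it may grow from step to step. -/
theorem polyT_listRec {g : Bool → P → List Bool → S → S}
    (hg : ∀ b, PolyT fun x : P × List Bool × S => g b x.1 x.2.1 x.2.2) (R : Polynomial ℕ)
    (hR : ∀ b p l s, size (g b p l s) ≤ size s + R.eval (size p + l.length))
    {p : α → P} {l : α → List Bool} {s : α → S} (hp : PolyT p) (hl : PolyT l) (hs : PolyT s) :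
    PolyT fun a => listRec g (p a) (l a) (s a) := by
  have hstep : PolyT (listRecStep g) := by
    have h : ∀ b, PolyT fun y : (P × List Bool × S) × List Bool =>
        (y.1.1, y.2, g b y.1.1 y.2 y.1.2.2) := fun b =>
      PolyT.pair (by fun_prop) (PolyT.pair (by fun_prop)
        ((hg b).comp (f := fun y : (P × List Bool × S) × List Bool => (y.1.1, y.2, y.1.2.2))
          (by fun_prop)))
    exact polyT_bcase (by fun_prop) (by fun_prop) (h true) (h false)
  have key := (PolyT.iterate hstep (fun x => size x.1 + x.2.1.length) R
    (by rintro ⟨p, l, s⟩; simp)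
    (by
      rintro ⟨p, _ | ⟨b, l⟩, s⟩
      · simp [listRecStep]
      · simp [listRecStep_cons])
    (by
      rintro ⟨p, _ | ⟨b, l⟩, s⟩
      · simp [listRecStep]
      · have h1 := hR b p l s
        have h2 := polynomial_eval_mono R (show size p + l.length ≤ size p + (b :: l).length by simp)
        simp only [listRecStep_cons, size_prod, size_list, List.length_cons] at h1 h2 ⊢
        omega) hl (hp.pair (hl.pair hs))).snd.snd
  simpa only [listRecStep_iterate] using key

theorem listRec_cons (l s : List Bool) :
    listRec (fun b (_ : Unit) _ s => b :: s) () l s = l.reverse ++ s := by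
  induction l generalizing s with
  | nil => rfl
  | cons b l ih => simp [listRec, ih]

@[fun_prop]
theorem PolyT.reverse {f : α → List Bool} (hf : PolyT f) : PolyT fun a => (f a).reverse := by
  have key := polyT_listRec (g := fun b (_ : Unit) _ (s : List Bool) => b :: s)
    (fun b => by fun_prop) 1 (by simp) (p := fun _ : α => ()) (s := fun _ => [])
    (.of_regs Empty.elim fun _ r => r.elim) hf .nil
  simpa only [listRec_cons, List.append_nil] using key

@[fun_prop]
theorem PolyT.append {f g : α → List Bool} (hf : PolyT f) (hg : PolyT g) :
    PolyT fun a => f a ++ g a := by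
  have key := polyT_listRec (g := fun b (_ : Unit) _ (s : List Bool) => b :: s)
    (fun b => by fun_prop) 1 (by simp) (p := fun _ : α => ())
    (.of_regs Empty.elim fun _ r => r.elim) hf.reverse hg
  simpa only [listRec_cons, List.reverse_reverse] using key

/-- The unary representation of the length of a string. -/
def ones (l : List Bool) : List Bool := List.replicate l.length true

@[fun_prop]
theorem polyT_ones {f : α → List Bool} (hf : PolyT f) : PolyT fun a => ones (f a) := by
  have h : ∀ l s, listRec (fun _ (_ : Unit) _ s => true :: s) () l s =
      List.replicate l.length true ++ s := by
    intro l
    induction l with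
    | nil => exact fun _ => rfl
    | cons b l ih => intro s; simp [listRec, ih, List.replicate_succ']
  have key := polyT_listRec (g := fun _ (_ : Unit) _ (s : List Bool) => true :: s)
    (fun b => by fun_prop) 1 (by simp) (p := fun _ : α => ()) (s := fun _ => [])
    (.of_regs Empty.elim fun _ r => r.elim) hf .nil
  simp only [h, List.append_nil] at key
  exact key

@[fun_prop]
theorem PolyT.tail {f : α → List Bool} (hf : PolyT f) : PolyT fun a => (f a).tail := by
  have key := polyT_bcase hf (.nil (α := α)) (t := fun _ l => l) (f := fun _ l => l)
    (by fun_prop) (by fun_prop)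
  refine (congrArg PolyT (funext fun a => ?_)).mp key
  rcases f a with _ | ⟨_ | _, l⟩ <;> rfl

@[fun_prop]
theorem PolyT.drop {f g : α → List Bool} (hf : PolyT f) (hg : PolyT g) :
    PolyT fun a => (g a).drop (f a).length := by
  have h : ∀ n (l : List Bool), List.tail^[n] l = l.drop n := by
    intro n
    induction n with
    | zero => exact fun _ => rfl
    | succ n ih => intro l; rw [iterate_succ_apply, ih, List.drop_tail]
  have key := PolyT.iterate (f := fun l : List Bool => l.tail) (by fun_prop) (fun _ => 0) 0
    (by simp) (by simp) (by simp) hf hg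
  simpa only [h] using key

/-- A string without its longest prefix consisting of ones. -/
def dropOnes (l : List Bool) : List Bool := l.dropWhile id

/-- The longest prefix consisting of ones. -/
def takeOnes (l : List Bool) : List Bool := l.takeWhile id

@[fun_prop]
theorem polyT_dropOnes {f : α → List Bool} (hf : PolyT f) : PolyT fun a => dropOnes (f a) := by
  have hstep : PolyT fun l : List Bool => bcase l [] (fun t => t) (fun _ => l) :=
    polyT_bcase (by fun_prop) .nil (by fun_prop) (by fun_prop)
  have h : ∀ (n : ℕ) (l : List Bool), l.length ≤ n →
      (fun l : List Bool => bcase l [] (fun t => t) (fun _ => l))^[n] l =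
        dropOnes l := by
    intro n
    induction n with
    | zero => intro l hl; simp_all [dropOnes]
    | succ n ih =>
      intro l hl
      rw [iterate_succ_apply]
      rcases l with _ | ⟨_ | _, l⟩
      · exact ih [] (by simp)
      -- A leading `false` makes the string a fixed point of the step, so iterating as often as the
      -- whole string is long does no harm.
      · exact iterate_fixed rfl n
      · exact ih l (by simpa using hl)
  have key := PolyT.iterate hstep (fun _ => 0) 0 (by simp) (by simp)
    (by rintro (_ | ⟨_ | _, l⟩) <;> simp) hf hf
  simpa only [h _ _ le_rfl] using key

/-- A prefix of ones is determined by its length, the difference of the lengths of `l` and `dropOnes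
l`. This makes `takeOnes` computable from functions already treated. -/
theorem takeOnes_eq (l : List Bool) : takeOnes l = (ones l).drop (dropOnes l).length := by
  induction l with
  | nil => rfl
  | cons b l ih =>
    cases b
    · simp [takeOnes, dropOnes, ones]
    · have h : (dropOnes l).length ≤ l.length := List.length_dropWhile_le _ _
      have : dropOnes (true :: l) = dropOnes l := rfl
      rw [this, ones, List.drop_replicate]
      rw [ones, List.drop_replicate] at ih
      change true :: takeOnes l = _
      rw [ih, List.length_cons, Nat.sub_add_comm h, List.replicate_succ]

@[fun_prop]
theorem polyT_takeOnes {f : α → List Bool} (hf : PolyT f) : PolyT fun a => takeOnes (f a) := by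
  simp only [takeOnes_eq]
  fun_prop

theorem takeOnes_append_dropOnes (l : List Bool) : takeOnes l ++ dropOnes l = l :=
  List.takeWhile_append_dropWhile

theorem takeOnes_eq_replicate (l : List Bool) :
    takeOnes l = List.replicate (takeOnes l).length true :=
  List.eq_replicate_of_mem fun _ h => List.mem_takeWhile_imp h

@[simp] theorem takeOnes_unary (n : ℕ) (l : List Bool) :
    takeOnes (List.replicate n true ++ false :: l) = List.replicate n true := by
  induction n with
  | zero => rfl
  | succ n ih => simp [takeOnes, List.replicate_succ]

@[simp] theorem dropOnes_unary (n : ℕ) (l : List Bool) :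
    dropOnes (List.replicate n true ++ false :: l) = false :: l := by
  induction n with
  | zero => rfl
  | succ n ih => simp [dropOnes, List.replicate_succ]

theorem dropOnes_cases (l : List Bool) : dropOnes l = [] ∨ ∃ r, dropOnes l = false :: r ∧
    l = List.replicate (takeOnes l).length true ++ false :: r := by
  have h := takeOnes_append_dropOnes l
  rw [takeOnes_eq_replicate l] at h
  rcases e : dropOnes l with _ | ⟨_ | _, r⟩
  · exact .inl rfl
  · rw [e] at h
    exact .inr ⟨r, rfl, h.symm⟩
  · have := List.head_dropWhile_not id (l := l) (by rw [show l.dropWhile id = _ from e]; simp)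
    simp [show l.dropWhile id = _ from e] at this

end ListFunctions
/-! ### Reading the Polish notation symbol by symbol -/

section TokenFold

open Function

variable {α P S : Type} [Reg α] [Reg P] [Reg S]

/-- The actions on an accumulator in `S`, with parameter in `P`, for the symbols of the Polish
notation; `bin true` is the action for `∨` and `bin false` the one for `∧`, the indices of a
variable are given in unary, and `bad` is the action for a malformed symbol. -/
structure TokenActions (P S : Type) where
  /-- the action for `¬` -/
  neg : P → S → S
  /-- the action for `∧` and `∨` -/
  bin : Bool → P → S → S
  /-- the action for a variable -/
  var : P → List Bool → List Bool → S → S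
  /-- the action for a malformed symbol -/
  bad : P → S → S

namespace TokenActions

/-- Read one symbol. -/
def step (A : TokenActions P S) (x : P × List Bool × S) : P × List Bool × S :=
  bcase x.2.1 x
    (fun l => bcase (dropOnes l) (x.1, [], A.bad x.1 x.2.2)
      (fun _ => (x.1, [], A.bad x.1 x.2.2))
      (fun r => bcase (dropOnes r) (x.1, [], A.bad x.1 x.2.2)
        (fun _ => (x.1, [], A.bad x.1 x.2.2))
        (fun r' => (x.1, r', A.var x.1 (takeOnes l) (takeOnes r) x.2.2))))
    (fun l => bcase l (x.1, [], A.bad x.1 x.2.2)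
      (fun r => bcase r (x.1, [], A.bad x.1 x.2.2)
        (fun r' => (x.1, r', A.bin true x.1 x.2.2))
        (fun r' => (x.1, r', A.bin false x.1 x.2.2)))
      (fun r => (x.1, r, A.neg x.1 x.2.2)))

/-- Read all symbols of a string. -/
def run (A : TokenActions P S) (p : P) (l : List Bool) (s : S) : S :=
  (A.step^[l.length] (p, l, s)).2.2

/-- The actions are computable, and enlarge the accumulator by a controlled amount. -/
structure Feasible (A : TokenActions P S) : Prop where
  neg : PolyT fun x : P × S => A.neg x.1 x.2
  bin : ∀ b, PolyT fun x : P × S => A.bin b x.1 x.2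
  var : PolyT fun x : P × List Bool × List Bool × S => A.var x.1 x.2.1 x.2.2.1 x.2.2.2
  bad : PolyT fun x : P × S => A.bad x.1 x.2
  bound : ∃ R : Polynomial ℕ, ∀ p s, size (A.neg p s) ≤ size s + R.eval (size p) ∧
    (∀ b, size (A.bin b p s) ≤ size s + R.eval (size p)) ∧
    size (A.bad p s) ≤ size s + R.eval (size p) ∧
    ∀ j i, size (A.var p j i s) ≤ size s + R.eval (size p + (j.length + i.length))

-- One alternative for each kind of symbol. An incomplete symbol discards the rest of the string, so
-- reading it also makes progress.
omit [Reg P] [Reg S] in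
theorem step_cases (A : TokenActions P S) (p : P) (l : List Bool) (s : S) :
    (l = [] ∧ A.step (p, l, s) = (p, [], s)) ∨
    (∃ r, l = false :: false :: r ∧ A.step (p, l, s) = (p, r, A.neg p s)) ∨
    (∃ b r, l = false :: true :: b :: r ∧ A.step (p, l, s) = (p, r, A.bin b p s)) ∨
    (∃ j i r, l = true :: (List.replicate j true ++ false :: (List.replicate i true ++ false :: r)) ∧
      A.step (p, l, s) =
        (p, r, A.var p (List.replicate j true) (List.replicate i true) s)) ∨
    (l ≠ [] ∧ A.step (p, l, s) = (p, [], A.bad p s)) := by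
  rcases l with _ | ⟨_ | _, l⟩
  · exact .inl ⟨rfl, rfl⟩
  · rcases l with _ | ⟨_ | _, l⟩
    · exact .inr (.inr (.inr (.inr ⟨by simp, rfl⟩)))
    · exact .inr (.inl ⟨l, rfl, rfl⟩)
    · rcases l with _ | ⟨_ | _, l⟩
      · exact .inr (.inr (.inr (.inr ⟨by simp, rfl⟩)))
      · exact .inr (.inr (.inl ⟨false, l, rfl, rfl⟩))
      · exact .inr (.inr (.inl ⟨true, l, rfl, rfl⟩))
  · right; right; right
    rcases dropOnes_cases l with h | ⟨r, h, hl⟩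
    · exact .inr ⟨by simp, by simp [step, h]⟩
    · rcases dropOnes_cases r with h' | ⟨r', h', hr⟩
      · exact .inr ⟨by simp, by simp [step, h, h']⟩
      · refine .inl ⟨_, _, r', by rw [← hr, ← hl], ?_⟩
        rw [← takeOnes_eq_replicate, ← takeOnes_eq_replicate]
        simp [step, h, h']

omit [Reg P] [Reg S] in
theorem step_nil (A : TokenActions P S) (p : P) (s : S) : A.step (p, [], s) = (p, [], s) := rfl

omit [Reg P] [Reg S] in
theorem exists_step_eq (A : TokenActions P S) (p : P) (l : List Bool) (s : S) (hl : l ≠ []) :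
    ∃ l' s', A.step (p, l, s) = (p, l', s') ∧ l'.length < l.length := by
  rcases A.step_cases p l s with ⟨h, _⟩ | ⟨r, rfl, h⟩ | ⟨b, r, rfl, h⟩ | ⟨j, i, r, rfl, h⟩ | ⟨h', h⟩
  · exact absurd h hl
  · exact ⟨_, _, h, by simp⟩
  · exact ⟨_, _, h, by simp; omega⟩
  · exact ⟨_, _, h, by simp; omega⟩
  · exact ⟨_, _, h, List.length_pos_iff.2 h'⟩

omit [Reg P] [Reg S] in
theorem exists_iterate_step (A : TokenActions P S) (p : P) (n : ℕ) : ∀ (l : List Bool) (s : S),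
    l.length ≤ n → ∃ s', ∀ k, l.length ≤ k → A.step^[k] (p, l, s) = (p, [], s') := by
  induction n with
  | zero =>
    intro l s hl
    obtain rfl : l = [] := List.length_eq_zero_iff.1 (by omega)
    exact ⟨s, fun k _ => iterate_fixed rfl k⟩
  | succ n ih =>
    intro l s hl
    by_cases h : l = []
    · subst h
      exact ⟨s, fun k _ => iterate_fixed rfl k⟩
    · obtain ⟨l', s', e, hl'⟩ := A.exists_step_eq p l s h
      obtain ⟨t, ht⟩ := ih l' s' (by omega)
      refine ⟨t, fun k hk => ?_⟩
      obtain ⟨k, rfl⟩ : ∃ m, k = m + 1 := ⟨k - 1, by omega⟩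
      rw [iterate_succ_apply, e, ht k (by omega)]

-- The number of iterations in `run` is the length of the string, usually more than the number of
-- symbols. As the empty string is stationary, surplus iterations change nothing, so the count can
-- be restarted after each symbol.
omit [Reg P] [Reg S] in
theorem run_of_step (A : TokenActions P S) {p : P} {l l' : List Bool} {s s' : S}
    (h : A.step (p, l, s) = (p, l', s')) (hl : l'.length < l.length) :
    A.run p l s = A.run p l' s' := by
  obtain ⟨t, ht⟩ := A.exists_iterate_step p l'.length l' s' le_rfl
  obtain ⟨k, hk⟩ : ∃ m, l.length = m + 1 := ⟨l.length - 1, by omega⟩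
  rw [run, run, hk, iterate_succ_apply, h, ht k (by omega), ht _ le_rfl]

omit [Reg P] [Reg S] in
@[simp] theorem run_nil (A : TokenActions P S) (p : P) (s : S) : A.run p [] s = s := rfl

omit [Reg P] [Reg S] in
theorem run_neg (A : TokenActions P S) (p : P) (l : List Bool) (s : S) :
    A.run p (false :: false :: l) s = A.run p l (A.neg p s) :=
  A.run_of_step rfl (by simp)

omit [Reg P] [Reg S] in
theorem run_bin (A : TokenActions P S) (p : P) (b : Bool) (l : List Bool) (s : S) :
    A.run p (false :: true :: b :: l) s = A.run p l (A.bin b p s) :=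
  A.run_of_step (by cases b <;> rfl) (by simp; omega)

omit [Reg P] [Reg S] in
theorem run_var (A : TokenActions P S) (p : P) (j i : ℕ) (l : List Bool) (s : S) :
    A.run p (true :: (List.replicate j true ++ false :: (List.replicate i true ++ false :: l))) s =
      A.run p l (A.var p (List.replicate j true) (List.replicate i true) s) :=
  A.run_of_step (by simp [step]) (by simp; omega)

theorem Feasible.step {A : TokenActions P S} (h : A.Feasible) : PolyT A.step := by
  have hbad : ∀ {γ : Type} [Reg γ] (f : γ → P × List Bool × S), PolyT f →
      PolyT fun c => ((f c).1, ([] : List Bool), A.bad (f c).1 (f c).2.2) := fun f hf =>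
    PolyT.pair (by fun_prop) (.pair .nil
      (h.bad.comp (f := fun c => ((f c).1, (f c).2.2)) (by fun_prop)))
  refine polyT_bcase (by fun_prop) (by fun_prop) ?_ ?_
  · refine polyT_bcase (by fun_prop) (hbad _ (by fun_prop)) (hbad _ (by fun_prop)) ?_
    refine polyT_bcase (by fun_prop) (hbad _ (by fun_prop)) (hbad _ (by fun_prop)) ?_
    exact PolyT.pair (by fun_prop) (.pair (by fun_prop) (h.var.comp
      (f := fun y : (((P × List Bool × S) × List Bool) × List Bool) × List Bool =>
        (y.1.1.1.1, takeOnes y.1.1.2, takeOnes y.1.2, y.1.1.1.2.2)) (by fun_prop)))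
  · refine polyT_bcase (by fun_prop) (hbad _ (by fun_prop)) ?_ ?_
    · refine polyT_bcase (by fun_prop) (hbad _ (by fun_prop)) ?_ ?_
      all_goals exact PolyT.pair (by fun_prop) (.pair (by fun_prop) ((h.bin _).comp
        (f := fun y : (((P × List Bool × S) × List Bool) × List Bool) × List Bool =>
          (y.1.1.1.1, y.1.1.1.2.2)) (by fun_prop)))
    · exact PolyT.pair (by fun_prop) (.pair (by fun_prop) (h.neg.comp
        (f := fun y : ((P × List Bool × S) × List Bool) × List Bool =>
          (y.1.1.1, y.1.1.2.2)) (by fun_prop)))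

/-- As in `polyT_listRec`, the parameter and the unread string control the growth; the indices of a
variable are parts of the unread string, so their lengths are covered. -/
theorem Feasible.run {A : TokenActions P S} (h : A.Feasible) {p : α → P} {l : α → List Bool}
    {s : α → S} (hp : PolyT p) (hl : PolyT l) (hs : PolyT s) :
    PolyT fun a => A.run (p a) (l a) (s a) := by
  obtain ⟨R, hR⟩ := h.bound
  refine (PolyT.iterate h.step (fun x => size x.1 + x.2.1.length) R ?_ ?_ ?_ hl
    (hp.pair (hl.pair hs))).snd.snd
  · rintro ⟨p, l, s⟩
    simp
  · rintro ⟨p, l, s⟩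
    by_cases hl : l = []
    · subst hl; simp [step_nil]
    · obtain ⟨l', s', e, hl'⟩ := A.exists_step_eq p l s hl
      rw [e]
      simp only
      omega
  · rintro ⟨p, l, s⟩
    obtain ⟨h1, h2, h3, h4⟩ := hR p s
    have hm : ∀ n, R.eval (size p) ≤ R.eval (size p + n) := fun n =>
      polynomial_eval_mono R (Nat.le_add_right _ _)
    rcases A.step_cases p l s with ⟨rfl, e⟩ | ⟨r, rfl, e⟩ | ⟨b, r, rfl, e⟩ | ⟨j, i, r, rfl, e⟩ |
      ⟨h', e⟩ <;> rw [e] <;> simp only [size_prod, size_list]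
    · omega
    · have := hm (false :: false :: r).length
      simp only [List.length_cons] at this ⊢
      omega
    · have := hm (false :: true :: b :: r).length
      have := h2 b
      simp only [List.length_cons] at *
      omega
    · have h5 := h4 (List.replicate j true) (List.replicate i true)
      simp only [List.length_replicate] at h5
      have h6 := polynomial_eval_mono R (show size p + (j + i) ≤ size p + (true ::
        (List.replicate j true ++ false :: (List.replicate i true ++ false :: r))).length by
          simp; omega)
      simp only [List.length_cons, List.length_append, List.length_replicate] at h6 ⊢
      omega
    · have := hm l.length
      simp only [List.length_nil] at *
      omega

end TokenActions

end TokenFold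
/-! ### Expressions whose variables are given by block and index -/

section RawExpressions

/-- Boolean expressions in variables given by a block number and an index. -/
inductive RawExpr : Type
  | var (j i : ℕ) : RawExpr
  | neg (e : RawExpr) : RawExpr
  | and (e₁ e₂ : RawExpr) : RawExpr
  | or (e₁ e₂ : RawExpr) : RawExpr

/-- The string for the variable with index `i` of block `j`. -/
def varCode (j i : ℕ) : List Bool :=
  true :: (List.replicate j true ++ false :: (List.replicate i true ++ [false]))

/-- There is a variable with index `i` of block `j`. -/
def InBlock (ms : List ℕ+) (j i : ℕ) : Prop := ∃ m, ms[j]? = some m ∧ i < m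

namespace RawExpr

/-- Polish notation. -/
def encode : RawExpr → List Bool
  | var j i => varCode j i
  | neg e => false :: false :: e.encode
  | and e₁ e₂ => false :: true :: false :: (e₁.encode ++ e₂.encode)
  | or e₁ e₂ => false :: true :: true :: (e₁.encode ++ e₂.encode)

/-- The value under an assignment. -/
def eval (v : ℕ → ℕ → Bool) : RawExpr → Bool
  | var j i => v j i
  | neg e => !e.eval v
  | and e₁ e₂ => e₁.eval v && e₂.eval v
  | or e₁ e₂ => e₁.eval v || e₂.eval v

/-- All variables belong to the given blocks. -/
def InRange (ms : List ℕ+) : RawExpr → Prop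
  | var j i => InBlock ms j i
  | neg e => e.InRange ms
  | and e₁ e₂ => e₁.InRange ms ∧ e₂.InRange ms
  | or e₁ e₂ => e₁.InRange ms ∧ e₂.InRange ms

/-- Replace the variables by expressions. -/
def subst (g : ℕ → ℕ → RawExpr) : RawExpr → RawExpr
  | var j i => g j i
  | neg e => neg (e.subst g)
  | and e₁ e₂ => and (e₁.subst g) (e₂.subst g)
  | or e₁ e₂ => or (e₁.subst g) (e₂.subst g)

theorem eval_subst (v : ℕ → ℕ → Bool) (g : ℕ → ℕ → RawExpr) (e : RawExpr) :
    (e.subst g).eval v = e.eval fun j i => (g j i).eval v := by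
  induction e <;> simp_all [subst, eval]

/-- Needed because `getBit` returns a default outside the blocks, where two assignments to be
compared may well differ. -/
theorem eval_congr {ms : List ℕ+} {v w : ℕ → ℕ → Bool} (h : ∀ j i, InBlock ms j i → v j i = w j i)
    {e : RawExpr} (he : e.InRange ms) : e.eval v = e.eval w := by
  induction e with
  | var j i => exact h j i he
  | neg e ih => simp [eval, ih he]
  | and e₁ e₂ ih₁ ih₂ => simp [eval, ih₁ he.1, ih₂ he.2]
  | or e₁ e₂ ih₁ ih₂ => simp [eval, ih₁ he.1, ih₂ he.2]

theorem InRange.subst {ms ms' : List ℕ+} {g : ℕ → ℕ → RawExpr}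
    (h : ∀ j i, InBlock ms j i → (g j i).InRange ms') {e : RawExpr} (he : e.InRange ms) :
    (e.subst g).InRange ms' := by
  induction e with
  | var j i => exact h j i he
  | neg e ih => exact ih he
  | and e₁ e₂ ih₁ ih₂ => exact ⟨ih₁ he.1, ih₂ he.2⟩
  | or e₁ e₂ ih₁ ih₂ => exact ⟨ih₁ he.1, ih₂ he.2⟩

end RawExpr

@[simp] theorem inBlock_nil (j i : ℕ) : ¬ InBlock [] j i := by simp [InBlock]

@[simp] theorem inBlock_cons_zero (m : ℕ+) (ms : List ℕ+) (i : ℕ) :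
    InBlock (m :: ms) 0 i ↔ i < m := by simp [InBlock]

@[simp] theorem inBlock_cons_succ (m : ℕ+) (ms : List ℕ+) (j i : ℕ) :
    InBlock (m :: ms) (j + 1) i ↔ InBlock ms j i := by simp [InBlock]

/-- The bit with index `i` of block `j` (and `0` if there is none). -/
def getBit : {ms : List ℕ+} → Inputs ms → ℕ → ℕ → Bool
  | [], _, _, _ => false
  | m :: _, (x, _), 0, i => if h : i < (m : ℕ) then x ⟨i, h⟩ else false
  | _ :: _, (_, y), j + 1, i => getBit y j i

/-- The block of a variable. -/
def Var.block : {ms : List ℕ+} → Var ms → ℕ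
  | _ :: _, .head _ => 0
  | _ :: _, .tail v => v.block + 1

/-- The index of a variable within its block. -/
def Var.index : {ms : List ℕ+} → Var ms → ℕ
  | _ :: _, .head i => i
  | _ :: _, .tail v => v.index

theorem Var.encode_eq : ∀ {ms : List ℕ+} (v : Var ms), true :: v.encode = varCode v.block v.index
  | _ :: _, .head i => rfl
  | _ :: _, .tail v => by
    have := v.encode_eq
    simp only [varCode, List.cons.injEq, true_and] at this
    simp [Var.encode, varCode, Var.block, Var.index, List.replicate_succ, this]

theorem Var.eval_eq : ∀ {ms : List ℕ+} (v : Var ms) (x : Inputs ms),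
    v.eval x = getBit x v.block v.index
  | _ :: _, .head i, (x, y) => by simp [Var.eval, getBit, Var.block, Var.index]
  | _ :: _, .tail v, (x, y) => by simpa [Var.eval, getBit, Var.block, Var.index] using v.eval_eq y

theorem Var.inBlock : ∀ {ms : List ℕ+} (v : Var ms), InBlock ms v.block v.index
  | _ :: _, .head i => by simp [Var.block, Var.index]
  | _ :: _, .tail v => by simpa [Var.block, Var.index] using v.inBlock

theorem InBlock.exists_var : ∀ {ms : List ℕ+} {j i : ℕ}, InBlock ms j i →
    ∃ v : Var ms, v.block = j ∧ v.index = i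
  | [], _, _, h => absurd h (inBlock_nil _ _)
  | m :: ms, 0, i, h => ⟨.head ⟨i, by simpa using h⟩, rfl, rfl⟩
  | m :: ms, j + 1, i, h => by
    obtain ⟨v, hj, hi⟩ := InBlock.exists_var ((inBlock_cons_succ m ms j i).1 h)
    exact ⟨.tail v, by simp [Var.block, hj], by simp [Var.index, hi]⟩

/-- The underlying raw expression. -/
def Expr.toRaw {ms : List ℕ+} : Expr ms → RawExpr
  | .var v => .var v.block v.index
  | .neg e => .neg e.toRaw
  | .and e₁ e₂ => .and e₁.toRaw e₂.toRaw
  | .or e₁ e₂ => .or e₁.toRaw e₂.toRaw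

variable {ms : List ℕ+}

theorem Expr.encode_toRaw (e : Expr ms) : e.toRaw.encode = e.encode := by
  induction e with
  | var v => exact v.encode_eq.symm
  | _ => simp_all [Expr.toRaw, RawExpr.encode, Expr.encode]

theorem Expr.eval_toRaw (e : Expr ms) (x : Inputs ms) : e.toRaw.eval (getBit x) = e.eval x := by
  induction e with
  | var v => exact (v.eval_eq x).symm
  | _ => simp_all [Expr.toRaw, RawExpr.eval, Expr.eval]

theorem Expr.inRange_toRaw (e : Expr ms) : e.toRaw.InRange ms := by
  induction e with
  | var v => exact v.inBlock
  | _ => simp_all [Expr.toRaw, RawExpr.InRange]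

/-- Rewritings are done on raw expressions, where indices are plain numbers; this is the way back to
expressions typed by their blocks. -/
theorem RawExpr.InRange.exists_expr {e : RawExpr} (h : e.InRange ms) :
    ∃ e' : Expr ms, e'.toRaw = e := by
  induction e with
  | var j i =>
    obtain ⟨v, hj, hi⟩ := InBlock.exists_var h
    exact ⟨.var v, by simp [Expr.toRaw, hj, hi]⟩
  | neg e ih =>
    obtain ⟨e', rfl⟩ := ih h
    exact ⟨.neg e', rfl⟩
  | and e₁ e₂ ih₁ ih₂ =>
    obtain ⟨e₁', rfl⟩ := ih₁ h.1
    obtain ⟨e₂', rfl⟩ := ih₂ h.2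
    exact ⟨.and e₁' e₂', rfl⟩
  | or e₁ e₂ ih₁ ih₂ =>
    obtain ⟨e₁', rfl⟩ := ih₁ h.1
    obtain ⟨e₂', rfl⟩ := ih₂ h.2
    exact ⟨.or e₁' e₂', rfl⟩

end RawExpressions

/-! ### Substitution for the variables of an encoded expression -/

section Substitution

variable {α P : Type} [Reg α] [Reg P]

/-- Copy all symbols except variables, and replace those by strings. -/
def substActions (g : P → List Bool → List Bool → List Bool) : TokenActions P (List Bool) where
  neg _ s := s ++ [false, false]
  bin b _ s := s ++ [false, true, b]
  var p j i s := s ++ g p j i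
  bad _ s := s

omit [Reg P] in
@[simp] theorem substActions_neg (g : P → List Bool → List Bool → List Bool) (p : P)
    (s : List Bool) : (substActions g).neg p s = s ++ [false, false] := rfl

omit [Reg P] in
@[simp] theorem substActions_bin (g : P → List Bool → List Bool → List Bool) (b : Bool) (p : P)
    (s : List Bool) : (substActions g).bin b p s = s ++ [false, true, b] := rfl

omit [Reg P] in
@[simp] theorem substActions_var (g : P → List Bool → List Bool → List Bool) (p : P)
    (j i s : List Bool) : (substActions g).var p j i s = s ++ g p j i := rfl

-- Prefix notation contains no closing symbols, so substitution is local: every connective is copied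
-- and every variable replaced where it stands. The remainder `l` and the output `s` are arbitrary
-- for the sake of the induction.
omit [Reg P] in
theorem run_substActions {g : P → List Bool → List Bool → List Bool} {G : ℕ → ℕ → RawExpr} {p : P}
    (h : ∀ j i, g p (List.replicate j true) (List.replicate i true) = (G j i).encode)
    (e : RawExpr) (l s : List Bool) : (substActions g).run p (e.encode ++ l) s =
      (substActions g).run p l (s ++ (e.subst G).encode) := by
  induction e generalizing l s with
  | var j i =>
    have := (substActions g).run_var p j i l s
    simpa [RawExpr.encode, varCode, RawExpr.subst, ← h] using this
  | neg e ih => simp [RawExpr.encode, TokenActions.run_neg, ih, RawExpr.subst]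
  | and e₁ e₂ ih₁ ih₂ =>
    simp [RawExpr.encode, TokenActions.run_bin, ih₁, ih₂, RawExpr.subst]
  | or e₁ e₂ ih₁ ih₂ =>
    simp [RawExpr.encode, TokenActions.run_bin, ih₁, ih₂, RawExpr.subst]

omit [Reg P] in
theorem run_substActions_encode {g : P → List Bool → List Bool → List Bool} {G : ℕ → ℕ → RawExpr}
    {p : P} (h : ∀ j i, g p (List.replicate j true) (List.replicate i true) = (G j i).encode)
    (e : RawExpr) : (substActions g).run p e.encode [] = (e.subst G).encode := by
  simpa using run_substActions h e [] []

theorem polyT_substActions {g : P → List Bool → List Bool → List Bool}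
    (hg : PolyT fun x : P × List Bool × List Bool => g x.1 x.2.1 x.2.2) {p : α → P}
    {l : α → List Bool} (hp : PolyT p) (hl : PolyT l) :
    PolyT fun a => (substActions g).run (p a) (l a) [] := by
  refine TokenActions.Feasible.run ⟨?_, ?_, ?_, ?_, ?_⟩ hp hl .nil
  · exact .append (by fun_prop) (.const_list _)
  · exact fun b => .append (by fun_prop) (.const_list _)
  · exact .append (by fun_prop) (hg.comp
      (f := fun x : P × List Bool × List Bool × List Bool => (x.1, x.2.1, x.2.2.1)) (by fun_prop))
  · exact (by fun_prop : PolyT fun x : P × List Bool => x.2)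
  · obtain ⟨R, hR⟩ := hg.exists_size_le
    refine ⟨R + 3, fun p s => ⟨by simp [substActions], fun b => by simp [substActions],
      by simp [substActions], fun j i => ?_⟩⟩
    have := hR (p, j, i)
    simp only [size_prod, size_list] at this
    simp [substActions]
    omega

end Substitution

/-! ### Headers -/

section Headers

variable {α : Type} [Reg α]

/-- Remove a number in unary and the following `0`. -/
def skipBlock (l : List Bool) : List Bool := (dropOnes l).tail

@[fun_prop]
theorem polyT_skipBlock {f : α → List Bool} (hf : PolyT f) : PolyT fun a => skipBlock (f a) := by
  unfold skipBlock
  fun_prop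

/-- The first `n` numbers in unary at the beginning of a string. -/
def header : ℕ → List Bool → List Bool
  | 0, _ => []
  | n + 1, l => takeOnes l ++ false :: header n (skipBlock l)

/-- The string after the first `n` numbers in unary. -/
def body : ℕ → List Bool → List Bool
  | 0, l => l
  | n + 1, l => body n (skipBlock l)

/-- A string which is empty if and only if the string `l` begins with `n` positive numbers in
unary. -/
def headerError : ℕ → List Bool → List Bool
  | 0, _ => []
  | n + 1, l => bcase l [true]
      (fun _ => bcase (dropOnes l) [true] (fun _ => [true]) (fun r => headerError n r))
      (fun _ => [true])

@[fun_prop]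
theorem polyT_header (n : ℕ) {f : α → List Bool} (hf : PolyT f) :
    PolyT fun a => header n (f a) := by
  induction n generalizing f with
  | zero => exact .nil
  | succ n ih => exact .append (by fun_prop) (.cons _ (ih (by fun_prop)))

@[fun_prop]
theorem polyT_body (n : ℕ) {f : α → List Bool} (hf : PolyT f) : PolyT fun a => body n (f a) := by
  induction n generalizing f with
  | zero => exact hf
  | succ n ih => exact ih (by fun_prop)

@[fun_prop]
theorem polyT_headerError (n : ℕ) {f : α → List Bool} (hf : PolyT f) :
    PolyT fun a => headerError n (f a) := by
  suffices h : PolyT (headerError n) from h.comp hf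
  clear hf f
  induction n with
  | zero => exact .nil
  | succ n ih =>
    exact polyT_bcase (by fun_prop) (.const_list _) (polyT_bcase (by fun_prop) (.const_list _)
      (.const_list _) (ih.comp (by fun_prop))) (.const_list _)

theorem skipBlock_unary (k : ℕ) (l : List Bool) :
    skipBlock (List.replicate k true ++ false :: l) = l := by simp [skipBlock]

theorem header_encodeSizes (ms : List ℕ+) (l : List Bool) :
    header ms.length (encodeSizes ms ++ l) = encodeSizes ms := by
  induction ms with
  | nil => rfl
  | cons m ms ih => simp [header, encodeSizes, skipBlock_unary, ih]

theorem body_encodeSizes (ms : List ℕ+) (l : List Bool) :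
    body ms.length (encodeSizes ms ++ l) = l := by
  induction ms with
  | nil => rfl
  | cons m ms ih => simp [body, encodeSizes, skipBlock_unary, ih]

theorem headerError_encodeSizes (ms : List ℕ+) (l : List Bool) :
    headerError ms.length (encodeSizes ms ++ l) = [] := by
  induction ms with
  | nil => rfl
  | cons m ms ih =>
    obtain ⟨k, hk⟩ : ∃ k, (m : ℕ) = k + 1 := ⟨m - 1, by have := m.pos; omega⟩
    have h := dropOnes_unary (k + 1) (encodeSizes ms ++ l)
    simp only [List.replicate_succ, List.cons_append] at h
    simp [headerError, encodeSizes, hk, List.replicate_succ, h, ih]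

theorem exists_of_headerError : ∀ {n : ℕ} {l : List Bool}, headerError n l = [] →
    ∃ ms : List ℕ+, ms.length = n ∧ ∃ r, l = encodeSizes ms ++ r
  | 0, l, _ => ⟨[], rfl, l, rfl⟩
  | n + 1, [], h => by simp [headerError] at h
  | n + 1, false :: l, h => by simp [headerError] at h
  | n + 1, true :: l, h => by
    rcases dropOnes_cases (true :: l) with e | ⟨r, e, hl⟩
    · simp [headerError, e] at h
    · obtain ⟨ms, hms, t, rfl⟩ := exists_of_headerError (n := n) (l := r) (by
        simpa [headerError, e] using h)
      have hpos : 0 < (takeOnes (true :: l)).length := Nat.succ_pos _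
      generalize (takeOnes (true :: l)).length = k at hpos hl
      lift k to ℕ+ using hpos
      refine ⟨k :: ms, by simp [hms], t, ?_⟩
      rw [hl]
      simp [encodeSizes]

end Headers

/-! ### Recognising the encodings of instances -/

section Recognition

variable {α : Type} [Reg α]

/-- Remove as many numbers in unary as `j` is long. -/
def skipBlocks (j l : List Bool) : List Bool := skipBlock^[j.length] l

@[fun_prop]
theorem polyT_skipBlocks {f g : α → List Bool} (hf : PolyT f) (hg : PolyT g) :
    PolyT fun a => skipBlocks (f a) (g a) := by
  refine PolyT.iterate (f := skipBlock) (by fun_prop) (fun _ => 0) 0 (by simp) (by simp) ?_ hf hg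
  intro l
  have : (dropOnes l).length ≤ l.length := List.length_dropWhile_le _ _
  simp [skipBlock]
  omega

theorem skipBlocks_encodeSizes (j : ℕ) (ms : List ℕ+) :
    skipBlocks (List.replicate j true) (encodeSizes ms) = encodeSizes (ms.drop j) := by
  induction j generalizing ms with
  | zero => rfl
  | succ j ih =>
    simp only [skipBlocks, List.length_replicate, Function.iterate_succ_apply] at ih ⊢
    cases ms with
    | nil =>
      have h : skipBlock (encodeSizes []) = encodeSizes [] := rfl
      rw [h, ih, List.drop_nil, List.drop_nil]
    | cons m ms => simpa [encodeSizes, skipBlock_unary] using ih ms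

/-- The accumulator counts, in unary, the expressions which are still to be read; it is `[false]`
after an error. The parameter holds the sizes of the blocks. -/
def parseActions : TokenActions (List Bool) (List Bool) where
  neg _ c := bcase c [false] (fun _ => c) (fun _ => [false])
  bin _ _ c := bcase c [false] (fun _ => true :: c) (fun _ => [false])
  var p j i c := bcase c [false]
    (fun t => bcase ((takeOnes (skipBlocks j p)).drop i.length) [false] (fun _ => t)
      (fun _ => [false]))
    (fun _ => [false])
  bad _ _ := [false]

theorem length_bcase_le {l : List Bool} {n : List Bool} {t f : List Bool → List Bool} {N : ℕ}
    (hn : n.length ≤ N) (ht : ∀ r, l = true :: r → (t r).length ≤ N)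
    (hf : ∀ r, l = false :: r → (f r).length ≤ N) : (bcase l n t f).length ≤ N := by
  rcases l with _ | ⟨_ | _, l⟩
  exacts [hn, hf l rfl, ht l rfl]

theorem feasible_parseActions : parseActions.Feasible := by
  refine ⟨?_, fun _ => ?_, ?_, .const_list _, 1, fun p c => ⟨?_, fun _ => ?_, ?_, fun j i => ?_⟩⟩
  · exact polyT_bcase (by fun_prop) (.const_list _) (by fun_prop) (.const_list _)
  · exact polyT_bcase (by fun_prop) (.const_list _) (by fun_prop) (.const_list _)
  · exact polyT_bcase (by fun_prop) (.const_list _) (polyT_bcase (by fun_prop) (.const_list _)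
      (by fun_prop) (.const_list _)) (.const_list _)
  all_goals simp only [size_list, Polynomial.eval_one, parseActions]
  · exact length_bcase_le (by simp) (by simp) (by simp)
  · exact length_bcase_le (by simp) (by simp) (by simp)
  · simp
  · refine length_bcase_le (by simp) (fun r hr => ?_) (by simp)
    exact length_bcase_le (by simp) (by simp [hr]; omega) (by simp)

/-- Deleting `i` ones from the unary length of block `j` leaves a nonempty string iff `i` is less
than that length. A missing block leads to the empty string, hence to the error value as well. -/
theorem parseActions_var (ms : List ℕ+) (j i c : ℕ) :
    parseActions.var (encodeSizes ms) (List.replicate j true) (List.replicate i true)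
      (List.replicate (c + 1) true) = List.replicate c true ∧ InBlock ms j i ∨
    parseActions.var (encodeSizes ms) (List.replicate j true) (List.replicate i true)
      (List.replicate (c + 1) true) = [false] ∧ ¬ InBlock ms j i := by
  simp only [parseActions, skipBlocks_encodeSizes, List.length_replicate, List.replicate_succ,
    bcase_true]
  by_cases hj : j < ms.length
  · have e : takeOnes (encodeSizes (ms.drop j)) = List.replicate (ms[j] : ℕ) true := by
      rw [List.drop_eq_getElem_cons hj]
      exact takeOnes_unary _ _
    have hB : InBlock ms j i ↔ i < ms[j] := by simp [InBlock, hj]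
    rw [e, List.drop_replicate, hB]
    by_cases hi : i < ms[j]
    · obtain ⟨k, hk⟩ : ∃ k, (ms[j] : ℕ) - i = k + 1 := ⟨ms[j] - i - 1, by omega⟩
      simp [hk, List.replicate_succ, hi]
    · have : (ms[j] : ℕ) - i = 0 := by omega
      simp [this, hi]
  · have : ms.drop j = [] := List.drop_eq_nil_of_le (by omega)
    have h' : ms[j]? = none := by simpa using hj
    simp [this, encodeSizes, takeOnes, InBlock, h']

/-- An error is never forgotten. -/
theorem run_parseActions_false (p l : List Bool) : parseActions.run p l [false] = [false] := by
  suffices h : ∀ n l, (parseActions.step^[n] (p, l, [false])).2.2 = [false] from h _ _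
  intro n
  induction n with
  | zero => exact fun _ => rfl
  | succ n ih =>
    intro l
    rw [Function.iterate_succ_apply]
    rcases parseActions.step_cases p l [false] with ⟨_, e⟩ | ⟨r, _, e⟩ | ⟨b, r, _, e⟩ |
      ⟨j, i, r, _, e⟩ | ⟨_, e⟩ <;> rw [e] <;> exact ih _

theorem run_parseActions_encode {ms : List ℕ+} {e : RawExpr} (he : e.InRange ms) (l : List Bool)
    (c : ℕ) : parseActions.run (encodeSizes ms) (e.encode ++ l) (List.replicate (c + 1) true) =
      parseActions.run (encodeSizes ms) l (List.replicate c true) := by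
  induction e generalizing l c with
  | var j i =>
    have := parseActions.run_var (encodeSizes ms) j i l (List.replicate (c + 1) true)
    rcases parseActions_var ms j i c with h | h
    · simpa [RawExpr.encode, varCode, h.1] using this
    · exact absurd he h.2
  | neg e ih =>
    rw [RawExpr.encode, List.cons_append, List.cons_append, TokenActions.run_neg]
    exact ih he l c
  | and e₁ e₂ ih₁ ih₂ | or e₁ e₂ ih₁ ih₂ =>
    -- A binary symbol raises the counter from `c + 1` to `c + 2`; the two operands bring it down to
    -- `c`.
    have h1 := ih₁ he.1 (e₂.encode ++ l) (c + 1)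
    have h2 := ih₂ he.2 l c
    simp only [RawExpr.encode, List.cons_append, TokenActions.run_bin, List.append_assoc]
    rw [← h2, ← h1]
    rfl

/-- Counters other than 1 are needed because operands are read one after the other: a run from `c`
to the empty counter has read `c` expressions. A connective is then put in front of the first one or
two expressions of what follows it. -/
theorem exists_of_run_parseActions (ms : List ℕ+) (n : ℕ) : ∀ (l : List Bool) (c : ℕ),
    l.length ≤ n → parseActions.run (encodeSizes ms) l (List.replicate c true) = [] →
    ∃ es : List RawExpr, es.length = c ∧ (∀ e ∈ es, e.InRange ms) ∧
      l = (es.map RawExpr.encode).flatten := by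
  induction n with
  | zero =>
    intro l c hl h
    obtain rfl : l = [] := List.length_eq_zero_iff.1 (by omega)
    exact ⟨[], (by simpa using h : c = 0).symm, by simp, rfl⟩
  | succ n ih =>
    intro l c hl h
    have hbad : ∀ r, parseActions.run (encodeSizes ms) r [false] ≠ [] := fun r => by
      simp [run_parseActions_false]
    rcases parseActions.step_cases (encodeSizes ms) l (List.replicate c true) with ⟨rfl, e⟩ |
      ⟨r, rfl, e⟩ | ⟨b, r, rfl, e⟩ | ⟨j, i, r, rfl, e⟩ | ⟨h', e⟩
    · exact ⟨[], (by simpa using h : c = 0).symm, by simp, rfl⟩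
    · rw [TokenActions.run_neg] at h
      rcases c with _ | c
      · exact absurd h (hbad _)
      · obtain ⟨es, hc, hes, rfl⟩ := ih r (c + 1) (by simp at hl; omega) h
        rcases es with _ | ⟨d, es⟩
        · simp at hc
        · exact ⟨.neg d :: es, by simpa using hc, by simpa [RawExpr.InRange] using hes,
            by simp [RawExpr.encode]⟩
    · rw [TokenActions.run_bin] at h
      rcases c with _ | c
      · exact absurd h (hbad _)
      · obtain ⟨es, hc, hes, rfl⟩ := ih r (c + 2) (by simp at hl; omega) h
        rcases es with _ | ⟨e₁, _ | ⟨e₂, es⟩⟩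
        · simp at hc
        · simp at hc
        · simp only [List.mem_cons, forall_eq_or_imp] at hes
          cases b
          · exact ⟨.and e₁ e₂ :: es, by simpa using hc,
              by simpa [RawExpr.InRange, and_assoc] using hes, by simp [RawExpr.encode]⟩
          · exact ⟨.or e₁ e₂ :: es, by simpa using hc,
              by simpa [RawExpr.InRange, and_assoc] using hes, by simp [RawExpr.encode]⟩
    · rw [TokenActions.run_var] at h
      rcases c with _ | c
      · exact absurd h (hbad _)
      · rcases parseActions_var ms j i c with ⟨e', hB⟩ | ⟨e', _⟩
        · rw [e'] at h
          obtain ⟨es, hc, hes, rfl⟩ := ih r c (by simp at hl; omega) h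
          exact ⟨.var j i :: es, by simp [hc], by simpa [RawExpr.InRange, hB] using hes,
            by simp [RawExpr.encode, varCode]⟩
        · rw [e'] at h
          exact absurd h (hbad _)
    · have := parseActions.run_of_step e (List.length_pos_iff.2 h')
      rw [this] at h
      exact absurd h (hbad _)

/-- A string which is empty if and only if `l` encodes an instance of level `n`. -/
def instanceError (n : ℕ) (l : List Bool) : List Bool :=
  headerError n l ++ parseActions.run (header n l) (body n l) [true]

theorem polyT_instanceError (n : ℕ) : PolyT (instanceError n) :=
  .append (by fun_prop) (feasible_parseActions.run (by fun_prop) (by fun_prop) (.const_list _))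

theorem Instance.instanceError_encode {n : ℕ} (F : Instance n) : instanceError n F.encode = [] := by
  obtain ⟨m, ms, rfl, e⟩ := F
  have h1 := headerError_encodeSizes (m :: ms) e.encode
  have h2 := header_encodeSizes (m :: ms) e.encode
  have h3 := body_encodeSizes (m :: ms) e.encode
  have h4 := run_parseActions_encode e.inRange_toRaw [] 0
  rw [e.encode_toRaw, List.append_nil] at h4
  simp only [List.length_cons] at h1 h2 h3
  rw [instanceError, Instance.encode]
  simp only
  rw [h1, h2, h3]
  exact h4

theorem exists_instance_of_instanceError {n : ℕ} (hn : 1 ≤ n) {l : List Bool}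
    (h : instanceError n l = []) : ∃ F : Instance n, F.encode = l := by
  obtain ⟨h1, h2⟩ := List.append_eq_nil_iff.1 h
  obtain ⟨ms, rfl, r, rfl⟩ := exists_of_headerError h1
  rw [header_encodeSizes, body_encodeSizes] at h2
  obtain ⟨es, hc, hes, rfl⟩ := exists_of_run_parseActions ms r.length r 1 le_rfl h2
  obtain ⟨e, rfl⟩ := List.length_eq_one_iff.1 hc
  rcases ms with _ | ⟨m, ms⟩
  · simp at hn
  · obtain ⟨e', rfl⟩ := (hes e (by simp)).exists_expr
    exact ⟨⟨m, ms, rfl, e'⟩, by simp [Instance.encode, Expr.encode_toRaw]⟩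

end Recognition
/-! ### Reductions given by computable functions on strings -/

section Reductions

theorem StrongReduces.of_polyT {φ ψ : PromiseProblem} {T : List Bool → List Bool} (hT : PolyT T)
    (hne : ∀ s : Str, T s.1 ≠ []) (h : ∀ s : Str, (ψ ⟨T s.1, hne s⟩).1 ⊆ (φ s).1) :
    StrongReduces φ ψ :=
  ⟨fun s => ⟨T s.1, hne s⟩, hT.polyTime _ fun _ => rfl, h⟩

theorem promiseProblem_apply {n : ℕ} (A : Instance n → Answers) {s : Str} {F : Instance n}
    (h : F.encode = s.1) : (promiseProblem n A s).1 = (A F).1 := by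
  ext b
  refine ⟨fun hb => hb F h, fun hb G hG => ?_⟩
  rwa [Instance.encode_injective n (hG.trans h.symm)]

theorem Instance.encode_ne_nil {n : ℕ} (F : Instance n) : F.encode ≠ [] := by
  simp [Instance.encode, encodeSizes]

/-- A string that encodes no instance admits both answers in the source problem, so `T` may do
anything there. -/
theorem StrongReduces.of_instances {n n' : ℕ} {A : Instance n → Answers}
    {A' : Instance n' → Answers} {T : List Bool → List Bool} (hT : PolyT T)
    (h : ∀ F : Instance n, ∃ G : Instance n', G.encode = T F.encode ∧ (A' G).1 ⊆ (A F).1) :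
    StrongReduces (promiseProblem n A) (promiseProblem n' A') := by
  -- Reductions must produce nonempty strings; an empty value of `T` is replaced by `[true]`, and
  -- any other value is kept.
  refine .of_polyT (T := fun l => bcase (T l) [true] (fun r => true :: r) (fun r => false :: r))
    (polyT_bcase hT (.const_list _) (by fun_prop) (by fun_prop)) (fun s => ?_) fun s b hb F hF => ?_
  · rcases T s.1 with _ | ⟨_ | _, r⟩ <;> simp
  · obtain ⟨G, hG, hGF⟩ := h F
    refine hGF (hb G ?_)
    have hne := G.encode_ne_nil
    rw [hG, hF] at hne ⊢
    generalize T s.1 = l at hne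
    rcases l with _ | ⟨_ | _, r⟩
    exacts [absurd rfl hne, rfl, rfl]

theorem StrongReduces.of_answers {n : ℕ} {A A' : Instance n → Answers}
    (h : ∀ F : Instance n, (A' F).1 ⊆ (A F).1) :
    StrongReduces (promiseProblem n A) (promiseProblem n A') :=
  .of_instances PolyT.id' fun F => ⟨F, rfl, h F⟩

@[simp] theorem Answers.mem_neg {A : Answers} {b : Bool} : b ∈ A.neg.1 ↔ (!b) ∈ A.1 := by
  constructor
  · rintro ⟨c, hc, rfl⟩
    simpa using hc
  · exact fun h => ⟨_, h, by simp⟩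

theorem Answers.neg_neg (A : Answers) : A.neg.neg = A :=
  Subtype.ext (Set.ext fun b => by simp)

theorem PromiseProblem.dual_dual (φ : PromiseProblem) : φ.dual.dual = φ :=
  funext fun _ => Answers.neg_neg _

theorem StrongReduces.dual {φ ψ : PromiseProblem} (h : StrongReduces φ ψ) :
    StrongReduces φ.dual ψ.dual := by
  obtain ⟨μ, hμ, h⟩ := h
  refine ⟨μ, hμ, fun s b hb => ?_⟩
  have hb := Answers.mem_neg.1 hb
  exact Answers.mem_neg.2 (h s hb)

theorem dual_promiseProblem {n : ℕ} (A : Instance n → Answers) :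
    (promiseProblem n A).dual = promiseProblem n fun F => (A F).neg := by
  funext s
  refine Subtype.ext (Set.ext fun b => ?_)
  refine Answers.mem_neg.trans ?_
  exact forall_congr' fun F => imp_congr_right fun _ => Answers.mem_neg.symm

theorem decisionProblem_apply {n : ℕ} (P : Instance n → Prop) {s : Str} {F : Instance n}
    (h : F.encode = s.1) : decisionProblem n P s = true ↔ P F := by
  simp only [decisionProblem, decide_eq_true_eq]
  refine ⟨?_, fun hF => ⟨F, h, hF⟩⟩
  rintro ⟨G, hG, hP⟩
  rwa [Instance.encode_injective n (h.trans hG.symm)]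

theorem decisionProblem_eq_false {n : ℕ} (P : Instance n → Prop) {s : Str}
    (h : ¬ ∃ F : Instance n, F.encode = s.1) : decisionProblem n P s = false := by
  simp only [decisionProblem, decide_eq_false_iff_not]
  rintro ⟨G, hG, -⟩
  exact h ⟨G, hG⟩

end Reductions

/-! ### Quantified formulas -/

section Formulas

/-- The two equivalences are proved together because removing a quantifier exchanges the two kinds
of formula. -/
theorem holds_not (ms : List ℕ+) : ∀ f : Inputs ms → Bool,
    (SatHolds ms (fun y => !f y) ↔ ¬ CoSatHolds ms f) ∧
    (CoSatHolds ms (fun y => !f y) ↔ ¬ SatHolds ms f) := by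
  induction ms with
  | nil => intro f; simp [SatHolds, CoSatHolds]
  | cons m ms ih =>
    intro f
    have h1 : ∀ x : Word m, fixFirst (fun y => !f y) x = fun y => !fixFirst f x y := fun _ => rfl
    simp only [SatHolds, CoSatHolds, h1, (ih _).1, (ih _).2]
    simp

theorem satHolds_not {ms : List ℕ+} {f : Inputs ms → Bool} :
    SatHolds ms (fun y => !f y) ↔ ¬ CoSatHolds ms f := (holds_not ms f).1

theorem coSatHolds_not {ms : List ℕ+} {f : Inputs ms → Bool} :
    CoSatHolds ms (fun y => !f y) ↔ ¬ SatHolds ms f := (holds_not ms f).2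

theorem holds_const (ms : List ℕ+) (b : Bool) :
    (SatHolds ms (fun _ => b) ↔ b = true) ∧ (CoSatHolds ms (fun _ => b) ↔ b = true) := by
  induction ms with
  | nil => simp [SatHolds, CoSatHolds]
  | cons m ms ih =>
    have h1 : ∀ x : Word m, fixFirst (fun _ : Inputs (m :: ms) => b) x = fun _ => b := fun _ => rfl
    simp [SatHolds, CoSatHolds, h1, ih]

theorem coSatHolds_and {ms : List ℕ+} {f : Inputs ms → Bool} {b : Bool} :
    CoSatHolds ms (fun y => b && f y) ↔ b = true ∧ CoSatHolds ms f := by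
  cases b
  · simpa using (holds_const ms false).2
  · simp

theorem coSatHolds_or {ms : List ℕ+} {f : Inputs ms → Bool} {b : Bool} :
    CoSatHolds ms (fun y => b || f y) ↔ b = true ∨ CoSatHolds ms f := by
  cases b
  · simp
  · simpa using (holds_const ms true).2

theorem satHolds_or {ms : List ℕ+} {f : Inputs ms → Bool} {b : Bool} :
    SatHolds ms (fun y => b || f y) ↔ b = true ∨ SatHolds ms f := by
  cases b
  · simp
  · simpa using (holds_const ms true).1

variable {n : ℕ}

theorem Instance.sat_iff {F : Instance n} : F.Sat ↔ F.witnesses.Nonempty := by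
  unfold Instance.Sat
  rw [SatHolds]
  rfl

theorem Instance.header_encode (F : Instance n) : header n F.encode = encodeSizes (F.m :: F.ms) := by
  have := header_encodeSizes (F.m :: F.ms) F.expr.encode
  rwa [List.length_cons, F.length_eq] at this

theorem Instance.body_encode (F : Instance n) : body n F.encode = F.expr.encode := by
  have := body_encodeSizes (F.m :: F.ms) F.expr.encode
  rwa [List.length_cons, F.length_eq] at this

/-! ### Negated instances -/

/-- The instance describing the negation of a function. -/
def Instance.negate (F : Instance n) : Instance n := { F with expr := .neg F.expr }

theorem Instance.encode_negate (F : Instance n) :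
    F.negate.encode = header n F.encode ++ ([false, false] ++ body n F.encode) := by
  rw [F.header_encode, F.body_encode]
  rfl

theorem Instance.witnesses_negate (F : Instance n) :
    F.negate.witnesses = F.counterexamples :=
  Set.ext fun x => coSatHolds_not (f := fixFirst F.fn x)

theorem Instance.counterexamples_negate (F : Instance n) :
    F.negate.counterexamples = F.witnesses :=
  Set.ext fun x => (not_congr (satHolds_not (f := fixFirst F.fn x))).trans not_not

theorem Instance.sat_negate (F : Instance n) : F.negate.Sat ↔ ¬ F.CoSat :=
  satHolds_not (f := F.fn)

theorem Instance.coSat_negate (F : Instance n) : F.negate.CoSat ↔ ¬ F.Sat :=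
  coSatHolds_not (f := F.fn)

/-- Negate the expression of an encoded instance. -/
def negateString (n : ℕ) (l : List Bool) : List Bool :=
  header n l ++ ([false, false] ++ body n l)

theorem polyT_negateString (n : ℕ) : PolyT (negateString n) :=
  .append (by fun_prop) (.append (.const_list _) (by fun_prop))

/-- Negating the expression turns the promise of at most one witness into that of at most one
counterexample, and satisfiability into failure of the universal formula. -/
theorem dual_USAT_reduces : StrongReduces (USAT n).dual (coUSAT n) := by
  classical
  rw [USAT, dual_promiseProblem]
  refine .of_instances (polyT_negateString n) fun F => ⟨F.negate, F.encode_negate, fun b hb => ?_⟩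
  refine Answers.mem_neg.2 fun h => ?_
  have := hb (by rwa [F.counterexamples_negate])
  simp only [Set.mem_singleton_iff, F.coSat_negate] at this ⊢
  simp [this]

theorem coUSAT_reduces_dual : StrongReduces (coUSAT n) (USAT n).dual := by
  classical
  rw [USAT, dual_promiseProblem]
  refine .of_instances (polyT_negateString n) fun F => ⟨F.negate, F.encode_negate, fun b hb h => ?_⟩
  have := Answers.mem_neg.1 hb (by rwa [F.witnesses_negate])
  simp only [Set.mem_singleton_iff, F.sat_negate] at this ⊢
  simpa using this

/-! ### Instances whose blocks all have length one -/

/-- An instance with blocks of length one. -/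
def Instance.unit {k : ℕ} (e : Expr (1 :: List.replicate k 1)) : Instance (k + 1) :=
  ⟨1, List.replicate k 1, by simp, e⟩

/-- The expression `x ∨ ¬ x`. -/
def Expr.tautology (ms : List ℕ+) : Expr (1 :: ms) :=
  .or (.var (.head 0)) (.neg (.var (.head 0)))

theorem Instance.sat_tautology (k : ℕ) : (Instance.unit (.tautology (.replicate k 1))).Sat := by
  have h : (Instance.unit (.tautology (.replicate k 1))).fn = fun _ => true :=
    funext fun _ => Bool.or_not_self _
  rw [Instance.Sat, h, (holds_const _ _).1]

theorem Instance.coSat_tautology (k : ℕ) :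
    (Instance.unit (.tautology (.replicate k 1))).CoSat := by
  have h : (Instance.unit (.tautology (.replicate k 1))).fn = fun _ => true :=
    funext fun _ => Bool.or_not_self _
  rw [Instance.CoSat, h, (holds_const _ _).2]

/-- Transform the encodings of instances of level `n` by `f`, and replace other strings by `l₀`. -/
def onInstances (n : ℕ) (l₀ : List Bool) (f : List Bool → List Bool) (l : List Bool) :
    List Bool := bcase (instanceError n l) (f l) (fun _ => l₀) (fun _ => l₀)

theorem polyT_onInstances (n : ℕ) (l₀ : List Bool) {f : List Bool → List Bool} (hf : PolyT f) :
    PolyT (onInstances n l₀ f) :=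
  polyT_bcase (polyT_instanceError n) hf (.const_list _) (.const_list _)

theorem onInstances_cases {n : ℕ} (hn : 1 ≤ n) (l₀ : List Bool) (f : List Bool → List Bool)
    (s : Str) : (∃ F : Instance n, F.encode = s.1 ∧ onInstances n l₀ f s.1 = f F.encode) ∨
      ((¬ ∃ F : Instance n, F.encode = s.1) ∧ onInstances n l₀ f s.1 = l₀) := by
  by_cases h : ∃ F : Instance n, F.encode = s.1
  · obtain ⟨F, hF⟩ := h
    refine .inl ⟨F, hF, ?_⟩
    rw [← hF, onInstances, F.instanceError_encode, bcase_nil]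
  · refine .inr ⟨h, ?_⟩
    rcases e : instanceError n s.1 with _ | ⟨_ | _, r⟩
    · exact absurd (exists_instance_of_instanceError hn e) h
    · simp [onInstances, e]
    · simp [onInstances, e]

/-- Reductions from decision problems, which have to treat the strings encoding no instance. -/
theorem StrongReduces.of_onInstances {n n' : ℕ} (hn : 1 ≤ n) {φ ψ : PromiseProblem}
    {f : List Bool → List Bool} (hf : PolyT f) (G₀ : Instance n')
    (h : ∀ F : Instance n, ∃ G : Instance n', G.encode = f F.encode ∧
      ∀ s t : Str, F.encode = s.1 → G.encode = t.1 → (ψ t).1 ⊆ (φ s).1)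
    (h₀ : ∀ s t : Str, (¬ ∃ F : Instance n, F.encode = s.1) → G₀.encode = t.1 →
      (ψ t).1 ⊆ (φ s).1) : StrongReduces φ ψ := by
  refine .of_polyT (polyT_onInstances n G₀.encode hf) (fun s => ?_) fun s => ?_
  · rcases onInstances_cases hn G₀.encode f s with ⟨F, -, h'⟩ | ⟨-, h'⟩ <;> rw [h']
    · obtain ⟨G, hG, -⟩ := h F
      exact hG ▸ G.encode_ne_nil
    · exact G₀.encode_ne_nil
  · rcases onInstances_cases hn G₀.encode f s with ⟨F, hF, h'⟩ | ⟨h', h''⟩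
    · obtain ⟨G, hG, hφ⟩ := h F
      exact hφ s _ hF (hG.trans h'.symm)
    · exact h₀ s _ h' h''.symm

/-- On strings that encode no instance both `SAT` and `coSAT` answer 0, so the dual answers 1; such
strings have to be recognised and sent to a tautology. -/
theorem dual_SAT_reduces (hn : 1 ≤ n) : StrongReduces (SAT n).dual (coSAT n) := by
  obtain ⟨k, rfl⟩ : ∃ k, n = k + 1 := ⟨n - 1, by omega⟩
  refine .of_onInstances hn (polyT_negateString _) (.unit (.tautology _)) (fun F => ⟨F.negate,
    F.encode_negate, fun s t hs ht b hb => ?_⟩) (fun s t hs ht b hb => ?_)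
  · refine Answers.mem_neg.2 ?_
    obtain rfl : b = decisionProblem _ _ t := hb
    have h1 := decisionProblem_apply Instance.CoSat ht
    have h2 := decisionProblem_apply Instance.Sat hs
    rw [F.coSat_negate, ← h2] at h1
    change _ = decisionProblem _ _ s
    cases h : decisionProblem (k + 1) Instance.Sat s <;> simp_all
  · refine Answers.mem_neg.2 ?_
    obtain rfl : b = decisionProblem _ _ t := hb
    have h1 := (decisionProblem_apply Instance.CoSat ht).2 (Instance.coSat_tautology k)
    change _ = decisionProblem _ _ s
    rw [h1, decisionProblem_eq_false _ hs]
    rfl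

theorem coSAT_reduces_dual (hn : 1 ≤ n) : StrongReduces (coSAT n) (SAT n).dual := by
  obtain ⟨k, rfl⟩ : ∃ k, n = k + 1 := ⟨n - 1, by omega⟩
  refine .of_onInstances hn (polyT_negateString _) (.unit (.tautology _)) (fun F => ⟨F.negate,
    F.encode_negate, fun s t hs ht b hb => ?_⟩) (fun s t hs ht b hb => ?_)
  · have hb : (!b) = decisionProblem _ _ t := Answers.mem_neg.1 hb
    have h1 := decisionProblem_apply Instance.Sat ht
    have h2 := decisionProblem_apply Instance.CoSat hs
    rw [F.sat_negate, ← h2, ← hb] at h1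
    change b = decisionProblem _ _ s
    cases h : decisionProblem (k + 1) Instance.CoSat s <;> simp_all
  · have hb : (!b) = decisionProblem _ _ t := Answers.mem_neg.1 hb
    rw [(decisionProblem_apply Instance.Sat ht).2 (Instance.sat_tautology k)] at hb
    change b = decisionProblem _ _ s
    rw [decisionProblem_eq_false _ hs]
    simpa using hb

/-! ### Instances restricted to strings with first bit one -/

/-- The instance describing the conjunction of the first bit and a function. -/
def Instance.restrict (F : Instance n) : Instance n :=
  { F with expr := .and (.var (.head ⟨0, F.m.pos⟩)) F.expr }

/-- Conjunction of the first bit with the expression of an encoded instance. -/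
def restrictString (n : ℕ) (l : List Bool) : List Bool :=
  header n l ++ ([false, true, false, true, false, false] ++ body n l)

theorem polyT_restrictString (n : ℕ) : PolyT (restrictString n) :=
  .append (by fun_prop) (.append (.const_list _) (by fun_prop))

theorem Instance.encode_restrict (F : Instance n) :
    F.restrict.encode = restrictString n F.encode := by
  rw [restrictString, F.header_encode, F.body_encode]
  rfl

theorem Instance.mem_witnesses_restrict (F : Instance n) (x : Word F.m) :
    x ∈ F.restrict.witnesses ↔ firstBit x = true ∧ x ∈ F.witnesses :=
  coSatHolds_and (b := firstBit x) (f := fixFirst F.fn x)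

-- Reductions to satisfiability and comparisons of promises.

/-- The answer of `SAT_n` on the encoding of an instance. -/
noncomputable def satAnswers (F : Instance n) : Answers := by
  classical exact ⟨{decide F.Sat}, Set.singleton_nonempty _⟩

theorem mem_satAnswers {F : Instance n} {b : Bool} : b ∈ (satAnswers F).1 ↔ (b = true ↔ F.Sat) := by
  simp only [satAnswers, Set.mem_singleton_iff]
  by_cases h : F.Sat <;> simp [h]

/-- Forgetting the answer 0 on other strings turns `SAT` into a promise problem, to which
`StrongReduces.of_instances` applies. -/
theorem satAnswers_reduces : StrongReduces (promiseProblem n satAnswers) (SAT n) := by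
  refine .of_polyT PolyT.id' (fun s => s.2) fun s b hb F hF => mem_satAnswers.2 ?_
  obtain rfl : b = decisionProblem _ _ s := hb
  exact decisionProblem_apply _ hF

theorem MaxVAL_reduces_SAT : StrongReduces (MaxVAL n) (SAT n) := by
  refine .trans (.of_instances (polyT_restrictString n) fun F => ⟨F.restrict, F.encode_restrict,
    fun b hb h => ?_⟩) satAnswers_reduces
  have hb := mem_satAnswers.1 hb
  obtain ⟨c, w, hw, rfl⟩ := firstBitMax_nonempty h.nonempty
  refine ⟨w, hw, ?_⟩
  rw [Bool.eq_iff_iff, hb, Instance.sat_iff]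
  constructor
  · rintro ⟨x, hx⟩
    obtain ⟨h1, h2⟩ := (F.mem_witnesses_restrict x).1 hx
    by_contra h3
    -- The first bit is the most significant, so a witness beginning with 1 exceeds any word
    -- beginning with 0.
    have hlt : w < toLex x := ⟨⟨0, F.m.pos⟩, fun j hj => absurd hj (by simp), by
      simp only [firstBit, Bool.not_eq_true] at h1 h3
      change ofLex w _ < x _
      rw [h1, h3]
      decide⟩
    exact absurd (hw.2 h2) (not_le_of_gt hlt)
  · intro h1
    exact ⟨ofLex w, (F.mem_witnesses_restrict _).2 ⟨h1, hw.1⟩⟩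

theorem UVAL_reduces_USAT : StrongReduces (UVAL n) (USAT n) := by
  classical
  refine .of_instances (polyT_restrictString n) fun F => ⟨F.restrict, F.encode_restrict,
    fun b hb h => ?_⟩
  obtain ⟨x, hx, hu⟩ := h
  have hb := hb (by
    rw [Set.encard_le_one_iff]
    intro y z hy hz
    rw [hu y ((F.mem_witnesses_restrict y).1 hy).2, hu z ((F.mem_witnesses_restrict z).1 hz).2])
  refine ⟨x, hx, ?_⟩
  simp only [Set.mem_singleton_iff] at hb
  rw [hb, Bool.eq_iff_iff, decide_eq_true_eq, Instance.sat_iff]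
  constructor
  · exact fun h => ⟨x, (F.mem_witnesses_restrict x).2 ⟨h, hx⟩⟩
  · rintro ⟨y, hy⟩
    obtain ⟨h1, h2⟩ := (F.mem_witnesses_restrict y).1 hy
    rwa [← hu y h2]

theorem USAT_reduces_SAT : StrongReduces (USAT n) (SAT n) := by
  classical
  refine .trans (.of_answers fun F b hb _ => ?_) satAnswers_reduces
  have hb := mem_satAnswers.1 hb
  rw [Set.mem_singleton_iff, Bool.eq_iff_iff, decide_eq_true_eq, hb]

/-- The instance is unchanged: a unique witness is in particular a witness, and the answers have the
same description. -/
theorem UVAL_reduces_VAL : StrongReduces (UVAL n) (VAL n) :=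
  .of_answers fun _ _ hb h => hb (Instance.sat_iff.2 h.exists)

theorem VAL_reduces_MaxVAL : StrongReduces (VAL n) (MaxVAL n) := by
  refine .of_answers fun F b hb h => ?_
  obtain ⟨w, hw, rfl⟩ := hb h
  exact ⟨ofLex w, hw.1, rfl⟩

end Formulas
-- Reductions that rewrite the first block.
section FirstBlock

variable {n : ℕ}

theorem exists_instance_of_raw {n : ℕ} (m : ℕ+) (ms : List ℕ+) (hn : ms.length + 1 = n)
    {e : RawExpr} (he : e.InRange (m :: ms)) : ∃ e' : Expr (m :: ms), e'.encode = e.encode ∧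
      (⟨m, ms, hn, e'⟩ : Instance n).encode = encodeSizes (m :: ms) ++ e.encode ∧
      ∀ x, e'.eval x = e.eval (getBit x) := by
  obtain ⟨e', rfl⟩ := he.exists_expr
  exact ⟨e', e'.encode_toRaw.symm, by simp [Instance.encode, e'.encode_toRaw],
    fun x => (e'.eval_toRaw x).symm⟩

theorem Instance.fn_eq (F : Instance n) (x : Inputs (F.m :: F.ms)) :
    F.fn x = F.expr.toRaw.eval (getBit x) := (F.expr.eval_toRaw x).symm

theorem Instance.body_encode_raw (F : Instance n) : body n F.encode = F.expr.toRaw.encode := by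
  rw [F.body_encode, F.expr.encode_toRaw]

@[simp] theorem getBit_zero {m : ℕ+} {ms : List ℕ+} (x : Word m) (y : Inputs ms) (i : ℕ) :
    getBit (ms := m :: ms) (x, y) 0 i = if h : i < (m : ℕ) then x ⟨i, h⟩ else false := rfl

@[simp] theorem getBit_succ {m : ℕ+} {ms : List ℕ+} (x : Word m) (y : Inputs ms) (j i : ℕ) :
    getBit (ms := m :: ms) (x, y) (j + 1) i = getBit y j i := rfl

/-! ### Complementing the first argument -/

/-- The complement of a string. -/
def complement {m : ℕ+} (x : Word m) : Word m := fun i => !x i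

@[simp] theorem complement_complement {m : ℕ+} (x : Word m) : complement (complement x) = x :=
  funext fun _ => Bool.not_not _

theorem complement_lt {m : ℕ+} {x y : Word m} (h : toLex x < toLex y) :
    toLex (complement y) < toLex (complement x) := by
  obtain ⟨i, h1, h2⟩ := h
  refine ⟨i, fun j hj => congrArg (!·) (h1 j hj).symm, ?_⟩
  change x i < y i at h2
  change (!y i) < (!x i)
  revert h2
  cases x i <;> cases y i <;> decide

theorem complement_le {m : ℕ+} {x y : Word m} (h : toLex x ≤ toLex y) :
    toLex (complement y) ≤ toLex (complement x) := by
  by_contra h'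
  have := complement_lt (not_le.1 h')
  rw [complement_complement, complement_complement] at this
  exact absurd h (not_le_of_gt this)

/-- Complementation is an order-reversing involution, so it carries the least element of the
preimage to the greatest element of the set. -/
theorem mem_firstBitMin_complement {m : ℕ+} {S : Set (Word m)} {b : Bool}
    (h : b ∈ firstBitMin {x | complement x ∈ S}) : (!b) ∈ firstBitMax S := by
  obtain ⟨w, ⟨hw, hmin⟩, rfl⟩ := h
  refine ⟨toLex (complement (ofLex w)), ⟨hw, fun v hv => ?_⟩, rfl⟩
  have h1 : toLex (complement (ofLex v)) ∈ {v | ofLex v ∈ {x | complement x ∈ S}} := by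
    change complement (complement (ofLex v)) ∈ S
    rw [complement_complement]
    exact hv
  have h2 := complement_le (hmin h1 : toLex (ofLex w) ≤ _)
  rwa [complement_complement] at h2

theorem mem_firstBitMax_complement {m : ℕ+} {S : Set (Word m)} {b : Bool}
    (h : b ∈ firstBitMax {x | complement x ∈ S}) : (!b) ∈ firstBitMin S := by
  obtain ⟨w, ⟨hw, hmax⟩, rfl⟩ := h
  refine ⟨toLex (complement (ofLex w)), ⟨hw, fun v hv => ?_⟩, rfl⟩
  have h1 : toLex (complement (ofLex v)) ∈ {v | ofLex v ∈ {x | complement x ∈ S}} := by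
    change complement (complement (ofLex v)) ∈ S
    rw [complement_complement]
    exact hv
  have h2 := complement_le (hmax h1 : _ ≤ toLex (ofLex w))
  rwa [complement_complement] at h2

/-- Negate the variables of the first block. -/
def complementVar (j i : ℕ) : RawExpr := if j = 0 then .neg (.var j i) else .var j i

/-- Negate the variables of the first block in the expression of an encoded instance. -/
def complementString (n : ℕ) (l : List Bool) : List Bool :=
  header n l ++ (substActions fun (_ : Unit) j i =>
    bcase j [false, false] (fun _ => []) (fun _ => []) ++
      true :: (j ++ false :: (i ++ [false]))).run () (body n l) []

theorem polyT_unit {α : Type} [Reg α] : PolyT fun _ : α => () :=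
  .of_regs Empty.elim fun _ r => r.elim

theorem polyT_complementString (n : ℕ) : PolyT (complementString n) := by
  refine .append (by fun_prop) (polyT_substActions ?_ polyT_unit (by fun_prop))
  refine .append (polyT_bcase (by fun_prop) (.const_list _) (.const_list _) (.const_list _)) ?_
  exact .cons _ (.append (by fun_prop) (.cons _ (.append (by fun_prop) (.const_list _))))

/-- For fixed first argument x, the rewritten expression describes the function obtained from f at
the complement of x; the other blocks are untouched, so membership in the witness set can be
compared directly. -/
theorem Instance.exists_complement (F : Instance n) : ∃ e' : Expr (F.m :: F.ms),
    ({ F with expr := e' } : Instance n).encode = complementString n F.encode ∧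
    ({ F with expr := e' } : Instance n).witnesses = {x | complement x ∈ F.witnesses} := by
  have hr : (F.expr.toRaw.subst complementVar).InRange (F.m :: F.ms) := by
    refine F.expr.inRange_toRaw.subst fun j i h => ?_
    rw [complementVar]
    split <;> exact h
  obtain ⟨e', -, h1, h2⟩ := exists_instance_of_raw F.m F.ms F.length_eq hr
  refine ⟨e', ?_, ?_⟩
  · rw [h1, complementString, F.header_encode, F.body_encode_raw,
      run_substActions_encode (G := complementVar)]
    intro j i
    rcases j with _ | j <;>
      simp [complementVar, RawExpr.encode, varCode, List.replicate_succ]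
  · have h3 : ∀ x, fixFirst (m := F.m) (ms := F.ms) e'.eval x = fixFirst F.fn (complement x) := by
      intro x
      funext y
      rw [fixFirst, h2, RawExpr.eval_subst, fixFirst, F.fn_eq]
      refine RawExpr.eval_congr (fun j i h => ?_) F.expr.inRange_toRaw
      rcases j with _ | j
      · have hi : i < (F.m : ℕ) := by simpa using h
        simp [complementVar, RawExpr.eval, hi, complement]
      · simp [complementVar, RawExpr.eval]
    ext x
    change CoSatHolds F.ms (fixFirst e'.eval x) ↔ CoSatHolds F.ms (fixFirst F.fn (complement x))
    rw [h3]

theorem complement_preimage_nonempty {m : ℕ+} {S : Set (Word m)} (h : S.Nonempty) :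
    {x | complement x ∈ S}.Nonempty := by
  obtain ⟨x, hx⟩ := h
  exact ⟨complement x, by simpa using hx⟩

theorem dual_MaxVAL_reduces : StrongReduces (MaxVAL n).dual (MinVAL n) := by
  rw [MaxVAL, dual_promiseProblem]
  refine .of_instances (polyT_complementString n) fun F => ?_
  obtain ⟨e', he, hw⟩ := F.exists_complement
  refine ⟨_, he, fun b hb => Answers.mem_neg.2 fun h => ?_⟩
  have h' := hb (Instance.sat_iff.2 (by
    rw [hw]; exact complement_preimage_nonempty (Instance.sat_iff.1 h)))
  rw [hw] at h'
  exact mem_firstBitMin_complement h'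

theorem dual_MinVAL_reduces : StrongReduces (MinVAL n).dual (MaxVAL n) := by
  rw [MinVAL, dual_promiseProblem]
  refine .of_instances (polyT_complementString n) fun F => ?_
  obtain ⟨e', he, hw⟩ := F.exists_complement
  refine ⟨_, he, fun b hb => Answers.mem_neg.2 fun h => ?_⟩
  have h' := hb (Instance.sat_iff.2 (by
    rw [hw]; exact complement_preimage_nonempty (Instance.sat_iff.1 h)))
  rw [hw] at h'
  exact mem_firstBitMax_complement h'

theorem mem_image_firstBit_complement {m : ℕ+} {S : Set (Word m)} {b : Bool}
    (h : b ∈ firstBit '' {x | complement x ∈ S}) : (!b) ∈ firstBit '' S := by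
  obtain ⟨x, hx, rfl⟩ := h
  exact ⟨complement x, hx, rfl⟩

theorem dual_VAL_reduces : StrongReduces (VAL n).dual (VAL n) := by
  nth_rw 1 [VAL]
  rw [dual_promiseProblem]
  refine .of_instances (polyT_complementString n) fun F => ?_
  obtain ⟨e', he, hw⟩ := F.exists_complement
  refine ⟨_, he, fun b hb => Answers.mem_neg.2 fun h => ?_⟩
  have h' := hb (Instance.sat_iff.2 (by
    rw [hw]; exact complement_preimage_nonempty (Instance.sat_iff.1 h)))
  rw [hw] at h'
  exact mem_image_firstBit_complement h'

theorem dual_UVAL_reduces : StrongReduces (UVAL n).dual (UVAL n) := by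
  nth_rw 1 [UVAL]
  rw [dual_promiseProblem]
  refine .of_instances (polyT_complementString n) fun F => ?_
  obtain ⟨e', he, hw⟩ := F.exists_complement
  refine ⟨_, he, fun b hb => Answers.mem_neg.2 fun h => ?_⟩
  obtain ⟨x, hx, hu⟩ := h
  have h' := hb (by
    rw [hw]
    refine ⟨complement x, by simpa using hx, fun y hy => ?_⟩
    rw [← hu _ hy, complement_complement])
  rw [hw] at h'
  exact mem_image_firstBit_complement h'

/-! ### A new first bit -/

/-- Shift the indices of the variables of the first block. -/
def shiftVar (j i : ℕ) : RawExpr := if j = 0 then .var j (i + 1) else .var j i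

/-- Add a new first bit `b` to an encoded instance with expression `e`; the new expression is
`¬ b ∨ e`. -/
def extendString (n : ℕ) (l : List Bool) : List Bool :=
  true :: (header n l ++ ([false, true, true, false, false, true, false, false] ++
    (substActions fun (_ : Unit) j i => true :: (j ++ false ::
      ((bcase j [true] (fun _ => []) (fun _ => []) ++ i) ++ [false]))).run () (body n l) []))

theorem polyT_extendString (n : ℕ) : PolyT (extendString n) := by
  refine .cons _ (.append (by fun_prop) (.append (.const_list _)
    (polyT_substActions ?_ polyT_unit (by fun_prop))))
  exact .cons _ (.append (by fun_prop) (.cons _ (.append (.append (polyT_bcase (by fun_prop)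
    (.const_list _) (.const_list _) (.const_list _)) (by fun_prop)) (.const_list _))))

/-- A string without its first bit. -/
def wordTail {m : ℕ+} (x : Word (m + 1)) : Word m := fun i => x i.succ

/-- The expression `¬ b ∨ e`, where `b` is a new first bit. -/
def extendExpr (e : RawExpr) : RawExpr := .or (.neg (.var 0 0)) (e.subst shiftVar)

theorem Instance.exists_extend (F : Instance n) : ∃ e' : Expr ((F.m + 1) :: F.ms),
    (⟨F.m + 1, F.ms, F.length_eq, e'⟩ : Instance n).encode = extendString n F.encode ∧
    (⟨F.m + 1, F.ms, F.length_eq, e'⟩ : Instance n).witnesses =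
      {x | firstBit x = true → wordTail x ∈ F.witnesses} := by
  have hr : (extendExpr F.expr.toRaw).InRange ((F.m + 1) :: F.ms) := by
    refine ⟨by simp [RawExpr.InRange], F.expr.inRange_toRaw.subst fun j i h => ?_⟩
    rcases j with _ | j
    · simpa [shiftVar, RawExpr.InRange] using h
    · simpa [shiftVar, RawExpr.InRange] using h
  obtain ⟨e', -, h1, h2⟩ := exists_instance_of_raw (F.m + 1) F.ms F.length_eq hr
  refine ⟨e', ?_, ?_⟩
  · rw [h1, extendString, F.header_encode, F.body_encode_raw,
      run_substActions_encode (G := shiftVar)]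
    · simp [extendExpr, RawExpr.encode, varCode, encodeSizes, List.replicate_succ]
    · intro j i
      rcases j with _ | j <;> simp [shiftVar, RawExpr.encode, varCode, List.replicate_succ]
  · have h3 : ∀ x, fixFirst (m := F.m + 1) (ms := F.ms) e'.eval x =
        fun y => !firstBit x || fixFirst F.fn (wordTail x) y := by
      intro x
      funext y
      rw [fixFirst, h2, extendExpr, RawExpr.eval, RawExpr.eval_subst, fixFirst, F.fn_eq]
      -- The new variable has index 0 of block 0, and the old indices of that block go up by one, so
      -- the old expression sees `wordTail x`.
      refine congrArg₂ _ (by simp [RawExpr.eval, firstBit]) ?_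
      refine RawExpr.eval_congr (fun j i h => ?_) F.expr.inRange_toRaw
      rcases j with _ | j
      · have hi : i < (F.m : ℕ) := by simpa using h
        simp [shiftVar, RawExpr.eval, hi, wordTail]
      · simp [shiftVar, RawExpr.eval]
    ext x
    change CoSatHolds F.ms (fixFirst e'.eval x) ↔
      (firstBit x = true → CoSatHolds F.ms (fixFirst F.fn (wordTail x)))
    rw [h3, coSatHolds_or]
    cases firstBit x <;> simp

theorem firstBitMax_eq_true {m : ℕ+} {S : Set (Word m)} {x : Word m} (hx : x ∈ S)
    (h : firstBit x = true) {b : Bool} (hb : b ∈ firstBitMax S) : b = true := by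
  obtain ⟨w, hw, rfl⟩ := hb
  by_contra h3
  have hlt : w < toLex x := ⟨⟨0, m.pos⟩, fun j hj => absurd hj (by simp), by
    simp only [firstBit, Bool.not_eq_true] at h h3
    change ofLex w _ < x _
    rw [h, h3]
    decide⟩
  exact absurd (hw.2 hx) (not_le_of_gt hlt)

/-- All words beginning with 0 are witnesses of the extended instance, so the promise always holds;
those beginning with 1 come from witnesses of the given instance. Strings encoding no instance are
sent to one whose witnesses all begin with 0, which yields the required answer 0. -/
theorem SAT_reduces_MaxVAL (hn : 1 ≤ n) : StrongReduces (SAT n) (MaxVAL n) := by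
  obtain ⟨k, rfl⟩ : ∃ k, n = k + 1 := ⟨n - 1, by omega⟩
  refine .of_onInstances hn (polyT_extendString (k + 1))
    (Instance.unit (k := k) (.neg (.var (.head 0)))) (fun F => ?_) (fun s t hs ht b hb => ?_)
  · obtain ⟨e', he, hw⟩ := F.exists_extend
    refine ⟨_, he, fun s t hs ht b hb => ?_⟩
    rw [MaxVAL, promiseProblem_apply _ ht] at hb
    have hb := hb (Instance.sat_iff.2 (by
      rw [hw]
      exact ⟨fun _ => false, fun h => by simp [firstBit] at h⟩))
    rw [hw] at hb
    change b = decisionProblem _ _ s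
    rw [Bool.eq_iff_iff, decisionProblem_apply _ hs, Instance.sat_iff]
    constructor
    · obtain ⟨w, hw', rfl⟩ := hb
      exact fun h => ⟨_, hw'.1 h⟩
    · rintro ⟨x, hx⟩
      refine firstBitMax_eq_true (x := fun i : Fin (F.m + 1) => Fin.cases true x i) ?_ rfl hb
      exact fun _ => hx
  · rw [MaxVAL, promiseProblem_apply _ ht] at hb
    have hw : ∀ x, x ∈ (Instance.unit (k := k) (.neg (.var (.head 0)))).witnesses ↔
        firstBit x = false := by
      intro x
      refine (holds_const _ (!firstBit x)).2.trans ?_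
      cases firstBit x <;> simp
    have hb := hb (Instance.sat_iff.2 ⟨fun _ => false, (hw _).2 rfl⟩)
    obtain ⟨w, hw', rfl⟩ := hb
    change _ = decisionProblem _ _ s
    rw [decisionProblem_eq_false _ hs]
    exact (hw _).1 hw'.1

end FirstBlock
/-! ### Quantified formulas over infinite strings -/

section BitGames

/-- Prepend a block to an assignment. -/
def consBlock (X : ℕ → Bool) (v : ℕ → ℕ → Bool) : ℕ → ℕ → Bool
  | 0 => X
  | j + 1 => v j

mutual

/-- The quantified formula `∃ X₀, ∀ X₁, …, p (X₀, X₁, …)` with `k` infinite blocks. -/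
def SatBits : ℕ → ((ℕ → ℕ → Bool) → Prop) → Prop
  | 0, p => p fun _ _ => false
  | k + 1, p => ∃ X, CoSatBits k fun v => p (consBlock X v)

/-- The quantified formula `∀ X₀, ∃ X₁, …, p (X₀, X₁, …)` with `k` infinite blocks. -/
def CoSatBits : ℕ → ((ℕ → ℕ → Bool) → Prop) → Prop
  | 0, p => p fun _ _ => false
  | k + 1, p => ∀ X, SatBits k fun v => p (consBlock X v)

end

theorem bits_const (k : ℕ) (P : Prop) :
    (SatBits k (fun _ => P) ↔ P) ∧ (CoSatBits k (fun _ => P) ↔ P) := by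
  induction k with
  | zero => simp [SatBits, CoSatBits]
  | succ k ih => simp [SatBits, CoSatBits, ih]

/-- The blocks of the given lengths at the beginning of an assignment. -/
def ofBits : (ms : List ℕ+) → (ℕ → ℕ → Bool) → Inputs ms
  | [], _ => ()
  | _ :: ms, v => (fun i => v 0 i, ofBits ms fun j => v (j + 1))

theorem ofBits_congr : ∀ {ms : List ℕ+} {v w : ℕ → ℕ → Bool},
    (∀ j i, InBlock ms j i → v j i = w j i) → ofBits ms v = ofBits ms w
  | [], _, _, _ => rfl
  | m :: ms, v, w, h => Prod.ext (funext fun i => h 0 i (by simp))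
      (ofBits_congr fun j i hi => h (j + 1) i (by simpa using hi))

theorem getBit_ofBits : ∀ {ms : List ℕ+} {v : ℕ → ℕ → Bool} {j i : ℕ}, InBlock ms j i →
    getBit (ofBits ms v) j i = v j i
  | [], _, _, _, h => absurd h (inBlock_nil _ _)
  | m :: ms, v, 0, i, h => by
    have hi : i < (m : ℕ) := by simpa using h
    simp [ofBits, hi]
  | m :: ms, v, j + 1, i, h =>
    getBit_ofBits (v := fun j => v (j + 1)) ((inBlock_cons_succ m ms j i).1 h)

theorem exists_extension {m : ℕ+} (x : Word m) : ∃ X : ℕ → Bool, (fun i : Fin m => X i) = x :=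
  ⟨fun i => if h : i < (m : ℕ) then x ⟨i, h⟩ else false, by simp⟩

/-- Only finitely many bits of a block are read, so quantifying over infinite strings is the same;
surplus blocks are vacuous. Thus blocks of different lengths and in different numbers become
comparable. -/
theorem holds_iff_bits {ms : List ℕ+} {k : ℕ} (h : ms.length ≤ k) (f : Inputs ms → Bool) :
    (SatHolds ms f ↔ SatBits k fun v => f (ofBits ms v) = true) ∧
    (CoSatHolds ms f ↔ CoSatBits k fun v => f (ofBits ms v) = true) := by
  induction ms generalizing k with
  | nil =>
    have := bits_const k (f () = true)
    exact ⟨by rw [SatHolds]; exact this.1.symm, by rw [CoSatHolds]; exact this.2.symm⟩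
  | cons m ms ih =>
    obtain ⟨k, rfl⟩ : ∃ k', k = k' + 1 := ⟨k - 1, by simp at h; omega⟩
    have h : ms.length ≤ k := by simpa using h
    simp only [SatHolds, CoSatHolds, SatBits, CoSatBits, (ih h _).1, (ih h _).2]
    constructor
    · constructor
      · rintro ⟨x, hx⟩
        obtain ⟨X, rfl⟩ := exists_extension x
        exact ⟨X, hx⟩
      · rintro ⟨X, hX⟩
        exact ⟨fun i => X i, hX⟩
    · constructor
      · exact fun h X => h fun i => X i
      · intro h x
        obtain ⟨X, rfl⟩ := exists_extension x
        exact h X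

/-- The assignment whose blocks have the bits of `X` before those of `Y`. -/
def mergeBits (N : ℕ) (X Y : ℕ → Bool) (i : ℕ) : Bool := if i < N then X i else Y (i - N)

/-- Two independent formulas, which use different bits of each block, may be evaluated
separately. -/
theorem bits_and (N k : ℕ) {p q : (ℕ → ℕ → Bool) → Prop}
    (hp : ∀ v w, (∀ j i, i < N → v j i = w j i) → (p v ↔ p w)) :
    (SatBits k (fun v => p v ∧ q fun j i => v j (i + N)) ↔ SatBits k p ∧ SatBits k q) ∧
    (CoSatBits k (fun v => p v ∧ q fun j i => v j (i + N)) ↔ CoSatBits k p ∧ CoSatBits k q) := by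
  induction k generalizing p q with
  | zero => simp [SatBits, CoSatBits]
  | succ k ih =>
    have hloc : ∀ X v w, (∀ j i, i < N → v j i = w j i) →
        (p (consBlock X v) ↔ p (consBlock X w)) := fun X v w h => hp _ _ fun j i hi => by
      rcases j with _ | j
      exacts [rfl, h j i hi]
    have hq : ∀ X v, (fun j i => consBlock X v j (i + N)) =
        consBlock (fun i => X (i + N)) fun j i => v j (i + N) := fun X v => by
      funext j i
      rcases j with _ | j <;> rfl
    -- `p` sees only the first `N` bits of the merged block, which are those of `X`; the shifted
    -- bits seen by `q` are those of `Y`.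
    have hm : ∀ X Y, (fun v => p (consBlock (mergeBits N X Y) v)) = fun v => p (consBlock X v) :=
      fun X Y => funext fun v => propext <| hp _ _ fun j i hi => by
        rcases j with _ | j
        exacts [if_pos hi, rfl]
    have hm' : ∀ X Y, (fun i => mergeBits N X Y (i + N)) = Y := fun X Y => by
      funext i
      simp [mergeBits]
    have key := fun X => ih (p := fun v => p (consBlock X v))
      (q := fun v => q (consBlock (fun i => X (i + N)) v)) (hloc X)
    simp only [SatBits, CoSatBits, hq, (key _).1, (key _).2]
    constructor
    · constructor
      · rintro ⟨X, h1, h2⟩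
        exact ⟨⟨X, h1⟩, _, h2⟩
      · rintro ⟨⟨X, h1⟩, Y, h2⟩
        exact ⟨mergeBits N X Y, by rwa [hm], by rwa [hm']⟩
    · constructor
      · intro h
        refine ⟨fun X => (h X).1, fun Y => ?_⟩
        -- Any block whose bits from `N` on are those of `Y` would do.
        have := (h (mergeBits N Y Y)).2
        rwa [hm'] at this
      · exact fun h X => ⟨h.1 X, h.2 _⟩

end BitGames

/-! ### Comparing strings -/

section Comparison

/-- If `r` expresses that the bits from `i + 1` on of block `1`, shifted by `N`, are greater than
those of block `0`, then this expression does so for the bits from `i` on. -/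
def greaterStep (N i : ℕ) (r : RawExpr) : RawExpr :=
  .or (.and (.var 1 (i + N)) (.neg (.var 0 i)))
    (.and (.or (.var 1 (i + N)) (.neg (.var 0 i))) r)

/-- The first `k` bits of block `1`, shifted by `N`, are greater than those of block `0`, or they
are equal and `r` holds. -/
def greaterOr (N : ℕ) : ℕ → RawExpr → RawExpr
  | 0, r => r
  | k + 1, r => greaterOr N k (greaterStep N k r)

/-- A contradiction. -/
def RawExpr.absurd : RawExpr := .and (.var 0 0) (.neg (.var 0 0))

/-- The expression mentions `r` only once, whereas spelling out the equality of two bits by cases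
could duplicate it. This keeps the nested comparison polynomial in size. -/
theorem eval_greaterStep (N i : ℕ) (r : RawExpr) (v : ℕ → ℕ → Bool) :
    (greaterStep N i r).eval v = true ↔
      (v 0 i = false ∧ v 1 (i + N) = true) ∨ v 0 i = v 1 (i + N) ∧ r.eval v = true := by
  simp only [greaterStep, RawExpr.eval]
  cases v 0 i <;> cases v 1 (i + N) <;> cases r.eval v <;> decide

theorem eval_greaterOr (N k : ℕ) (r : RawExpr) (v : ℕ → ℕ → Bool) :
    (greaterOr N k r).eval v = true ↔
      (∃ i < k, (∀ j < i, v 0 j = v 1 (j + N)) ∧ v 0 i = false ∧ v 1 (i + N) = true) ∨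
        (∀ j < k, v 0 j = v 1 (j + N)) ∧ r.eval v = true := by
  induction k generalizing r with
  | zero => simp [greaterOr]
  | succ k ih =>
    rw [greaterOr, ih, eval_greaterStep]
    constructor
    · rintro (⟨i, hi, h⟩ | ⟨h, h' | ⟨h', hr⟩⟩)
      · exact .inl ⟨i, by omega, h⟩
      · exact .inl ⟨k, by omega, h, h'⟩
      · refine .inr ⟨fun j hj => ?_, hr⟩
        rcases Nat.lt_succ_iff_lt_or_eq.1 hj with hj | rfl
        exacts [h j hj, h']
    · rintro (⟨i, hi, h, h'⟩ | ⟨h, hr⟩)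
      · rcases Nat.lt_succ_iff_lt_or_eq.1 hi with hi | rfl
        exacts [.inl ⟨i, hi, h, h'⟩, .inr ⟨h, .inl h'⟩]
      · exact .inr ⟨fun j hj => h j (by omega), .inr ⟨h k (by omega), hr⟩⟩

theorem eval_greaterOr_absurd {m : ℕ+} (N : ℕ) (v : ℕ → ℕ → Bool) {x y : Word m}
    (hx : ∀ i : Fin m, v 0 i = x i) (hy : ∀ i : Fin m, v 1 (i + N) = y i) :
    (greaterOr N m .absurd).eval v = true ↔ toLex x < toLex y := by
  rw [eval_greaterOr]
  have h0 : RawExpr.absurd.eval v = false := by simp [RawExpr.absurd, RawExpr.eval]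
  simp only [h0, Bool.false_eq_true, and_false, or_false]
  constructor
  · rintro ⟨i, hi, h1, h2, h3⟩
    refine ⟨⟨i, hi⟩, fun j hj => ?_, ?_⟩
    · have := h1 j hj
      rwa [hx j, hy j] at this
    · change x _ < y _
      rw [← hx, ← hy, h2, h3]
      decide
  · rintro ⟨i, h1, h2⟩
    change x i < y i at h2
    rw [Bool.lt_iff, ← hx, ← hy] at h2
    refine ⟨i, i.2, fun j hj => ?_, h2⟩
    have := h1 ⟨j, hj.trans i.2⟩ hj
    change x _ = y _ at this
    rwa [← hx, ← hy] at this

theorem inRange_greaterOr {ms : List ℕ+} {N k : ℕ} {r : RawExpr} (h0 : ∀ i < k, InBlock ms 0 i)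
    (h1 : ∀ i < k, InBlock ms 1 (i + N)) (hr : r.InRange ms) : (greaterOr N k r).InRange ms := by
  induction k generalizing r with
  | zero => exact hr
  | succ k ih =>
    have h0' := h0 k (by omega)
    have h1' := h1 k (by omega)
    exact ih (fun i hi => h0 i (by omega)) (fun i hi => h1 i (by omega))
      ⟨⟨h1', h0'⟩, ⟨h1', h0'⟩, hr⟩

/-- The string of `greaterStep`. -/
def greaterStepString (N i r : List Bool) : List Bool :=
  [false, true, true, false, true, false, true, true, false] ++ ((i ++ N) ++
    ([false, false, false, true, false] ++ (i ++
      ([false, false, true, false, false, true, true, true, true, false] ++ ((i ++ N) ++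
        ([false, false, false, true, false] ++ (i ++ (false :: r))))))))

theorem greaterStepString_encode (N i : ℕ) (r : RawExpr) :
    greaterStepString (List.replicate N true) (List.replicate i true) r.encode =
      (greaterStep N i r).encode := by
  simp [greaterStepString, greaterStep, RawExpr.encode, varCode, List.replicate_add,
    List.replicate_succ, -List.replicate_append_replicate]

/-- The string of `greaterOr`. -/
def greaterOrString (N k r : List Bool) : List Bool :=
  listRec (fun _ N i r => greaterStepString N i r) N k r

theorem greaterOrString_encode (N k : ℕ) (r : RawExpr) :
    greaterOrString (List.replicate N true) (List.replicate k true) r.encode =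
      (greaterOr N k r).encode := by
  induction k generalizing r with
  | zero => rfl
  | succ k ih =>
    rw [greaterOr, ← ih, ← greaterStepString_encode, List.replicate_succ]
    rfl

theorem polyT_greaterOrString {α : Type} [Reg α] {N k r : α → List Bool} (hN : PolyT N)
    (hk : PolyT k) (hr : PolyT r) : PolyT fun a => greaterOrString (N a) (k a) (r a) := by
  -- Each round adds four copies of `i`, two of `N` and 30 further symbols. The unread part of the
  -- unary counter is the index `i` itself.
  refine polyT_listRec (fun _ => ?_) (4 * Polynomial.X + 30) (fun _ N i r => ?_) hN hk hr
  · unfold greaterStepString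
    refine .append (.const_list _) (.append (by fun_prop) (.append (.const_list _)
      (.append (by fun_prop) (.append (.const_list _) (.append (by fun_prop)
        (.append (.const_list _) (by fun_prop)))))))
  · simp [greaterStepString]
    omega

end Comparison

/-! ### The greatest element as a unique element -/

section GreatestUnique

variable {n : ℕ}

/-- Move the variables to the next block and shift their indices. -/
def shiftBlocks (N j i : ℕ) : RawExpr := .var (j + 1) (i + N)

/-- The expression which describes that `x` in block `0` belongs to the set described by `e` and
is its greatest element. -/
def greatestExpr (N m : ℕ) (e : RawExpr) : RawExpr :=
  .and e (.or (.neg (greaterOr N m .absurd)) (.neg (e.subst (shiftBlocks N))))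

/-- `k` block lengths in unary, which are all equal to `2 N`. -/
def blocksString : ℕ → List Bool → List Bool
  | 0, _ => []
  | k + 1, N => N ++ (N ++ false :: blocksString k N)

theorem blocksString_replicate (k : ℕ) (N : ℕ) (B : ℕ+) (hB : (B : ℕ) = N + N) :
    blocksString k (List.replicate N true) = encodeSizes (List.replicate k B) := by
  induction k with
  | zero => rfl
  | succ k ih =>
    simp [blocksString, ih, List.replicate_succ, encodeSizes, hB, List.replicate_add,
      -List.replicate_append_replicate]

theorem polyT_blocksString {α : Type} [Reg α] {N : α → List Bool} (hN : PolyT N) (k : ℕ) :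
    PolyT fun a => blocksString k (N a) := by
  induction k with
  | zero => exact .nil
  | succ k ih => exact .append hN (.append hN (.cons _ ih))

/-- Transform an encoded instance of level `n` into one of level `n + 1` which describes the
greatest element. -/
def greatestString (n : ℕ) (l : List Bool) : List Bool :=
  takeOnes l ++ false :: (blocksString n (ones l) ++ ([false, true, false] ++ (body n l ++
    ([false, true, true, false, false] ++ (greaterOrString (ones l) (takeOnes l)
      RawExpr.absurd.encode ++ ([false, false] ++ (substActions fun N j i =>
        true :: ((true :: j) ++ false :: ((i ++ N) ++ [false]))).run (ones l) (body n l) []))))))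

theorem polyT_greatestString (n : ℕ) : PolyT (greatestString n) := by
  refine .append (by fun_prop) (.cons _ (.append (polyT_blocksString (by fun_prop) n)
    (.append (.const_list _) (.append (by fun_prop) (.append (.const_list _) (.append
      (polyT_greaterOrString (by fun_prop) (by fun_prop) (.const_list _)) (.append (.const_list _)
        (polyT_substActions ?_ (by fun_prop) (by fun_prop)))))))))
  exact .cons _ (.append (by fun_prop) (.cons _ (.append (by fun_prop) (.const_list _))))

theorem InBlock.lt_length : ∀ {ms : List ℕ+} {j i : ℕ}, InBlock ms j i →
    j < ms.length ∧ i < (encodeSizes ms).length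
  | [], _, _, h => absurd h (inBlock_nil _ _)
  | m :: ms, 0, i, h => by
    have hi : i < (m : ℕ) := by simpa using h
    simp [encodeSizes]
    omega
  | m :: ms, j + 1, i, h => by
    have := InBlock.lt_length ((inBlock_cons_succ m ms j i).1 h)
    simp [encodeSizes]
    omega

theorem inBlock_replicate {k : ℕ} {B : ℕ+} {j i : ℕ} :
    InBlock (List.replicate k B) j i ↔ j < k ∧ i < (B : ℕ) := by
  by_cases h : j < k <;> simp [InBlock, h]

open Classical in
/-- The value of `greatestExpr` at a string `x` and blocks given by an assignment. -/
theorem eval_greatestExpr {m : ℕ+} {ms : List ℕ+} {N : ℕ} {B : ℕ+} (hB : (B : ℕ) = N + N)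
    (hN : (encodeSizes (m :: ms)).length ≤ N) {e : RawExpr} (he : e.InRange (m :: ms)) (x : Word m)
    (v : ℕ → ℕ → Bool) :
    (greatestExpr N m e).eval (getBit (ms := m :: List.replicate (ms.length + 1) B)
      (x, ofBits (List.replicate (ms.length + 1) B) v)) = true ↔
      e.eval (getBit (ms := m :: ms) (x, ofBits ms v)) = true ∧
        (!decide (toLex x < toLex (ofBits (m :: ms) fun j i => v j (i + N)).1) ||
          !e.eval (getBit (ofBits (m :: ms) fun j i => v j (i + N)))) = true := by
  have hget : ∀ j i, j < ms.length + 1 → i < N + N →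
      getBit (ofBits (List.replicate (ms.length + 1) B) v) j i = v j i := fun j i hj hi =>
    getBit_ofBits (inBlock_replicate.2 ⟨hj, hB ▸ hi⟩)
  have hlt : ∀ j i, InBlock (m :: ms) j i → j < ms.length + 1 ∧ i < N := fun j i h =>
    ⟨h.lt_length.1, h.lt_length.2.trans_le hN⟩
  have h1 : e.eval (getBit (ms := m :: List.replicate (ms.length + 1) B)
      (x, ofBits (List.replicate (ms.length + 1) B) v)) =
      e.eval (getBit (ms := m :: ms) (x, ofBits ms v)) := by
    refine RawExpr.eval_congr (fun j i h => ?_) he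
    have := hlt j i h
    rcases j with _ | j
    · rfl
    · rw [getBit_succ, getBit_succ, hget j i (by omega) (by omega),
        getBit_ofBits ((inBlock_cons_succ m ms j i).1 h)]
  have h2 : (e.subst (shiftBlocks N)).eval
      (getBit (ms := m :: List.replicate (ms.length + 1) B)
        (x, ofBits (List.replicate (ms.length + 1) B) v)) =
      e.eval (getBit (ofBits (m :: ms) fun j i => v j (i + N))) := by
    rw [RawExpr.eval_subst]
    refine RawExpr.eval_congr (fun j i h => ?_) he
    have := hlt j i h
    rw [shiftBlocks, RawExpr.eval, getBit_succ, hget j _ (by omega) (by omega), getBit_ofBits h]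
  have h3 := eval_greaterOr_absurd (m := m) N
    (getBit (ms := m :: List.replicate (ms.length + 1) B)
      (x, ofBits (List.replicate (ms.length + 1) B) v)) (x := x)
    (y := (ofBits (m :: ms) fun j i => v j (i + N)).1) (fun i => by simp) (fun i => by
      have := hlt 0 i (by simp)
      rw [getBit_succ, hget 0 _ (by omega) (by omega)]
      rfl)
  rw [greatestExpr, RawExpr.eval, RawExpr.eval, RawExpr.eval, RawExpr.eval, h1, h2]
  rw [← decide_eq_true_iff (p := toLex x < _), ← Bool.eq_iff_iff] at h3
  rw [h3, Bool.and_eq_true]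

/-- Membership of x and maximality of x are both formulas beginning with ∀. The former uses the
first `N` bits of each new block. The latter uses the bits after these, and its block 0, the
competitor y, becomes block 1 of the new instance. -/
theorem Instance.exists_greatest (F : Instance n) : ∃ (ms : List ℕ+)
    (hms : ms.length + 1 = n + 1) (e : Expr (F.m :: ms)),
    (⟨F.m, ms, hms, e⟩ : Instance (n + 1)).encode = greatestString n F.encode ∧
    ∀ x : Word F.m, x ∈ (⟨F.m, ms, hms, e⟩ : Instance (n + 1)).witnesses ↔
      x ∈ F.witnesses ∧ ∀ y ∈ F.witnesses, ¬ toLex x < toLex y := by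
  classical
  obtain ⟨m, ms, rfl, e⟩ := F
  set F : Instance (ms.length + 1) := ⟨m, ms, rfl, e⟩ with hF
  -- The length of the encoding bounds every block length and is available in unary as `ones`, so no
  -- maximum has to be computed.
  obtain ⟨N, hN⟩ : ∃ N, F.encode.length = N := ⟨_, rfl⟩
  have hsizes : (encodeSizes (m :: ms)).length ≤ N := by
    rw [← hN]
    exact (List.prefix_append (encodeSizes (m :: ms)) e.encode).length_le
  have hm : (m : ℕ) < N := lt_of_lt_of_le (by simp [encodeSizes]) hsizes
  obtain ⟨B, hB⟩ : ∃ B : ℕ+, (B : ℕ) = N + N := ⟨⟨N + N, by omega⟩, rfl⟩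
  have he := e.inRange_toRaw
  have hr : (greatestExpr N m e.toRaw).InRange (m :: List.replicate (ms.length + 1) B) := by
    have hlt : ∀ j i, InBlock (m :: ms) j i → j < ms.length + 1 ∧ i < N := fun j i h =>
      ⟨h.lt_length.1, h.lt_length.2.trans_le hsizes⟩
    refine ⟨?_, inRange_greaterOr (fun i hi => by simpa using hi) (fun i hi => ?_)
      ⟨by simp [RawExpr.InRange], by simp [RawExpr.InRange]⟩, he.subst fun j i h => ?_⟩
    -- The first copy of the expression is not renamed, but must be in range for the longer blocks;
    -- it is viewed as its own substitution instance.
    · have := he.subst (ms' := m :: List.replicate (ms.length + 1) B) (g := .var) fun j i h => by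
        have := hlt j i h
        rcases j with _ | j
        · simpa [RawExpr.InRange] using h
        · rw [RawExpr.InRange, inBlock_cons_succ, inBlock_replicate]
          omega
      have h' : ∀ e : RawExpr, e.subst .var = e := fun e => by
        induction e <;> simp_all [RawExpr.subst]
      rwa [h'] at this
    · rw [inBlock_cons_succ, inBlock_replicate]
      omega
    · have := hlt j i h
      rw [shiftBlocks, RawExpr.InRange, inBlock_cons_succ, inBlock_replicate]
      omega
  obtain ⟨e', -, h1, h2⟩ := exists_instance_of_raw m (List.replicate (ms.length + 1) B)
    (n := ms.length + 1 + 1) (by simp) hr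
  refine ⟨_, by simp, e', ?_, fun x => ?_⟩
  · have hones : ones F.encode = List.replicate N true := by rw [ones, hN]
    have htake : takeOnes F.encode = List.replicate (m : ℕ) true := by
      simp [hF, Instance.encode, encodeSizes]
    have hb : body (ms.length + 1) F.encode = e.toRaw.encode := F.body_encode_raw
    rw [h1, greatestString, hones, htake, hb, greaterOrString_encode,
      blocksString_replicate _ _ _ hB, run_substActions_encode (G := shiftBlocks N)]
    · simp [greatestExpr, RawExpr.encode, encodeSizes]
    · intro j i
      simp [shiftBlocks, RawExpr.encode, varCode, List.replicate_succ, List.replicate_add,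
        -List.replicate_append_replicate]
  · have key := bits_and N (ms.length + 1)
      (p := fun v => fixFirst e.eval x (ofBits ms v) = true)
      (q := fun v => (fun z : Inputs (m :: ms) =>
        !decide (toLex x < toLex z.1) || !e.eval z) (ofBits (m :: ms) v) = true)
      (fun v w h => by
        rw [ofBits_congr fun j i hi => h j i ?_]
        have := ((inBlock_cons_succ m ms j i).2 hi).lt_length
        omega)
    have hG : (fun v => fixFirst (m := m) e'.eval x
          (ofBits (List.replicate (ms.length + 1) B) v) = true) =
        fun v => fixFirst e.eval x (ofBits ms v) = true ∧ (fun z : Inputs (m :: ms) =>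
        !decide (toLex x < toLex z.1) || !e.eval z)
          (ofBits (m :: ms) fun j i => v j (i + N)) = true := by
      funext v
      rw [fixFirst, h2, eval_greatestExpr hB hsizes he, e.eval_toRaw, e.eval_toRaw]
      rfl
    change CoSatHolds (List.replicate (ms.length + 1) B) (fixFirst e'.eval x) ↔
      CoSatHolds ms (fixFirst e.eval x) ∧
        ∀ y, CoSatHolds ms (fixFirst e.eval y) → ¬ toLex x < toLex y
    -- The formula for x has only `ms.length` blocks; in the joint formula its last block is a
    -- dummy.
    rw [(holds_iff_bits (k := ms.length + 1) (by simp) _).2, hG, key.2,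
      ← (holds_iff_bits (Nat.le_succ _) _).2]
    refine (and_congr_right' (holds_iff_bits (ms := m :: ms) le_rfl fun z =>
      !decide (toLex x < toLex z.1) || !e.eval z).2.symm).trans ?_
    rw [CoSatHolds]
    refine and_congr_right fun _ => forall_congr' fun y => ?_
    -- The comparison depends on x and y alone, so it can be taken out of the remaining quantifiers.
    refine (satHolds_or (b := !decide (toLex x < toLex y))
      (f := fun w => !fixFirst e.eval y w)).trans ?_
    rw [satHolds_not]
    simp only [Bool.not_eq_true', decide_eq_false_iff_not]
    tauto

/-- If there is a witness, a greatest one exists because words of a given length are finite in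
number, and it is unique by antisymmetry; so the promise of the target problem holds. -/
theorem MaxVAL_reduces_UVAL : StrongReduces (MaxVAL n) (UVAL (n + 1)) := by
  refine .of_instances (polyT_greatestString n) fun F => ?_
  obtain ⟨ms, hms, e, he, hw⟩ := F.exists_greatest
  refine ⟨_, he, fun b hb h => ?_⟩
  obtain ⟨-, w, ⟨hw1, hw2⟩, -⟩ := firstBitMax_nonempty h.nonempty
  obtain ⟨x, hx, rfl⟩ := hb ⟨ofLex w, (hw _).2 ⟨hw1, fun y hy => not_lt_of_ge (hw2 hy)⟩,
    fun y hy => by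
      obtain ⟨hy1, hy2⟩ := (hw y).1 hy
      exact congrArg ofLex (le_antisymm (hw2 hy1) (not_lt.1 (hy2 _ hw1)))⟩
  obtain ⟨hx1, hx2⟩ := (hw x).1 hx
  exact ⟨toLex x, ⟨hx1, fun y hy => not_lt.1 (hx2 _ hy)⟩, rfl⟩

end GreatestUnique
end PromiseHierarchy

-- Assembly of the theorem.

open PromiseHierarchy

theorem theorem3 (n : ℕ) (hn : 1 ≤ n) :
    PromiseHierarchy.strongClosure (PromiseHierarchy.SAT n).dual =
        PromiseHierarchy.strongClosure (PromiseHierarchy.coSAT n) ∧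
      PromiseHierarchy.strongClosure (PromiseHierarchy.MaxVAL n).dual =
        PromiseHierarchy.strongClosure (PromiseHierarchy.MinVAL n) ∧
      PromiseHierarchy.strongClosure (PromiseHierarchy.VAL n).dual =
        PromiseHierarchy.strongClosure (PromiseHierarchy.VAL n) ∧
      PromiseHierarchy.strongClosure (PromiseHierarchy.USAT n).dual =
        PromiseHierarchy.strongClosure (PromiseHierarchy.coUSAT n) ∧
      PromiseHierarchy.strongClosure (PromiseHierarchy.UVAL n).dual =
        PromiseHierarchy.strongClosure (PromiseHierarchy.UVAL n) ∧
      PromiseHierarchy.strongClosure (PromiseHierarchy.SAT n) =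
        PromiseHierarchy.strongClosure (PromiseHierarchy.MaxVAL n) ∧
      (PromiseHierarchy.StrongReduces (PromiseHierarchy.UVAL n) (PromiseHierarchy.VAL n) ∧
        PromiseHierarchy.StrongReduces (PromiseHierarchy.VAL n) (PromiseHierarchy.MaxVAL n) ∧
        PromiseHierarchy.StrongReduces (PromiseHierarchy.MaxVAL n)
          (PromiseHierarchy.UVAL (n + 1))) ∧
      (PromiseHierarchy.StrongReduces (PromiseHierarchy.UVAL n) (PromiseHierarchy.USAT n) ∧
        PromiseHierarchy.StrongReduces (PromiseHierarchy.USAT n) (PromiseHierarchy.SAT n)) := by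
  refine ⟨strongClosure_eq (dual_SAT_reduces hn) (coSAT_reduces_dual hn),
    strongClosure_eq dual_MaxVAL_reduces ?_, strongClosure_eq dual_VAL_reduces ?_,
    strongClosure_eq dual_USAT_reduces coUSAT_reduces_dual, strongClosure_eq dual_UVAL_reduces ?_,
    strongClosure_eq (SAT_reduces_MaxVAL hn) MaxVAL_reduces_SAT,
    ⟨UVAL_reduces_VAL, VAL_reduces_MaxVAL, MaxVAL_reduces_UVAL⟩,
    UVAL_reduces_USAT, USAT_reduces_SAT⟩
  -- A reduction of a dual problem is itself dualised: the same map works, and the double dual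
  -- disappears.
  · simpa only [PromiseProblem.dual_dual] using dual_MinVAL_reduces.dual
  · simpa only [PromiseProblem.dual_dual] using dual_VAL_reduces.dual
  · simpa only [PromiseProblem.dual_dual] using dual_UVAL_reduces.dual
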